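/- Let $K$ be an infinite field with $\operatorname{char}(K)\neq 2$, let $n \ge 0$, let $Q\subset K[x_1,\dots,x_n]$ be a homogeneous ideal (where $\deg x_i=1$), and put $A=K[x_1,\dots,x_n]/Q$, with graded maximal ideal $\mathfrak m=(x_1,\dots,x_n)A$. Suppose that $Q$ has a $2$-linear resolution over $P=K[x_1,\dots,x_n]$, i.e. there is an exact sequence of graded $P$-modules $\cdots\to P(-4)^{b_2}\to P(-3)^{b_1}\to P(-2)^{b_0}\to Q\to 0$ with all $b_i$ finite (the zero ideal is allowed). Let $S(\mathfrak m)$ be the symmetric algebra of the $A$-module $\mathfrak m$. (1) After a suitable linear change of the coordinates $x_1,\dots,x_n$, the defining ideal of $S(\mathfrak m)$ has a quadratic Gröbner basis with respect to the reverse lexicographic term order. Explicitly: there is a matrix $g\in GL_n(K)$ such that, with $\ell_i=\sum_j g_{ij}x_j$, the homomorphism of $K$-algebras $K[x_1,\dots,x_n,y_1,\dots,y_n]\to S(\mathfrak m)$ that maps $x_i$ to the class of $\ell_i$ in $A=S^0(\mathfrak m)$ and $y_i$ to the class of $\ell_i$ in $\mathfrak m=S^1(\mathfrak m)$ is surjective,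 and its kernel has a finite Gröbner basis consisting of forms of degree $2$ with respect to the (degree) reverse lexicographic order induced by $x_1>\dots>x_n>y_1>\dots>y_n$. (2) In particular $S(\mathfrak m)$ is Koszul: with the grading in which the classes of the $x_i$ in $S^0(\mathfrak m)$ and in $S^1(\mathfrak m)$ all have degree $1$, $S(\mathfrak m)$ is a positively graded $K$-algebra $R=K\oplus R_1\oplus R_2\oplus\cdots$, and its residue class field $K=R/R_+$ has a linear free resolution $\cdots\to R(-2)^{b_2}\to R(-1)^{b_1}\to R^{b_0}\to K\to 0$ with all $b_i$ finite. -/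

import Mathlib

open MvPolynomial

attribute [local instance] MvPolynomial.gradedAlgebra

/-! ### The (graded) reverse lexicographic term order -/

/-- A copy of the monoid of exponent vectors `σ →₀ ℕ`, to be ordered reverse lexicographically. -/
def DegRevLex (σ : Type*) : Type _ := σ →₀ ℕ

namespace DegRevLex

variable {σ : Type*}

noncomputable instance : AddCommMonoid (DegRevLex σ) :=
  inferInstanceAs (AddCommMonoid (σ →₀ ℕ))

/-- The identity map from exponent vectors to their reverse lexicographically ordered copy. -/
noncomputable def toRev : (σ →₀ ℕ) ≃+ DegRevLex σ := AddEquiv.refl _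

/-- The identity map back to exponent vectors. -/
noncomputable def ofRev : DegRevLex σ ≃+ (σ →₀ ℕ) := AddEquiv.refl _

/-- The key of an exponent vector: first the total degree is compared, and in case of equality the
exponent vectors are compared in the dual of the colexicographic order. -/
noncomputable def key (a : DegRevLex σ) : ℕ ×ₗ (Colex (σ →₀ ℕ))ᵒᵈ :=
  toLex ((ofRev a).degree, OrderDual.toDual (toColex (ofRev a)))

theorem key_injective : Function.Injective (key (σ := σ)) := by
  intro a b h
  have h2 := congrArg (fun p => (ofLex p).2) h
  exact h2

variable [LinearOrder σ]

noncomputable instance : LinearOrder (DegRevLex σ) := LinearOrder.lift' key key_injective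

theorem lt_iff {a b : DegRevLex σ} :
    a < b ↔ (ofRev a).degree < (ofRev b).degree ∨
      ((ofRev a).degree = (ofRev b).degree ∧ toColex (ofRev b) < toColex (ofRev a)) := by
  change key a < key b ↔ _
  simp [key, Prod.Lex.toLex_lt_toLex]

theorem le_iff {a b : DegRevLex σ} :
    a ≤ b ↔ (ofRev a).degree < (ofRev b).degree ∨
      ((ofRev a).degree = (ofRev b).degree ∧ toColex (ofRev b) ≤ toColex (ofRev a)) := by
  change key a ≤ key b ↔ _
  simp [key, Prod.Lex.toLex_le_toLex]

/-- The explicit form of the reverse lexicographic order: `x ^ a < x ^ b` if and only if the total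
degree of `a` is smaller, or the degrees agree and, at the largest index at which `a` and `b`
differ, the exponent in `a` is larger. -/
theorem toRev_lt_toRev_iff {a b : σ →₀ ℕ} :
    toRev a < toRev b ↔ a.degree < b.degree ∨
      (a.degree = b.degree ∧ ∃ i, (∀ j, i < j → b j = a j) ∧ b i < a i) := by
  rw [lt_iff]
  rfl

instance : IsOrderedAddMonoid (DegRevLex σ) where
  add_le_add_left a b h c := by
    rw [le_iff] at h ⊢
    simpa [map_add, toColex_add] using h

instance [Finite σ] : WellFoundedLT (DegRevLex σ) := by
  refine ⟨?_⟩
  have hfin : ∀ d : ℕ, {a : DegRevLex σ | (ofRev a).degree ≤ d}.Finite := fun d =>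
    Finsupp.finite_of_degree_le d
  refine WellFounded.intro fun a => ?_
  have hs : {b : DegRevLex σ | b ≤ a}.Finite := by
    refine (hfin (ofRev a).degree).subset fun b hb => ?_
    rcases le_iff.1 hb with h | h
    · exact h.le
    · exact h.1.le
  have hw := Set.wellFoundedOn_iff.1 (hs.wellFoundedOn (r := (· < ·)))
  have hacc : ∀ x : DegRevLex σ, x ≤ a → Acc (· < ·) x := by
    intro x
    induction hw.apply x with
    | intro x _ ih =>
      intro hx
      exact Acc.intro x fun y hy => ih y ⟨hy, hy.le.trans hx, hx⟩ (hy.le.trans hx)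
  exact hacc a le_rfl

end DegRevLex

/-- The (degree) reverse lexicographic term order on the monomials in finitely many variables
`x_i`, `i ∈ σ`, induced by `x_i > x_j` for `i < j`. -/
noncomputable def MonomialOrder.revLex (σ : Type*) [LinearOrder σ] [Finite σ] :
    MonomialOrder σ where
  syn := DegRevLex σ
  toSyn := DegRevLex.toRev
  toSyn_monotone a b h := by
    rw [DegRevLex.le_iff]
    change a.degree < b.degree ∨ (a.degree = b.degree ∧ toColex b ≤ toColex a)
    have hab : b.degree = a.degree + (b - a).degree := by
      rw [← map_add, add_tsub_cancel_of_le h]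
    rcases Nat.eq_zero_or_pos (b - a).degree with h0 | h0
    · have h1 : b - a = 0 := (Finsupp.degree_eq_zero_iff _).1 h0
      have h2 : b = a := by
        rw [← add_tsub_cancel_of_le h, h1, add_zero]
      exact Or.inr ⟨by rw [h2], by rw [h2]⟩
    · exact Or.inl (by omega)

/-! ### Gröbner bases -/

/-- The finite set `G` is a Gröbner basis of the ideal `J` with respect to the term order `m`:
it is contained in `J`, and the leading terms of its elements generate the initial ideal of `J`. -/
def IsGroebnerBasis {σ K : Type*} [CommRing K] (m : MonomialOrder σ)
    (J : Ideal (MvPolynomial σ K)) (G : Finset (MvPolynomial σ K)) : Prop :=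
  (∀ g ∈ G, g ∈ J) ∧
    Ideal.span (m.leadingTerm '' (G : Set (MvPolynomial σ K))) =
      Ideal.span (m.leadingTerm '' (J : Set (MvPolynomial σ K)))

/-- The ideal `J` has a Gröbner basis consisting of quadratic forms. -/
def HasQuadraticGroebnerBasis {σ K : Type*} [CommRing K] (m : MonomialOrder σ)
    (J : Ideal (MvPolynomial σ K)) : Prop :=
  ∃ G : Finset (MvPolynomial σ K), IsGroebnerBasis m J G ∧ ∀ g ∈ G, g.IsHomogeneous 2

/-! ### Linear resolutions and the Koszul property -/

/-- Let `R` be a graded `K`-algebra with graded pieces `𝓡 d` and `M` a graded `R`-module with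
graded pieces `ℳ d`. The module `M` has a `d`-linear resolution if it has a graded free resolution
`⋯ → R(-d-2)^{b 2} → R(-d-1)^{b 1} → R(-d)^{b 0} → M → 0`
with finite ranks: the basis of the free module in homological degree `0` is mapped to elements
of degree `d` of `M`, all the entries of the matrices of the other maps have degree `1`,
and the sequence is exact. -/
def HasLinearResolution {K R M : Type*} [CommRing K] [CommRing R] [Algebra K R]
    [AddCommGroup M] [Module K M] [Module R M]
    (𝓡 : ℕ → Submodule K R) (ℳ : ℕ → Submodule K M) (d : ℕ) : Prop :=
  ∃ (b : ℕ → ℕ) (ε : (Fin (b 0) → R) →ₗ[R] M)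
    (δ : ∀ i, (Fin (b (i + 1)) → R) →ₗ[R] (Fin (b i) → R)),
    (∀ j, ε (Pi.single j 1) ∈ ℳ d) ∧
    (∀ i j k, δ i (Pi.single j 1) k ∈ 𝓡 1) ∧
    Function.Surjective ε ∧
    Function.Exact (δ 0) ε ∧
    ∀ i, Function.Exact (δ (i + 1)) (δ i)

/-- A homogeneous ideal `Q` of a polynomial ring has a `d`-linear resolution as a graded module
over the polynomial ring. -/
def Ideal.HasLinearResolution {σ K : Type*} [CommRing K] (Q : Ideal (MvPolynomial σ K))
    (d : ℕ) : Prop :=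
  _root_.HasLinearResolution (K := K) (R := MvPolynomial σ K) (M := Q)
    (homogeneousSubmodule σ K)
    (fun e => (homogeneousSubmodule σ K e).comap (Q.subtype.restrictScalars K)) d

/-- A positively graded `K`-algebra `R = K ⊕ R_1 ⊕ R_2 ⊕ ⋯` is Koszul if the residue class field
`K = R / R_+`, with the induced grading, has a (`0`-)linear resolution over `R`. -/
def IsKoszul {K R : Type*} [Field K] [CommRing R] [Algebra K R]
    (𝓡 : ℕ → Submodule K R) [GradedAlgebra 𝓡] : Prop :=
  𝓡 0 = 1 ∧
    HasLinearResolution (K := K) (R := R) (M := R ⧸ (HomogeneousIdeal.irrelevant 𝓡).toIdeal) 𝓡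
      (fun d => (𝓡 d).map
        ((HomogeneousIdeal.irrelevant 𝓡).toIdeal.mkQ.restrictScalars K)) 0

/-! ### The symmetric algebra of the graded maximal ideal -/

section SymmetricAlgebraOfMaximalIdeal

variable {K : Type*} [Field K] {n : ℕ} (Q : Ideal (MvPolynomial (Fin n) K))

/-- The graded maximal ideal `𝔪 = (x_1, …, x_n)` of `A = K[x_1, …, x_n] / Q`. -/
noncomputable def gradedMaxIdeal : Ideal (MvPolynomial (Fin n) K ⧸ Q) :=
  (Ideal.span (Set.range X)).map (Ideal.Quotient.mk Q)

/-- The symmetric algebra `S(𝔪)` over `A = K[x_1, …, x_n] / Q` of the graded maximal ideal `𝔪`. -/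
abbrev SymMax : Type _ := SymmetricAlgebra (MvPolynomial (Fin n) K ⧸ Q) (gradedMaxIdeal Q)

/-- The linear forms `ℓ_i = ∑_j g_{ij} x_j`, which are the new coordinates of `K[x_1, …, x_n]`
given by the invertible matrix `g`. -/
noncomputable def coordForm (g : GL (Fin n) K) (i : Fin n) : MvPolynomial (Fin n) K :=
  ∑ j, C (g.val i j) * X j

theorem mk_coordForm_mem (g : GL (Fin n) K) (i : Fin n) :
    Ideal.Quotient.mk Q (coordForm g i) ∈ gradedMaxIdeal Q :=
  Ideal.mem_map_of_mem _ (Ideal.sum_mem _ fun j _ =>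
    Ideal.mul_mem_left _ _ (Ideal.subset_span ⟨j, rfl⟩))

/-- The presentation `K[x_1, …, x_n, y_1, …, y_n] → S(𝔪)` in the coordinates `ℓ_1, …, ℓ_n`: the
variable `x_i` is mapped to the class of `ℓ_i` in `A = S⁰(𝔪)`, and `y_i` to the class of `ℓ_i` in
`𝔪 = S¹(𝔪)`. The variables of the polynomial ring on the left are indexed by `Fin (n + n)`, in the
order `x_1, …, x_n, y_1, …, y_n`. -/
noncomputable def symPresentation (g : GL (Fin n) K) :
    MvPolynomial (Fin (n + n)) K →ₐ[K] SymMax Q :=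
  aeval (Fin.append
    (fun i => algebraMap (MvPolynomial (Fin n) K ⧸ Q) (SymMax Q)
      (Ideal.Quotient.mk Q (coordForm g i)))
    (fun i => SymmetricAlgebra.ι (MvPolynomial (Fin n) K ⧸ Q) (gradedMaxIdeal Q)
      ⟨Ideal.Quotient.mk Q (coordForm g i), mk_coordForm_mem Q g i⟩))

/-- The defining ideal of `S(𝔪)` in the coordinates given by `g`. -/
noncomputable def symDefiningIdeal (g : GL (Fin n) K) : Ideal (MvPolynomial (Fin (n + n)) K) :=
  RingHom.ker (symPresentation Q g)

/-- The standard (total) grading of `S(𝔪)`: the classes of the `x_i` and of the `y_i` have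
degree `1`. -/
noncomputable def symGrading (d : ℕ) : Submodule K (SymMax Q) :=
  (homogeneousSubmodule (Fin (n + n)) K d).map (symPresentation Q 1).toLinearMap

end SymmetricAlgebraOfMaximalIdeal

/-! Both claims follow from one fact: in suitable coordinates, every leading monomial of the
defining ideal `J` of S(𝔪) is divisible by the leading monomial of a quadric in `J`
(`RevLexGeneric.exists_isLead_le_of_mem_symDefiningIdeal`).

Generic coordinates. A complex with linear entries that is exact in positive coefficient degrees
forces the quotient P/Q to have no socle in degrees ≥ 2 (`exists_sub_map_mem_of_socle`,
`QuadraticComplex.Exact.mem_of_socle`). A general linear form is therefore regular on P/Q in degrees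
≥ 2, and exactness survives passing to the quotient (`QuadraticComplex.Exact.sup_span`), so the
argument can be repeated for a whole flag of linear forms. Each form is moreover chosen so that if
it lies in one of the linear colon spaces built so far (modulo the flag), that space is everything.
For the colon by the form itself this is a quadratic condition, handled by polarizing squares in
characteristic ≠ 2. The outcome is `RevLexGeneric`.

Consequences for Q. The reverse lexicographic order reduces modulo the last variables first, so
regularity makes the initial ideal of Q generated by quadrics (`RevLexGeneric.exists_isLead_le`),
and the colon condition makes it stable in its smaller index: if x_i x_j with i ≤ j is a leading
monomial, so is x_k x_j for k ≤ i (`RevLexGeneric.exists_isLead_of_le`).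

From Q to S(𝔪). `J` contains Q, the minors x_j y_i - x_i y_j, and the sorted polarizations of the
quadrics of Q. Let u be the leading monomial of an element of `J`. Either a minor's leading monomial
divides u, or u is sorted: all its x-indices are at most all its y-indices. In the sorted case,
mapping to the Rees algebra by y_i ↦ x_i t keeps u leading (`IsLead.mergeHom`), so the merged
monomial is leading for Q and is divisible by a quadratic leading monomial x_i x_j. By stability x_i
may be replaced by x_c, where c is the least x-index of u; then x_c x_j or x_c y_j divides u. This
needs u to contain some x, which holds because S(𝔪) maps to Sym(𝔪/𝔪²), a polynomial ring in the y_i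
(`coordChange_yHom_eq_zero`).

Koszulness. For any algebra R presented by an ideal with this quadratic divisibility property, a
linear resolution of K is built by iterated Schreyer syzygies over R. At each stage the leading
monomials of the relation module, apart from those in the initial ideal, are multiples of linear
ones, given by colons of a monomial ideal (`SchreyerData.next`). -/

/-! ### Linear forms and the ideals they generate -/

section LinearForms

variable {K : Type*} [Field K] {n : ℕ}

/-- The linear form with a given vector of coefficients. -/
noncomputable def linForm : (Fin n → K) →ₗ[K] MvPolynomial (Fin n) K :=
  Fintype.linearCombination K (X (R := K))

theorem linForm_apply (v : Fin n → K) : linForm v = ∑ j, C (v j) * X j := by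
  simp [linForm, Fintype.linearCombination_apply, smul_eq_C_mul]

theorem linForm_single (i : Fin n) : linForm (Pi.single i (1 : K)) = X i := by
  simp [linForm_apply, Pi.single_apply, apply_ite C]

theorem linForm_isHomogeneous (v : Fin n → K) : (linForm v).IsHomogeneous 1 := by
  rw [linForm_apply]
  exact IsHomogeneous.sum _ _ _ fun j _ => by simpa using (isHomogeneous_C_mul_X (v j) j)

/-- The ideal generated by a space of linear forms. -/
noncomputable def linIdeal (V : Submodule K (Fin n → K)) : Ideal (MvPolynomial (Fin n) K) :=
  Ideal.span (linForm '' (V : Set (Fin n → K)))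

theorem linForm_mem_linIdeal {V : Submodule K (Fin n → K)} {v : Fin n → K} (hv : v ∈ V) :
    linForm v ∈ linIdeal V :=
  Ideal.subset_span ⟨v, hv, rfl⟩

theorem linIdeal_mono {V W : Submodule K (Fin n → K)} (h : V ≤ W) : linIdeal V ≤ linIdeal W :=
  Ideal.span_mono (Set.image_mono h)

theorem linIdeal_bot : linIdeal (⊥ : Submodule K (Fin n → K)) = ⊥ := by
  simp [linIdeal]

theorem linIdeal_sup_span (V : Submodule K (Fin n → K)) (l : Fin n → K) :
    linIdeal (V ⊔ Submodule.span K {l}) = linIdeal V ⊔ Ideal.span {linForm l} := by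
  apply le_antisymm
  · refine Ideal.span_le.2 ?_
    rintro _ ⟨v, hv, rfl⟩
    obtain ⟨a, ha, b, hb, rfl⟩ := Submodule.mem_sup.1 hv
    obtain ⟨c, rfl⟩ := Submodule.mem_span_singleton.1 hb
    rw [map_add, map_smul, smul_eq_C_mul]
    exact Submodule.add_mem_sup (linForm_mem_linIdeal ha)
      (Ideal.mul_mem_left _ _ (Ideal.mem_span_singleton_self _))
  · refine sup_le (linIdeal_mono le_sup_left) ?_
    rw [Ideal.span_singleton_le_iff_mem]
    exact linForm_mem_linIdeal (Submodule.mem_sup_right (Submodule.mem_span_singleton_self l))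

theorem linIdeal_isHomogeneous (V : Submodule K (Fin n → K)) :
    (linIdeal V).IsHomogeneous (homogeneousSubmodule (Fin n) K) := by
  apply Ideal.homogeneous_span
  rintro _ ⟨v, -, rfl⟩
  exact ⟨1, linForm_isHomogeneous v⟩

/-- Project K^n along `V` onto a complement. The induced substitution has kernel `linIdeal V` and
lands in a domain, so the ideal is prime and membership in it is tested by one ring homomorphism. -/
theorem exists_algHom_linIdeal (V : Submodule K (Fin n → K)) :
    ∃ (Φ : MvPolynomial (Fin n) K →ₐ[K] MvPolynomial (Fin n) K)
      (p : (Fin n → K) →ₗ[K] (Fin n → K)),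
      (∀ v, Φ (linForm v) = linForm (p v)) ∧ (∀ v, p v = 0 ↔ v ∈ V) ∧
      ∀ f, f ∈ linIdeal V ↔ Φ f = 0 := by
  obtain ⟨W, hW⟩ := Submodule.exists_isCompl V
  let p : (Fin n → K) →ₗ[K] (Fin n → K) := W.subtype ∘ₗ W.projectionOnto V hW.symm
  have hp : ∀ v, p v = 0 ↔ v ∈ V := fun v => by
    simp [p]
  have hpv : ∀ v, v - p v ∈ V := Submodule.sub_projection_mem hW.symm
  let Φ : MvPolynomial (Fin n) K →ₐ[K] MvPolynomial (Fin n) K :=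
    aeval fun j => linForm (p (Pi.single j 1))
  have hΦ : ∀ v, Φ (linForm v) = linForm (p v) := by
    intro v
    have h : Φ.toLinearMap ∘ₗ linForm = linForm ∘ₗ p := by
      refine LinearMap.pi_ext' fun i => LinearMap.ext_ring ?_
      simp [linForm_single, Φ]
    exact LinearMap.congr_fun h v
  refine ⟨Φ, p, hΦ, hp, fun f => ⟨fun hf => ?_, fun hf => ?_⟩⟩
  · have hle : linIdeal V ≤ RingHom.ker Φ := by
      refine Ideal.span_le.2 ?_
      rintro _ ⟨v, hv, rfl⟩
      simp only [SetLike.mem_coe, RingHom.mem_ker, hΦ]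
      rw [(hp v).2 hv, map_zero]
    exact hle hf
  · have h : (Ideal.Quotient.mkₐ K (linIdeal V)).comp Φ = Ideal.Quotient.mkₐ K (linIdeal V) := by
      ext i
      simp only [AlgHom.comp_apply, Φ, aeval_X, Ideal.Quotient.mkₐ_eq_mk]
      rw [eq_comm, Ideal.Quotient.eq]
      nth_rw 1 [← linForm_single i]
      rw [← map_sub]
      exact linForm_mem_linIdeal (hpv _)
    have := DFunLike.congr_fun h f
    simp only [AlgHom.comp_apply, hf, map_zero, Ideal.Quotient.mkₐ_eq_mk] at this
    exact Ideal.Quotient.eq_zero_iff_mem.1 this.symm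

theorem linForm_injective : Function.Injective (linForm (K := K) (n := n)) := by
  intro v w h
  ext i
  have := congrArg (coeff (Finsupp.single i 1)) h
  simpa [linForm_apply, coeff_sum, coeff_C_mul, coeff_X, Finsupp.single_left_inj] using this

theorem mem_linIdeal_of_linForm_mul_mem {V : Submodule K (Fin n → K)} {l : Fin n → K}
    (hl : l ∉ V) {f : MvPolynomial (Fin n) K} (h : linForm l * f ∈ linIdeal V) :
    f ∈ linIdeal V := by
  obtain ⟨Φ, p, h1, h2, h3⟩ := exists_algHom_linIdeal V
  rw [h3, map_mul, h1, mul_eq_zero] at h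
  rw [h3]
  refine h.resolve_left fun h0 => hl ?_
  rw [← h2]
  exact linForm_injective (by rw [h0, map_zero])

theorem mem_linIdeal_top {f : MvPolynomial (Fin n) K} {e : ℕ} (he : 1 ≤ e)
    (hf : f.IsHomogeneous e) : f ∈ linIdeal (⊤ : Submodule K (Fin n → K)) := by
  obtain ⟨Φ, p, h1, h2, h3⟩ := exists_algHom_linIdeal (⊤ : Submodule K (Fin n → K))
  rw [h3]
  have hX : ∀ i, Φ (X i) = 0 := fun i => by
    rw [← linForm_single, h1, (h2 _).2 trivial, map_zero]
  rw [f.as_sum, map_sum]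
  refine Finset.sum_eq_zero fun d hd => ?_
  rw [monomial_eq, map_mul, map_finsuppProd]
  have hd' : d ≠ 0 := by
    rintro rfl
    have := hf (mem_support_iff.1 hd)
    simp at this
    omega
  obtain ⟨i, hi⟩ := Finsupp.ne_iff.1 hd'
  rw [Finsupp.prod, Finset.prod_eq_zero (Finsupp.mem_support_iff.2 hi), mul_zero]
  simpa [hX] using hi

end LinearForms

/-! ### Complexes of free modules with homogeneous entries, modulo linear forms -/

section Complexes

variable {K : Type*} [Field K] {σ : Type*} {ι κ : Type*}

/-- A vector all of whose entries are forms of degree `e`. -/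
def HomVec (e : ℕ) (f : ι → MvPolynomial σ K) : Prop := ∀ k, (f k).IsHomogeneous e

/-- The vectors with entries in the ideal `I`. -/
noncomputable def vecIdeal (I : Ideal (MvPolynomial σ K)) (ι : Type*) :
    Submodule (MvPolynomial σ K) (ι → MvPolynomial σ K) :=
  Submodule.pi Set.univ fun _ => I

theorem mem_vecIdeal {I : Ideal (MvPolynomial σ K)} {f : ι → MvPolynomial σ K} :
    f ∈ vecIdeal I ι ↔ ∀ k, f k ∈ I := by
  simp [vecIdeal]

/-- The homogeneous component of a vector of polynomials. -/
noncomputable def vecComponent (e : ℕ) (f : ι → MvPolynomial σ K) : ι → MvPolynomial σ K :=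
  fun k => homogeneousComponent e (f k)

theorem homVec_vecComponent (e : ℕ) (f : ι → MvPolynomial σ K) : HomVec e (vecComponent e f) :=
  fun _ => homogeneousComponent_isHomogeneous _ _

theorem HomVec.vecComponent_eq {e : ℕ} {f : ι → MvPolynomial σ K} (hf : HomVec e f) :
    vecComponent e f = f :=
  funext fun k => homogeneousComponent_eq_self (hf k)

theorem HomVec.sub {e : ℕ} {f g : ι → MvPolynomial σ K} (hf : HomVec e f) (hg : HomVec e g) :
    HomVec e (f - g) :=
  fun k => (hf k).sub (hg k)

theorem HomVec.smul {e d : ℕ} {f : ι → MvPolynomial σ K} {r : MvPolynomial σ K}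
    (hr : r.IsHomogeneous d) (hf : HomVec e f) : HomVec (e + d) (r • f) :=
  fun k => by simpa [add_comm] using hr.mul (hf k)

theorem vecComponent_mem {I : Ideal (MvPolynomial σ K)}
    (hI : I.IsHomogeneous (homogeneousSubmodule σ K)) {f : ι → MvPolynomial σ K}
    (hf : f ∈ vecIdeal I ι) (e : ℕ) : vecComponent e f ∈ vecIdeal I ι :=
  mem_vecIdeal.2 fun k => homogeneousComponent_mem_of_mem hI (mem_vecIdeal.1 hf k) _

theorem homogeneousComponent_mul_of_isHomogeneous {r : MvPolynomial σ K} {d : ℕ}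
    (hr : r.IsHomogeneous d) (f : MvPolynomial σ K) (e : ℕ) :
    homogeneousComponent (e + d) (f * r) = homogeneousComponent e f * r := by
  conv_lhs => rw [← sum_homogeneousComponent f, Finset.sum_mul, map_sum]
  have h : ∀ i, homogeneousComponent (e + d) (homogeneousComponent i f * r) =
      if i = e then homogeneousComponent e f * r else 0 := by
    intro i
    rw [homogeneousComponent_of_mem ((homogeneousComponent_isHomogeneous i f).mul hr)]
    by_cases hi : i = e
    · simp [hi]
    · rw [if_neg hi, if_neg (by omega)]
  simp only [h, Finset.sum_ite_eq', Finset.mem_range]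
  split_ifs with h1
  · rfl
  · rw [homogeneousComponent_eq_zero _ _ (by omega), zero_mul]

theorem vecComponent_sub (e : ℕ) (f g : ι → MvPolynomial σ K) :
    vecComponent e (f - g) = vecComponent e f - vecComponent e g :=
  funext fun _ => map_sub _ _ _

theorem vecComponent_smul {d : ℕ} {r : MvPolynomial σ K} (hr : r.IsHomogeneous d) (e : ℕ)
    (f : ι → MvPolynomial σ K) : vecComponent (e + d) (r • f) = r • vecComponent e f :=
  funext fun k => by
    simp [vecComponent, mul_comm r, homogeneousComponent_mul_of_isHomogeneous hr]

theorem linearMap_apply_eq_sum [Fintype ι] [DecidableEq ι]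
    (D : (ι → MvPolynomial σ K) →ₗ[MvPolynomial σ K] (κ → MvPolynomial σ K))
    (f : ι → MvPolynomial σ K) (k : κ) : D f k = ∑ j, f j * D (Pi.single j 1) k := by
  conv_lhs => rw [pi_eq_sum_univ' f, map_sum]
  simp [Finset.sum_apply, map_smul]

variable [Finite ι]

theorem map_mem_vecIdeal (D : (ι → MvPolynomial σ K) →ₗ[MvPolynomial σ K] (κ → MvPolynomial σ K))
    {I : Ideal (MvPolynomial σ K)} {f : ι → MvPolynomial σ K} (hf : f ∈ vecIdeal I ι) :
    D f ∈ vecIdeal I κ := by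
  classical
  have := Fintype.ofFinite ι
  refine mem_vecIdeal.2 fun k => ?_
  rw [linearMap_apply_eq_sum]
  exact Ideal.sum_mem _ fun j _ => Ideal.mul_mem_right _ _ (mem_vecIdeal.1 hf j)

/-- A linear map between free modules whose matrix has entries that are forms of degree `d`. -/
def HomEntries [DecidableEq ι] (d : ℕ)
    (D : (ι → MvPolynomial σ K) →ₗ[MvPolynomial σ K] (κ → MvPolynomial σ K)) : Prop :=
  ∀ j k, (D (Pi.single j 1) k).IsHomogeneous d

variable [DecidableEq ι]

theorem HomEntries.map_vecComponent {d : ℕ}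
    {D : (ι → MvPolynomial σ K) →ₗ[MvPolynomial σ K] (κ → MvPolynomial σ K)}
    (hD : HomEntries d D) (e : ℕ) (f : ι → MvPolynomial σ K) :
    D (vecComponent e f) = vecComponent (e + d) (D f) := by
  have := Fintype.ofFinite ι
  funext k
  rw [linearMap_apply_eq_sum, vecComponent, linearMap_apply_eq_sum, map_sum]
  exact Finset.sum_congr rfl fun j _ =>
    (homogeneousComponent_mul_of_isHomogeneous (hD j k) _ _).symm

theorem HomEntries.homVec {d e : ℕ}
    {D : (ι → MvPolynomial σ K) →ₗ[MvPolynomial σ K] (κ → MvPolynomial σ K)}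
    (hD : HomEntries d D) {f : ι → MvPolynomial σ K} (hf : HomVec e f) : HomVec (e + d) (D f) := by
  rw [← hf.vecComponent_eq, hD.map_vecComponent]
  exact homVec_vecComponent _ _

/-- A preimage can be replaced by its component of the right degree, since the matrix and the ideal
are homogeneous. This keeps all later liftings degree by degree. -/
theorem HomEntries.exists_homVec {d e : ℕ}
    {D : (ι → MvPolynomial σ K) →ₗ[MvPolynomial σ K] (κ → MvPolynomial σ K)}
    (hD : HomEntries d D) {I : Ideal (MvPolynomial σ K)}
    (hI : I.IsHomogeneous (homogeneousSubmodule σ K)) {y : κ → MvPolynomial σ K}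
    (hy : HomVec (e + d) y) (h : ∃ u, y - D u ∈ vecIdeal I κ) :
    ∃ u, HomVec e u ∧ y - D u ∈ vecIdeal I κ := by
  obtain ⟨u, hu⟩ := h
  refine ⟨vecComponent e u, homVec_vecComponent _ _, ?_⟩
  rw [hD.map_vecComponent]
  have := vecComponent_mem hI hu (e + d)
  rwa [vecComponent_sub, hy.vecComponent_eq] at this

end Complexes

/-! ### Socles of cokernels of linear complexes -/

section Socle

variable {K : Type*} [Field K] {n : ℕ}

local notation "P" => MvPolynomial (Fin n) K

theorem mem_vecIdeal_of_linForm_smul_mem {ι : Type*} {V : Submodule K (Fin n → K)}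
    {l : Fin n → K} (hl : l ∉ V) {f : ι → P} (h : linForm l • f ∈ vecIdeal (linIdeal V) ι) :
    f ∈ vecIdeal (linIdeal V) ι :=
  mem_vecIdeal.2 fun k => mem_linIdeal_of_linForm_mul_mem hl (mem_vecIdeal.1 h k)

theorem mem_vecIdeal_sup_span {ι : Type*} {V : Submodule K (Fin n → K)}
    {l : Fin n → K} {f : ι → P} :
    f ∈ vecIdeal (linIdeal (V ⊔ Submodule.span K {l})) ι ↔
      ∃ w, f - linForm l • w ∈ vecIdeal (linIdeal V) ι := by
  simp only [mem_vecIdeal, linIdeal_sup_span]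
  constructor
  · intro h
    have : ∀ k, ∃ w, f k - linForm l * w ∈ linIdeal V := fun k => by
      obtain ⟨a, ha, b, hb, hab⟩ := Submodule.mem_sup.1 (h k)
      obtain ⟨c, rfl⟩ := Ideal.mem_span_singleton.1 hb
      exact ⟨c, by rwa [← hab, add_sub_cancel_right]⟩
    choose w hw using this
    exact ⟨w, hw⟩
  · rintro ⟨w, hw⟩ k
    rw [← sub_add_cancel (f k) (linForm l * w k)]
    exact Submodule.add_mem_sup (hw k) (Ideal.mul_mem_right _ _ (Ideal.mem_span_singleton_self _))

theorem exists_homVec_sub_smul_mem {ι : Type*} {V : Submodule K (Fin n → K)}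
    {l : Fin n → K} {f : ι → P} {e : ℕ} (hf : HomVec (e + 1) f)
    (h : f ∈ vecIdeal (linIdeal (V ⊔ Submodule.span K {l})) ι) :
    ∃ w, HomVec e w ∧ f - linForm l • w ∈ vecIdeal (linIdeal V) ι := by
  obtain ⟨w, hw⟩ := mem_vecIdeal_sup_span.1 h
  refine ⟨vecComponent e w, homVec_vecComponent _ _, ?_⟩
  have := vecComponent_mem (linIdeal_isHomogeneous V) hw (e + 1)
  rwa [vecComponent_sub, hf.vecComponent_eq, vecComponent_smul (linForm_isHomogeneous l)] at this

/-- Exactness, in positive coefficient degrees and modulo the ideal generated by a space of linear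
forms, of a pair of maps. -/
def ExactMod (V : Submodule K (Fin n → K)) {ι κ μ : Type*} (D' : (ι → P) →ₗ[P] (κ → P))
    (D : (κ → P) →ₗ[P] (μ → P)) : Prop :=
  ∀ e v, 1 ≤ e → HomVec e v → D v ∈ vecIdeal (linIdeal V) μ →
    ∃ u, v - D' u ∈ vecIdeal (linIdeal V) κ

/-- Exactness passes to the quotient by a further linear form. -/
theorem ExactMod.sup_span {V : Submodule K (Fin n → K)} {l : Fin n → K} (hl : l ∉ V)
    {b₀ b₁ b₂ b₃ : ℕ}
    {D₂ : (Fin b₃ → P) →ₗ[P] (Fin b₂ → P)} {D₁ : (Fin b₂ → P) →ₗ[P] (Fin b₁ → P)}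
    {D₀ : (Fin b₁ → P) →ₗ[P] (Fin b₀ → P)} (h₁ : HomEntries 1 D₁)
    (h₀₁ : ∀ u, D₀ (D₁ u) = 0) (hex₂ : ExactMod V D₂ D₁) (hex₁ : ExactMod V D₁ D₀) :
    ExactMod (V ⊔ Submodule.span K {l}) D₂ D₁ := by
  intro e v he hv hDv
  -- Modulo `V`, `D₁ v = l w`. Applying `D₀` and cancelling `l` makes `w` a cycle, hence `w = D₁ u`;
  -- then `v - l u` is a cycle modulo `V` and exactness there applies.
  obtain ⟨w, hw, hw'⟩ := exists_homVec_sub_smul_mem (h₁.homVec hv) hDv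
  have h2 : D₀ w ∈ vecIdeal (linIdeal V) _ := by
    refine mem_vecIdeal_of_linForm_smul_mem hl ?_
    have := map_mem_vecIdeal D₀ hw'
    rw [map_sub, h₀₁, zero_sub, map_smul, neg_mem_iff] at this
    exact this
  obtain ⟨e, rfl⟩ := Nat.exists_eq_add_of_le' he
  obtain ⟨u, hu, hu'⟩ := h₁.exists_homVec (linIdeal_isHomogeneous V) hw (hex₁ _ _ he hw h2)
  have h3 : D₁ (v - linForm l • u) ∈ vecIdeal (linIdeal V) _ := by
    have := add_mem hw' (Submodule.smul_mem _ (linForm l) hu')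
    rw [smul_sub, sub_add_sub_cancel] at this
    rwa [map_sub, map_smul]
  obtain ⟨u', hu'⟩ := hex₂ _ _ he (hv.sub (hu.smul (linForm_isHomogeneous l))) h3
  refine ⟨u', mem_vecIdeal_sup_span.2 ⟨u, ?_⟩⟩
  rwa [sub_right_comm]

/-- The cokernel of the last map of a linear complex that is exact modulo `V` has no socle in
positive degrees. -/
theorem exists_sub_map_mem_of_socle (c : ℕ) :
    ∀ (V : Submodule K (Fin n → K)), n ≤ Module.finrank K V + c →
    ∀ (b : ℕ → ℕ) (D : ∀ i, (Fin (b (i + 1)) → P) →ₗ[P] (Fin (b i) → P)),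
    (∀ i, HomEntries 1 (D i)) → (∀ i u, D i (D (i + 1) u) = 0) →
    (∀ i, ExactMod V (D (i + 1)) (D i)) →
    ∀ (e : ℕ) (f : Fin (b 0) → P), 1 ≤ e → HomVec e f →
    (∀ l : Fin n → K, ∃ u, linForm l • f - D 0 u ∈ vecIdeal (linIdeal V) _) →
    ∃ u, f - D 0 u ∈ vecIdeal (linIdeal V) _ := by
  -- Modulo all linear forms every vector of positive degree vanishes; the induction below runs on
  -- the codimension of `V`.
  have top_case : ∀ (b : ℕ → ℕ) (D : ∀ i, (Fin (b (i + 1)) → P) →ₗ[P] (Fin (b i) → P))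
      (e : ℕ) (f : Fin (b 0) → P), 1 ≤ e → HomVec e f →
      ∃ u, f - D 0 u ∈ vecIdeal (linIdeal (⊤ : Submodule K (Fin n → K))) _ := fun b D e f he hf =>
    ⟨0, by rw [map_zero, sub_zero]; exact mem_vecIdeal.2 fun k => mem_linIdeal_top he (hf k)⟩
  induction c with
  | zero =>
    intro V hV b D _ _ _ e f he hf _
    have : V = ⊤ := Submodule.eq_top_of_finrank_eq
      (le_antisymm (Submodule.finrank_le V) (by simpa using hV))
    subst this
    exact top_case b D e f he hf
  | succ c ih =>
    intro V hV b D hD hDD hex e f he hf hsoc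
    by_cases hVt : V = ⊤
    · subst hVt
      exact top_case b D e f he hf
    obtain ⟨l, hl⟩ : ∃ l, l ∉ V := by
      by_contra! h
      exact hVt (eq_top_iff.2 fun x _ => h x)
    have hlt : V < V ⊔ Submodule.span K {l} := by
      refine lt_of_le_of_ne le_sup_left fun h => hl ?_
      rw [h]
      exact Submodule.mem_sup_right (Submodule.mem_span_singleton_self l)
    have hrank := Submodule.finrank_lt_finrank_of_lt hlt
    -- Write `l f = D 0 g`, with `g` of the same degree `e` as `f`. For any `m`, comparing with `m f
    -- = D 0 h` makes `m g - l h` a cycle, so `g` is a socle element of the next cokernel modulo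
    -- `l`.
    obtain ⟨g, hg, hg'⟩ := (hD 0).exists_homVec (linIdeal_isHomogeneous V)
      (hf.smul (linForm_isHomogeneous l)) (hsoc l)
    have key : ∀ m : Fin n → K, ∃ u, linForm m • g - D 1 u ∈
        vecIdeal (linIdeal (V ⊔ Submodule.span K {l})) _ := by
      intro m
      obtain ⟨h, hh, hh'⟩ := (hD 0).exists_homVec (linIdeal_isHomogeneous V)
        (hf.smul (linForm_isHomogeneous m)) (hsoc m)
      have h3 : D 0 (linForm m • g - linForm l • h) ∈ vecIdeal (linIdeal V) _ := by
        have := sub_mem (Submodule.smul_mem _ (linForm l) hh') (Submodule.smul_mem _ (linForm m) hg')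
        rw [smul_sub, smul_sub, smul_comm (linForm m) (linForm l) f, sub_sub_sub_cancel_left] at this
        rwa [map_sub, map_smul, map_smul]
      obtain ⟨u, hu⟩ := hex 0 _ _ (by omega)
        ((hg.smul (linForm_isHomogeneous m)).sub (hh.smul (linForm_isHomogeneous l))) h3
      exact ⟨u, mem_vecIdeal_sup_span.2 ⟨h, by rwa [sub_right_comm]⟩⟩
    -- Killing `l` costs exactness at the right end, because it uses exactness one step further
    -- right. The complex is therefore shifted by one.
    obtain ⟨u, hu⟩ := ih _ (by omega) (fun i => b (i + 1)) (fun i => D (i + 1))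
      (fun i => hD _) (fun i => hDD _)
      (fun i => ExactMod.sup_span hl (hD _) (hDD _) (hex _) (hex _)) e g he hg key
    -- Now `g = D 1 u + l w` modulo `V`, so `l f = D 0 g = l D 0 w`, and `l` cancels.
    obtain ⟨w, hw⟩ := mem_vecIdeal_sup_span.1 hu
    refine ⟨w, mem_vecIdeal_of_linForm_smul_mem hl ?_⟩
    have := add_mem hg' (map_mem_vecIdeal (D 0) hw)
    rw [map_sub, map_sub, map_smul] at this
    erw [hDD] at this
    rw [sub_zero, sub_add_sub_cancel] at this
    rwa [smul_sub]

end Socle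

/-! ### Ideals augmenting a linear complex by quadrics -/

section QuadraticPresentation

variable {K : Type*} [Field K] {n : ℕ}

local notation "P" => MvPolynomial (Fin n) K

/-- A complex of free modules with linear entries, augmented to an ideal by a row of quadrics. -/
structure QuadraticComplex (Q : Ideal (MvPolynomial (Fin n) K)) where
  b : ℕ → ℕ
  ε : (Fin (b 0) → MvPolynomial (Fin n) K) →ₗ[MvPolynomial (Fin n) K] (Fin 1 → MvPolynomial (Fin n) K)
  D : ∀ i, (Fin (b (i + 1)) → MvPolynomial (Fin n) K) →ₗ[MvPolynomial (Fin n) K] (Fin (b i) → MvPolynomial (Fin n) K)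
  ε_hom : HomEntries 2 ε
  D_hom : ∀ i, HomEntries 1 (D i)
  ε_D : ∀ u, ε (D 0 u) = 0
  D_D : ∀ i u, D i (D (i + 1) u) = 0
  mem_iff : ∀ a, a ∈ Q ↔ ∃ u, ε u = fun _ => a

namespace QuadraticComplex

variable {Q : Ideal (MvPolynomial (Fin n) K)} (F : QuadraticComplex Q)

/-- Exactness of the complex, in positive coefficient degrees and modulo linear forms. -/
def Exact (V : Submodule K (Fin n → K)) : Prop :=
  ExactMod V (F.D 0) F.ε ∧ ∀ i, ExactMod V (F.D (i + 1)) (F.D i)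

theorem mem_sup_iff {V : Submodule K (Fin n → K)} {a : P} :
    a ∈ Q ⊔ linIdeal V ↔ ∃ u, (fun _ => a) - F.ε u ∈ vecIdeal (linIdeal V) (Fin 1) := by
  constructor
  · intro h
    obtain ⟨q, hq, r, hr, rfl⟩ := Submodule.mem_sup.1 h
    obtain ⟨u, hu⟩ := (F.mem_iff q).1 hq
    refine ⟨u, mem_vecIdeal.2 fun k => ?_⟩
    simpa [hu] using hr
  · rintro ⟨u, hu⟩
    rw [← add_sub_cancel (F.ε u 0) a]
    refine Submodule.add_mem_sup ((F.mem_iff _).2 ⟨u, ?_⟩) (mem_vecIdeal.1 hu 0)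
    funext k
    rw [Subsingleton.elim k 0]

theorem isHomogeneous (F : QuadraticComplex Q) :
    Q.IsHomogeneous (homogeneousSubmodule (Fin n) K) := by
  have : Q = Ideal.span (Set.range fun j => F.ε (Pi.single j 1) 0) := by
    apply le_antisymm
    · intro a ha
      obtain ⟨u, hu⟩ := (F.mem_iff a).1 ha
      have := congrFun hu 0
      rw [← this, linearMap_apply_eq_sum]
      exact Ideal.sum_mem _ fun j _ => Ideal.mul_mem_left _ _ (Ideal.subset_span ⟨j, rfl⟩)
    · refine Ideal.span_le.2 ?_
      rintro _ ⟨j, rfl⟩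
      exact (F.mem_iff _).2 ⟨Pi.single j 1, funext fun k => by rw [Subsingleton.elim k 0]⟩
  rw [this]
  apply Ideal.homogeneous_span
  rintro _ ⟨j, rfl⟩
  exact ⟨2, F.ε_hom j 0⟩

theorem isHomogeneous_sup (F : QuadraticComplex Q) (V : Submodule K (Fin n → K)) :
    (Q ⊔ linIdeal V).IsHomogeneous (homogeneousSubmodule (Fin n) K) :=
  Ideal.IsHomogeneous.sup F.isHomogeneous (linIdeal_isHomogeneous V)

variable {F}

theorem exists_homVec_of_mem_sup {V : Submodule K (Fin n → K)} {a : P} {e : ℕ}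
    (ha : a.IsHomogeneous (e + 2)) (h : a ∈ Q ⊔ linIdeal V) :
    ∃ u, HomVec e u ∧ (fun _ => a) - F.ε u ∈ vecIdeal (linIdeal V) (Fin 1) :=
  F.ε_hom.exists_homVec (linIdeal_isHomogeneous V) (fun _ => ha) (F.mem_sup_iff.1 h)

/-- The residue class ring has no socle in degrees at least two. -/
theorem Exact.mem_of_socle {V : Submodule K (Fin n → K)} (hF : F.Exact V) {a : P} {d : ℕ}
    (hd : 2 ≤ d) (ha : a.IsHomogeneous d)
    (hsoc : ∀ l : Fin n → K, linForm l * a ∈ Q ⊔ linIdeal V) : a ∈ Q ⊔ linIdeal V := by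
  by_cases hVt : V = ⊤
  · subst hVt
    exact Ideal.mem_sup_right (mem_linIdeal_top (by omega) ha)
  obtain ⟨l, hl⟩ : ∃ l, l ∉ V := by
    by_contra! h
    exact hVt (eq_top_iff.2 fun x _ => h x)
  obtain ⟨e, rfl⟩ := Nat.exists_eq_add_of_le' hd
  have hdeg : ∀ m : Fin n → K, (linForm m * a).IsHomogeneous ((e + 1) + 2) := fun m => by
    have := (linForm_isHomogeneous m).mul ha
    rwa [show 1 + (e + 2) = (e + 1) + 2 by ring] at this
  -- The socle argument once more, with the augmentation as last map. Since `a` has degree at least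
  -- 2 and the entries of `F.ε` are quadrics, `g` has degree at least 1, as the cokernel statement
  -- requires.
  obtain ⟨g, hg, hg'⟩ := exists_homVec_of_mem_sup (F := F) (hdeg l) (hsoc l)
  have key : ∀ m : Fin n → K, ∃ u, linForm m • g - F.D 0 u ∈
      vecIdeal (linIdeal (V ⊔ Submodule.span K {l})) _ := by
    intro m
    obtain ⟨h, hh, hh'⟩ := exists_homVec_of_mem_sup (F := F) (hdeg m) (hsoc m)
    have h3 : F.ε (linForm m • g - linForm l • h) ∈ vecIdeal (linIdeal V) _ := by
      have := sub_mem (Submodule.smul_mem _ (linForm l) hh') (Submodule.smul_mem _ (linForm m) hg')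
      have e1 : linForm l • (fun _ : Fin 1 => linForm m * a) =
          linForm m • (fun _ : Fin 1 => linForm l * a) := by
        funext k
        simp only [Pi.smul_apply, smul_eq_mul]
        ring
      rw [smul_sub, smul_sub, e1, sub_sub_sub_cancel_left] at this
      rwa [map_sub, map_smul, map_smul]
    obtain ⟨u, hu⟩ := hF.1 _ _ (by omega)
      ((hg.smul (linForm_isHomogeneous m)).sub (hh.smul (linForm_isHomogeneous l))) h3
    exact ⟨u, mem_vecIdeal_sup_span.2 ⟨h, by rwa [sub_right_comm]⟩⟩
  have hex : ∀ i, ExactMod (V ⊔ Submodule.span K {l}) (F.D (i + 1)) (F.D i) := by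
    intro i
    cases i with
    | zero => exact ExactMod.sup_span hl (F.D_hom 0) F.ε_D (hF.2 0) hF.1
    | succ i => exact ExactMod.sup_span hl (F.D_hom _) (F.D_D i) (hF.2 _) (hF.2 _)
  obtain ⟨u, hu⟩ := exists_sub_map_mem_of_socle n _ (by omega) F.b F.D F.D_hom F.D_D hex
    (e + 1) g (by omega) hg key
  obtain ⟨w, hw⟩ := mem_vecIdeal_sup_span.1 hu
  refine F.mem_sup_iff.2 ⟨w, mem_vecIdeal_of_linForm_smul_mem hl ?_⟩
  have := add_mem hg' (map_mem_vecIdeal F.ε hw)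
  rw [map_sub, map_sub, map_smul, F.ε_D, sub_zero, sub_add_sub_cancel] at this
  rwa [smul_sub]

/-- Exactness passes to the quotient by a linear form that is regular in degrees at least two. -/
theorem Exact.sup_span {V : Submodule K (Fin n → K)} (hF : F.Exact V) {l : Fin n → K}
    (hl : l ∉ V) (hreg : ∀ d (a : P), 2 ≤ d → a.IsHomogeneous d →
      linForm l * a ∈ Q ⊔ linIdeal V → a ∈ Q ⊔ linIdeal V) :
    F.Exact (V ⊔ Submodule.span K {l}) := by
  refine ⟨fun e v he hv hDv => ?_, fun i => ?_⟩
  · obtain ⟨e, rfl⟩ := Nat.exists_eq_add_of_le' he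
    obtain ⟨w, hw, hw'⟩ := exists_homVec_sub_smul_mem (e := e + 2)
      (by have := F.ε_hom.homVec hv; rwa [add_right_comm] at this) hDv
    -- Here `F.ε v = l w`, and `w` has degree at least 2 exactly because `v` has degree at least 1.
    -- This is why exactness is tracked only in positive coefficient degrees.
    have h2 : w 0 ∈ Q ⊔ linIdeal V := by
      refine hreg (e + 2) _ (by omega) (hw 0) (F.mem_sup_iff.2 ⟨v, ?_⟩)
      rw [← neg_mem_iff, neg_sub]
      convert hw' using 2
      funext k
      rw [Subsingleton.elim k 0]
      rfl
    obtain ⟨u, hu, hu'⟩ := exists_homVec_of_mem_sup (F := F) (hw 0) h2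
    have hw0 : (fun _ => w 0) = w := funext fun k => by rw [Subsingleton.elim k 0]
    rw [hw0] at hu'
    have h3 : F.ε (v - linForm l • u) ∈ vecIdeal (linIdeal V) _ := by
      have := add_mem hw' (Submodule.smul_mem _ (linForm l) hu')
      rw [smul_sub, sub_add_sub_cancel] at this
      rwa [map_sub, map_smul]
    obtain ⟨u', hu'⟩ := hF.1 _ _ he (hv.sub (hu.smul (linForm_isHomogeneous l))) h3
    exact ⟨u', mem_vecIdeal_sup_span.2 ⟨u, by rwa [sub_right_comm]⟩⟩
  · cases i with
    | zero => exact ExactMod.sup_span hl (F.D_hom 0) F.ε_D (hF.2 0) hF.1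
    | succ i => exact ExactMod.sup_span hl (F.D_hom _) (F.D_D i) (hF.2 _) (hF.2 _)

end QuadraticComplex

/-- The augmentation to `Q` is composed with the inclusion into `P`, viewed as a free module of rank
one, so that it becomes a matrix like the other maps. -/
theorem Ideal.HasLinearResolution.exists_quadraticComplex {Q : Ideal P}
    (h : Q.HasLinearResolution 2) : ∃ F : QuadraticComplex Q, F.Exact ⊥ := by
  obtain ⟨b, ε, δ, hε, hδ, hs, hex0, hex⟩ := h
  refine ⟨{ b := b, ε := (LinearMap.pi fun _ : Fin 1 => Q.subtype) ∘ₗ ε, D := δ,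
            ε_hom := fun j k => hε j
            D_hom := fun i j k => hδ i j k
            ε_D := fun u => ?_
            D_D := fun i u => (hex i _).2 ⟨u, rfl⟩
            mem_iff := fun a => ?_ }, ?_⟩
  · have : ε (δ 0 u) = 0 := (hex0 _).2 ⟨u, rfl⟩
    funext k
    simp [this]
  · constructor
    · intro ha
      obtain ⟨u, hu⟩ := hs ⟨a, ha⟩
      exact ⟨u, funext fun k => by simp [hu]⟩
    · rintro ⟨u, hu⟩
      have := congrFun hu 0
      simp only [LinearMap.comp_apply, LinearMap.pi_apply, Submodule.subtype_apply] at this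
      rw [← this]
      exact (ε u).2
  · have hz : ∀ {ι : Type} {f : ι → P}, f ∈ vecIdeal (linIdeal ⊥) ι → f = 0 := fun {ι f} hf => by
      funext k
      have := mem_vecIdeal.1 hf k
      rwa [linIdeal_bot] at this
    refine ⟨fun e v _ _ hv => ?_, fun i e v _ _ hv => ?_⟩
    · have h0 : ε v = 0 := by
        have := congrFun (hz hv) 0
        simpa using this
      obtain ⟨u, hu⟩ := (hex0 v).1 h0
      exact ⟨u, by simp [hu]⟩
    · obtain ⟨u, hu⟩ := (hex i v).1 (hz hv)
      exact ⟨u, by simp [hu]⟩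

end QuadraticPresentation

/-! ### Avoiding subspaces and a quadratic condition -/

section Avoidance

/-- Over an infinite field, a linear form can be found outside finitely many proper subspaces and
such that its square avoids a given subspace that does not contain all squares. -/
theorem exists_sq_notMem_of_forall_ne_top {K E σ : Type*} [Field K] [Infinite K] [AddCommGroup E]
    [Module K E] (φ : E →ₗ[K] MvPolynomial σ K) (I : Ideal (MvPolynomial σ K))
    (s : Set (Submodule K E)) (hs : s.Finite) (htop : ⊤ ∉ s) {y : E} (hy : φ y ^ 2 ∉ I) :
    ∃ x, φ x ^ 2 ∉ I ∧ ∀ H ∈ s, x ∉ H := by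
  obtain ⟨x₀, hx₀⟩ : ∃ x₀ : E, ∀ H ∈ s, x₀ ∉ H := by
    have := Subspace.biUnion_ne_univ_of_top_notMem (s := hs.toFinset) (by simpa using htop)
    obtain ⟨x, hx⟩ := (Set.ne_univ_iff_exists_notMem _).1 this
    exact ⟨x, fun H hH hxH => hx (by simpa using ⟨H, hH, hxH⟩)⟩
  -- A functional vanishing on `I` but not at `φ y ^ 2` turns the condition along the line `x₀ + t
  -- y` into a polynomial in `t` whose coefficient of t² is nonzero.
  obtain ⟨f, hfy, hfI⟩ := Submodule.exists_le_ker_of_notMem (p := I.restrictScalars K) hy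
  let p : Polynomial K := Polynomial.C (f (φ x₀ ^ 2)) +
    Polynomial.C (f (2 * φ x₀ * φ y)) * Polynomial.X + Polynomial.C (f (φ y ^ 2)) * Polynomial.X ^ 2
  have hp : p ≠ 0 := by
    intro h
    have := congrArg (Polynomial.coeff · 2) h
    simp [p] at this
    exact hfy this
  have heval : ∀ t : K, p.eval t = f (φ (x₀ + t • y) ^ 2) := by
    intro t
    have : φ (x₀ + t • y) ^ 2 = φ x₀ ^ 2 + t • (2 * φ x₀ * φ y) + t ^ 2 • φ y ^ 2 := by
      simp only [map_add, map_smul, Algebra.smul_def, map_pow]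
      ring
    rw [this]
    simp only [p, map_add, map_smul, Polynomial.eval_add, Polynomial.eval_mul, Polynomial.eval_C,
      Polynomial.eval_X, Polynomial.eval_pow, smul_eq_mul]
    ring
  -- The line meets each `H` at most once: two points of intersection would put `y`, and then `x₀`,
  -- into `H`.
  have hbad : ({t : K | p.IsRoot t} ∪ ⋃ H ∈ s, {t : K | x₀ + t • y ∈ H}).Finite := by
    refine (Polynomial.finite_setOfPred_isRoot hp).union (hs.biUnion fun H hH => ?_)
    refine Set.Subsingleton.finite fun t ht t' ht' => ?_
    by_contra hne
    have h1 : (t - t') • y ∈ H := by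
      have := H.sub_mem ht ht'
      rwa [add_sub_add_left_eq_sub, ← sub_smul] at this
    have h2 : y ∈ H := (H.smul_mem_iff (sub_ne_zero.2 hne)).1 h1
    exact hx₀ H hH (by simpa using H.sub_mem ht (H.smul_mem t h2))
  obtain ⟨t, ht⟩ := hbad.exists_notMem
  simp only [Set.mem_union, Set.mem_ofPred_eq, Set.mem_iUnion, not_or, not_exists] at ht
  refine ⟨x₀ + t • y, fun h => ht.1 ?_, fun H hH => ht.2 H hH⟩
  rw [Polynomial.IsRoot, heval]
  exact hfI h

end Avoidance

/-! ### Generic flags of linear forms -/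

section Generic

variable {K : Type*} [Field K] {n : ℕ}

theorem homogeneousComponent_linForm_mul (l : Fin n → K) (f : MvPolynomial (Fin n) K) (e : ℕ) :
    homogeneousComponent (e + 1) (linForm l * f) = linForm l * homogeneousComponent e f := by
  rw [mul_comm, homogeneousComponent_mul_of_isHomogeneous (linForm_isHomogeneous l), mul_comm]

/-- If the residue class ring of `I` has no socle in degrees at least `c`, then a linear form
outside finitely many proper subspaces is regular in degrees at least `c`. -/
theorem exists_finite_forall_regular {I : Ideal (MvPolynomial (Fin n) K)}
    (hI : I.IsHomogeneous (homogeneousSubmodule (Fin n) K)) {c : ℕ}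
    (hsoc : ∀ d (a : MvPolynomial (Fin n) K), c ≤ d → a.IsHomogeneous d →
      (∀ l : Fin n → K, linForm l * a ∈ I) → a ∈ I) :
    ∃ s : Set (Submodule K (Fin n → K)), s.Finite ∧ ⊤ ∉ s ∧ ∀ l, (∀ H ∈ s, l ∉ H) →
      ∀ d (a : MvPolynomial (Fin n) K), c ≤ d → a.IsHomogeneous d → linForm l * a ∈ I → a ∈ I := by
  let g : Ideal (MvPolynomial (Fin n) K) → Submodule K (Fin n → K) := fun p =>
    (p.restrictScalars K).comap linForm
  have hfin := associatedPrimes.finite (MvPolynomial (Fin n) K) (MvPolynomial (Fin n) K ⧸ I)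
  refine ⟨(g '' associatedPrimes (MvPolynomial (Fin n) K) (MvPolynomial (Fin n) K ⧸ I)) \ {⊤},
    (hfin.image g).sdiff, by simp, fun l hl d a hd ha hla => ?_⟩
  by_contra haI
  let N : Submodule (MvPolynomial (Fin n) K) (MvPolynomial (Fin n) K ⧸ I) :=
    Submodule.span _ {Ideal.Quotient.mk I a}
  have hN : Nontrivial N := by
    refine ⟨⟨⟨Ideal.Quotient.mk I a, Submodule.mem_span_singleton_self _⟩, 0, fun h => haI ?_⟩⟩
    exact Ideal.Quotient.eq_zero_iff_mem.1 (congrArg Subtype.val h)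
  -- The excluded subspaces are the linear parts of the associated primes, except those containing
  -- every linear form. If `l` kills `a`, an associated prime of the submodule generated by `a`
  -- contains `l`, so it must be of the excepted kind.
  obtain ⟨p, hp⟩ := associatedPrimes.nonempty (MvPolynomial (Fin n) K) N
  have hp' := associatedPrimes.subset_of_injective N.subtype_injective hp
  obtain ⟨hprime, ⟨x, hx⟩, hxp⟩ := isAssociatedPrime_iff.1 hp
  obtain ⟨r, rfl⟩ := Submodule.mem_span_singleton.1 hx
  have hmem : ∀ q, q ∈ p ↔ q * (r * a) ∈ I := by
    intro q
    rw [hxp, Submodule.mem_colon_singleton, Submodule.mem_bot, ← Ideal.Quotient.eq_zero_iff_mem,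
      Subtype.ext_iff]
    change q • r • Ideal.Quotient.mk I a = 0 ↔ _
    rw [map_mul, map_mul]
    rfl
  have hlp : linForm l ∈ p := by
    rw [hmem, mul_left_comm]
    exact Ideal.mul_mem_left _ _ hla
  have htop : g p = ⊤ := by
    by_contra h
    exact hl (g p) ⟨⟨p, hp', rfl⟩, h⟩ hlp
  have hall : ∀ m : Fin n → K, linForm m * (r * a) ∈ I := fun m => by
    rw [← hmem]
    have : m ∈ g p := by rw [htop]; trivial
    exact this
  -- The multiple `r * a` is killed by all linear forms. Its components all have degree at least `d
  -- ≥ c`, so the socle hypothesis applies to each of them.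
  have hra : r * a ∈ I := by
    conv => rw [← sum_homogeneousComponent r, Finset.sum_mul]
    refine Ideal.sum_mem _ fun k _ => ?_
    refine hsoc (k + d) _ (by omega) ((homogeneousComponent_isHomogeneous k r).mul ha) fun m => ?_
    rw [← homogeneousComponent_mul_of_isHomogeneous ha, ← homogeneousComponent_linForm_mul]
    exact homogeneousComponent_mem_of_mem hI (hall m) _
  refine hprime.ne_top (Ideal.eq_top_iff_one _ |>.2 ?_)
  rwa [hmem, one_mul]

/-- The space of linear forms whose product with a given linear form lies in an ideal. -/
noncomputable def linColon (I : Ideal (MvPolynomial (Fin n) K)) (x : Fin n → K) :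
    Submodule K (Fin n → K) :=
  (I.restrictScalars K).comap (LinearMap.mulLeft K (linForm x) ∘ₗ linForm)

/-- The span of the first members of a sequence. -/
def flagSpan (v : ℕ → Fin n → K) (k : ℕ) : Submodule K (Fin n → K) :=
  Submodule.span K (v '' Set.Iio k)

theorem flagSpan_zero (v : ℕ → Fin n → K) : flagSpan v 0 = ⊥ := by
  simp [flagSpan]

theorem flagSpan_succ (v : ℕ → Fin n → K) (k : ℕ) :
    flagSpan v (k + 1) = flagSpan v k ⊔ Submodule.span K {v k} := by
  rw [flagSpan, flagSpan, ← Submodule.span_union, ← Set.image_singleton, ← Set.image_union]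
  congr 2
  ext i
  simp

theorem flagSpan_congr {v w : ℕ → Fin n → K} {k : ℕ} (h : ∀ i < k, v i = w i) :
    flagSpan v k = flagSpan w k := by
  rw [flagSpan, flagSpan]
  congr 1
  exact Set.image_congr fun i hi => h i hi

theorem flagSpan_mono (v : ℕ → Fin n → K) {j k : ℕ} (h : j ≤ k) : flagSpan v j ≤ flagSpan v k :=
  Submodule.span_mono (Set.image_mono (Set.Iio_subset_Iio h))

theorem finrank_flagSpan_le (v : ℕ → Fin n → K) (k : ℕ) :
    Module.finrank K (flagSpan v k) ≤ k := by
  classical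
  have : v '' Set.Iio k = ((Finset.range k).image v : Finset (Fin n → K)) := by
    ext; simp
  rw [flagSpan, this]
  refine (finrank_span_finset_le_card _).trans (Finset.card_image_le.trans (by simp))

/-- The genericity of the `k`-th member of a sequence of linear forms. -/
structure IsGenericAt (Q : Ideal (MvPolynomial (Fin n) K)) (v : ℕ → Fin n → K) (k : ℕ) : Prop where
  notMem : v k ∉ flagSpan v k
  regular : ∀ d (a : MvPolynomial (Fin n) K), 2 ≤ d → a.IsHomogeneous d →
    linForm (v k) * a ∈ Q ⊔ linIdeal (flagSpan v k) → a ∈ Q ⊔ linIdeal (flagSpan v k)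
  colon : ∀ j ≤ k, v k ∈ linColon (Q ⊔ linIdeal (flagSpan v j)) (v j) ⊔ flagSpan v k →
    linColon (Q ⊔ linIdeal (flagSpan v j)) (v j) ⊔ flagSpan v k = ⊤

theorem IsGenericAt.congr {Q : Ideal (MvPolynomial (Fin n) K)} {v w : ℕ → Fin n → K} {k : ℕ}
    (h : ∀ i ≤ k, v i = w i) (hv : IsGenericAt Q v k) : IsGenericAt Q w k := by
  have h1 : ∀ j ≤ k, flagSpan v j = flagSpan w j := fun j hj =>
    flagSpan_congr fun i hi => h i (by omega)
  refine ⟨?_, ?_, ?_⟩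
  · rw [← h k le_rfl, ← h1 k le_rfl]
    exact hv.notMem
  · rw [← h k le_rfl, ← h1 k le_rfl]
    exact hv.regular
  · intro j hj
    rw [← h k le_rfl, ← h1 k le_rfl, ← h1 j hj, ← h j hj]
    exact hv.colon j hj

/-- Polarization: 2xy = (x + y)² - x² - y². This is where characteristic different from 2 enters. -/
theorem linForm_mul_mem_of_forall_sq_mem {I : Ideal (MvPolynomial (Fin n) K)}
    (h2 : (2 : K) ≠ 0) (h : ∀ y : Fin n → K, linForm y ^ 2 ∈ I) (x y : Fin n → K) :
    linForm x * linForm y ∈ I := by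
  have h3 : C 2 * (linForm x * linForm y) ∈ I := by
    have := I.sub_mem (I.sub_mem (h (x + y)) (h x)) (h y)
    rw [map_add] at this
    convert this using 1
    rw [map_ofNat]
    ring
  have := I.mul_mem_left (C (2⁻¹ : K)) h3
  rwa [← mul_assoc, ← C_mul, inv_mul_cancel₀ h2, C_1, one_mul] at this

variable [Infinite K]

/-- The form must avoid the flag, finitely many subspaces witnessing irregularity, and those earlier
colon spaces that are proper modulo the flag. The colon by the new form itself is no fixed subspace;
it is controlled through the square of the form. -/
theorem QuadraticComplex.Exact.exists_isGenericAt {Q : Ideal (MvPolynomial (Fin n) K)}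
    {F : QuadraticComplex Q} (h2 : (2 : K) ≠ 0) {v : ℕ → Fin n → K} {k : ℕ} (hk : k < n)
    (hF : F.Exact (flagSpan v k)) : ∃ x, IsGenericAt Q (Function.update v k x) k := by
  obtain ⟨s, hs, hst, hreg⟩ := exists_finite_forall_regular (c := 2)
    (F.isHomogeneous_sup (flagSpan v k)) fun d a hd ha hl => hF.mem_of_socle hd ha hl
  have hne : flagSpan v k ≠ ⊤ := fun h => by
    have := finrank_flagSpan_le v k
    rw [h, finrank_top, Module.finrank_fin_fun] at this
    omega
  let t : Set (Submodule K (Fin n → K)) := (s ∪ {flagSpan v k}) ∪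
    ((fun j => linColon (Q ⊔ linIdeal (flagSpan v j)) (v j) ⊔ flagSpan v k) '' Set.Iio k) \ {⊤}
  have ht : t.Finite :=
    (hs.union (Set.finite_singleton _)).union ((Set.finite_Iio k).image _).sdiff
  have htt : ⊤ ∉ t := by
    simp [t, hst, hne.symm]
  -- The square of `x` lies in the ideal only if all squares do; otherwise the avoidance lemma
  -- supplies an `x` with square outside.
  have main : ∃ x, (linForm x ^ 2 ∈ Q ⊔ linIdeal (flagSpan v k) →
      ∀ y : Fin n → K, linForm y ^ 2 ∈ Q ⊔ linIdeal (flagSpan v k)) ∧ ∀ H ∈ t, x ∉ H := by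
    by_cases hall : ∀ y : Fin n → K, linForm y ^ 2 ∈ Q ⊔ linIdeal (flagSpan v k)
    · have := Subspace.biUnion_ne_univ_of_top_notMem (s := ht.toFinset) (by simpa using htt)
      obtain ⟨x, hx⟩ := (Set.ne_univ_iff_exists_notMem _).1 this
      exact ⟨x, fun _ => hall, fun H hH hxH => hx
        (Set.mem_biUnion (by simpa using hH) hxH)⟩
    · push Not at hall
      obtain ⟨y, hy⟩ := hall
      have key := fun y => exists_sq_notMem_of_forall_ne_top (y := y)
        (linForm (K := K) (n := n)) (Q ⊔ linIdeal (flagSpan v k)) t ht htt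
      obtain ⟨x, hx, hx'⟩ := key y hy
      exact ⟨x, fun h => absurd h hx, hx'⟩
  obtain ⟨x, hx, hxt⟩ := main
  have h1 : ∀ j ≤ k, flagSpan (Function.update v k x) j = flagSpan v j := fun j hj =>
    flagSpan_congr fun i hi => Function.update_of_ne (by omega) _ _
  refine ⟨x, ?_, ?_, ?_⟩
  · rw [h1 k le_rfl, Function.update_self]
    exact hxt _ (Or.inl (Or.inr rfl))
  · rw [h1 k le_rfl, Function.update_self]
    exact hreg x fun H hH => hxt _ (Or.inl (Or.inl hH))
  · intro j hj
    rw [h1 k le_rfl, h1 j hj, Function.update_self]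
    rcases hj.lt_or_eq with hj | rfl
    · rw [Function.update_of_ne hj.ne]
      intro hmem
      by_contra hne
      exact hxt _ (Or.inr ⟨⟨j, hj, rfl⟩, hne⟩) hmem
    -- For `j = k` membership says that the square of `x` lies in the ideal; by the choice of `x`
    -- all squares then do, and by polarization all products.
    · rw [Function.update_self]
      intro hmem
      have hle : flagSpan v j ≤ linColon (Q ⊔ linIdeal (flagSpan v j)) x := fun y hy =>
        Ideal.mul_mem_left _ _ (Ideal.mem_sup_right (linForm_mem_linIdeal hy))
      rw [sup_of_le_left hle] at hmem ⊢
      refine eq_top_iff.2 fun y _ => linForm_mul_mem_of_forall_sq_mem h2 (hx ?_) x y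
      rw [sq]
      exact hmem

/-- The existence of generic sequences of linear forms for ideals with a `2`-linear resolution. -/
theorem QuadraticComplex.Exact.exists_forall_isGenericAt {Q : Ideal (MvPolynomial (Fin n) K)}
    {F : QuadraticComplex Q} (h2 : (2 : K) ≠ 0) (hF : F.Exact ⊥) :
    ∃ v : ℕ → Fin n → K, ∀ k < n, IsGenericAt Q v k := by
  suffices h : ∀ m ≤ n, ∃ v : ℕ → Fin n → K, (∀ k < m, IsGenericAt Q v k) ∧
      F.Exact (flagSpan v m) by
    obtain ⟨v, hv, -⟩ := h n le_rfl
    exact ⟨v, hv⟩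
  intro m
  induction m with
  | zero => exact fun _ => ⟨0, by simp, by rwa [flagSpan_zero]⟩
  | succ m ih =>
    intro hm
    obtain ⟨v, hv, hex⟩ := ih (by omega)
    obtain ⟨x, hx⟩ := hex.exists_isGenericAt h2 (by omega : m < n)
    have h1 : flagSpan (Function.update v m x) m = flagSpan v m :=
      flagSpan_congr fun i hi => Function.update_of_ne (by omega) _ _
    refine ⟨Function.update v m x, fun k hk => ?_, ?_⟩
    · rcases (Nat.lt_succ_iff.1 hk).lt_or_eq with hk | rfl
      · exact (hv k hk).congr fun i hi => (Function.update_of_ne (by omega) _ _).symm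
      · exact hx
    · rw [flagSpan_succ]
      exact QuadraticComplex.Exact.sup_span (by rwa [h1]) hx.notMem hx.regular

end Generic

/-! ### Leading monomials -/

section Lead

variable {σ K : Type*} [CommRing K] (m : MonomialOrder σ)

/-- The monomial with exponent vector `u` is the leading monomial of `f`. -/
def IsLead (f : MvPolynomial σ K) (u : σ →₀ ℕ) : Prop :=
  coeff u f ≠ 0 ∧ ∀ w, coeff w f ≠ 0 → m.toSyn w ≤ m.toSyn u

variable {m}

theorem isHomogeneous_of_degree {f : MvPolynomial σ K} {d : ℕ}
    (h : ∀ w, coeff w f ≠ 0 → w.degree = d) : f.IsHomogeneous d := by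
  intro w hw
  have := h w hw
  rwa [Finsupp.degree_eq_weight_one] at this

theorem MvPolynomial.IsHomogeneous.degree_eq_of_coeff_ne_zero {f : MvPolynomial σ K} {d : ℕ}
    (hf : f.IsHomogeneous d) {w : σ →₀ ℕ} (hw : coeff w f ≠ 0) : w.degree = d := by
  by_contra h
  exact hw (hf.coeff_eq_zero h)

theorem exists_eq_single_of_degree_eq_one {w : σ →₀ ℕ} (h : w.degree = 1) :
    ∃ s, w = Finsupp.single s 1 := by
  have : w ∈ {d : σ →₀ ℕ | d.degree = 1} := h
  rw [← Finsupp.range_single_one] at this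
  obtain ⟨s, hs⟩ := this
  exact ⟨s, hs.symm⟩

theorem IsLead.degree_eq {f : MvPolynomial σ K} {u : σ →₀ ℕ} (h : IsLead m f u) :
    m.degree f = u := by
  apply m.toSyn.injective
  apply le_antisymm
  · exact m.degree_le_iff.2 fun w hw => h.2 w (mem_support_iff.1 hw)
  · exact m.le_degree (mem_support_iff.2 h.1)

theorem isLead_degree {f : MvPolynomial σ K} (hf : f ≠ 0) : IsLead m f (m.degree f) :=
  ⟨m.coeff_degree_ne_zero_iff.2 hf, fun _ hw => m.le_degree (mem_support_iff.2 hw)⟩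

theorem IsLead.degree_of_isHomogeneous {f : MvPolynomial σ K} {u : σ →₀ ℕ} (h : IsLead m f u)
    {d : ℕ} (hf : f.IsHomogeneous d) : u.degree = d :=
  hf.degree_eq_of_coeff_ne_zero h.1

end Lead

/-! ### Reverse lexicographic leading monomials in generic position -/

section RevLex

variable {n : ℕ}

theorem revLex_lt_iff {a b : Fin n →₀ ℕ} :
    (MonomialOrder.revLex (Fin n)).toSyn a < (MonomialOrder.revLex (Fin n)).toSyn b ↔
      a.degree < b.degree ∨
      (a.degree = b.degree ∧ ∃ i, (∀ j, i < j → b j = a j) ∧ b i < a i) :=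
  DegRevLex.toRev_lt_toRev_iff

/-- If `w ≤ u`, the last variable of `u` is `x_j`, and `x_j` does not divide `w`, then `w` is
divisible by a later variable. -/
theorem exists_lt_ne_zero_of_revLex_le {u w : Fin n →₀ ℕ} {j : Fin n} (hdeg : w.degree = u.degree)
    (hle : (MonomialOrder.revLex (Fin n)).toSyn w ≤ (MonomialOrder.revLex (Fin n)).toSyn u)
    (huj : u j ≠ 0) (hu : ∀ s, j < s → u s = 0) (hwj : w j = 0) : ∃ s, j < s ∧ w s ≠ 0 := by
  by_contra! h
  refine absurd hle (not_le.2 (revLex_lt_iff.2 (Or.inr ⟨hdeg.symm, j, fun s hs => ?_, ?_⟩)))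
  · rw [h s hs, hu s hs]
  · omega

/-- A monomial divisible by a variable later than all those of `u` is smaller than `u`. -/
theorem revLex_lt_of_ne_zero {u w : Fin n →₀ ℕ} {s : Fin n} (hdeg : w.degree = u.degree)
    (hu : ∀ t, s ≤ t → u t = 0) (hw : w s ≠ 0) :
    (MonomialOrder.revLex (Fin n)).toSyn w < (MonomialOrder.revLex (Fin n)).toSyn u := by
  have hw' : w.support.Nonempty := ⟨s, Finsupp.mem_support_iff.2 hw⟩
  have hs : s ≤ w.support.max' hw' := Finset.le_max' _ _ (Finsupp.mem_support_iff.2 hw)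
  refine revLex_lt_iff.2 (Or.inr ⟨hdeg, w.support.max' hw', fun t ht => ?_, ?_⟩)
  · have : w t = 0 := by
      by_contra h
      exact absurd (Finset.le_max' _ _ (Finsupp.mem_support_iff.2 h)) (not_le.2 ht)
    rw [this, hu t (hs.trans ht.le)]
  · rw [hu _ hs]
    exact Nat.pos_of_ne_zero (Finsupp.mem_support_iff.1 (Finset.max'_mem _ _))

theorem revLex_single_lt_single {i s : Fin n} :
    (MonomialOrder.revLex (Fin n)).toSyn (Finsupp.single s 1) <
      (MonomialOrder.revLex (Fin n)).toSyn (Finsupp.single i 1) ↔ i < s := by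
  have key : ∀ i s : Fin n, i < s → (MonomialOrder.revLex (Fin n)).toSyn (Finsupp.single s 1) <
      (MonomialOrder.revLex (Fin n)).toSyn (Finsupp.single i 1) := by
    intro i s h
    refine revLex_lt_of_ne_zero (s := s) (by simp) (fun t ht => ?_) (by simp)
    rw [Finsupp.single_eq_of_ne]
    exact (h.trans_le ht).ne'
  refine ⟨fun h => ?_, key i s⟩
  by_contra! hle
  rcases hle.lt_or_eq with h' | rfl
  · exact lt_asymm h (key _ _ h')
  · exact lt_irrefl _ h

variable {K : Type*} [Field K]

/-- The ideal generated by the variables after `x_j`. -/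
noncomputable def laterIdeal (K : Type*) [Field K] (j : Fin n) : Ideal (MvPolynomial (Fin n) K) :=
  Ideal.span (X '' Set.Ioi j)

theorem mem_laterIdeal {j : Fin n} {f : MvPolynomial (Fin n) K} :
    f ∈ laterIdeal K j ↔ ∀ w ∈ f.support, ∃ s, j < s ∧ w s ≠ 0 :=
  mem_ideal_span_X_image

/-- An ideal is in generic position with respect to the reverse lexicographic order, in degrees at
least two: every variable is regular modulo the later ones in degrees at least two, and the
linear colon ideals with respect to the variables have leading variables that form an initial
segment. -/
structure RevLexGeneric (Q : Ideal (MvPolynomial (Fin n) K)) : Prop where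
  isHomogeneous : Q.IsHomogeneous (homogeneousSubmodule (Fin n) K)
  regular : ∀ (j : Fin n) (d : ℕ) (a : MvPolynomial (Fin n) K), 2 ≤ d → a.IsHomogeneous d →
    X j * a ∈ Q ⊔ laterIdeal K j → a ∈ Q ⊔ laterIdeal K j
  stable : ∀ i j : Fin n, i ≤ j → ∀ μ ∈ Submodule.span K (X '' Set.Ioi i),
    X j * (X i + μ) ∈ Q ⊔ laterIdeal K j → ∀ k ≤ i,
    ∃ μ' ∈ Submodule.span K (X '' Set.Ioi i), X j * (X k + μ') ∈ Q ⊔ laterIdeal K j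

theorem exists_isHomogeneous_sub_mem_laterIdeal {Q : Ideal (MvPolynomial (Fin n) K)}
    (hQ : Q.IsHomogeneous (homogeneousSubmodule (Fin n) K)) {j : Fin n} {d : ℕ}
    {a : MvPolynomial (Fin n) K} (ha : a.IsHomogeneous d) (h : a ∈ Q ⊔ laterIdeal K j) :
    ∃ q ∈ Q, q.IsHomogeneous d ∧ a - q ∈ laterIdeal K j := by
  obtain ⟨q, hq, r, hr, rfl⟩ := Submodule.mem_sup.1 h
  have hl : (laterIdeal K j).IsHomogeneous (homogeneousSubmodule (Fin n) K) := by
    apply Ideal.homogeneous_span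
    rintro _ ⟨v, -, rfl⟩
    exact ⟨1, isHomogeneous_X _ _⟩
  refine ⟨homogeneousComponent d q, homogeneousComponent_mem_of_mem hQ hq _,
    homogeneousComponent_isHomogeneous _ _, ?_⟩
  have := homogeneousComponent_mem_of_mem hl hr d
  rw [← homogeneousComponent_eq_self ha, ← map_sub, add_sub_cancel_left]
  exact this

/-- The characteristic property of the order: if x_j is the last variable of the leading monomial of
a form, every term not divisible by x_j involves a later variable, for otherwise it would be larger.
-/
theorem modMonomial_single_mem_laterIdeal {f : MvPolynomial (Fin n) K} {d : ℕ}
    (hf : f.IsHomogeneous d) {u : Fin n →₀ ℕ} (hu : IsLead (MonomialOrder.revLex (Fin n)) f u)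
    {j : Fin n} (huj : u j ≠ 0) (hu' : ∀ s, j < s → u s = 0) :
    modMonomial f (Finsupp.single j 1) ∈ laterIdeal K j := by
  refine mem_laterIdeal.2 fun w hw => ?_
  rw [mem_support_iff] at hw
  have hj : ¬ Finsupp.single j 1 ≤ w := fun h => hw (coeff_modMonomial_of_le _ h)
  rw [coeff_modMonomial_of_not_le _ hj] at hw
  refine exists_lt_ne_zero_of_revLex_le ?_ (hu.2 w hw) huj hu' ?_
  · rw [hu.degree_of_isHomogeneous hf]
    by_contra h
    exact hw (hf.coeff_eq_zero h)
  · by_contra h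
    exact hj (Finsupp.single_le_iff.2 (Nat.one_le_iff_ne_zero.2 h))

theorem divMonomial_single_isHomogeneous {f : MvPolynomial (Fin n) K} {d : ℕ}
    (hf : f.IsHomogeneous (d + 1)) (j : Fin n) :
    (divMonomial f (Finsupp.single j 1)).IsHomogeneous d := by
  refine isHomogeneous_of_degree fun w hw => ?_
  rw [coeff_divMonomial] at hw
  have := hf.degree_eq_of_coeff_ne_zero hw
  rw [map_add, Finsupp.degree_single] at this
  omega

/-- Divide by the last variable x_j of `u`. Modulo later variables `f = x_j a`, and regularity gives
`a ∈ Q` modulo later variables. Correcting `a` by terms in later variables does not touch its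
leading monomial `u / x_j`, so the degree drops until it is 2. -/
theorem RevLexGeneric.exists_isLead_le {Q : Ideal (MvPolynomial (Fin n) K)} (hQ : RevLexGeneric Q)
    (d : ℕ) : ∀ {f : MvPolynomial (Fin n) K} {u : Fin n →₀ ℕ}, f ∈ Q → f.IsHomogeneous (d + 2) →
      IsLead (MonomialOrder.revLex (Fin n)) f u →
      ∃ q ∈ Q, q.IsHomogeneous 2 ∧ ∃ u', IsLead (MonomialOrder.revLex (Fin n)) q u' ∧ u' ≤ u := by
  induction d with
  | zero => exact fun {f u} hf hd hu => ⟨f, hf, hd, u, hu, le_rfl⟩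
  | succ d ih =>
    intro f u hf hd hu
    have hdeg := hu.degree_of_isHomogeneous hd
    have hne : u.support.Nonempty := by
      rw [Finset.nonempty_iff_ne_empty, Ne, Finsupp.support_eq_empty]
      rintro rfl
      simp at hdeg
    set j := u.support.max' hne
    have huj : u j ≠ 0 := Finsupp.mem_support_iff.1 (Finset.max'_mem _ _)
    have hu' : ∀ s, j < s → u s = 0 := fun s hs => by
      by_contra h
      exact absurd (Finset.le_max' _ _ (Finsupp.mem_support_iff.2 h)) (not_le.2 hs)
    have hju : Finsupp.single j 1 ≤ u := Finsupp.single_le_iff.2 (Nat.one_le_iff_ne_zero.2 huj)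
    set a := divMonomial f (Finsupp.single j 1)
    have ha : a.IsHomogeneous (d + 2) := divMonomial_single_isHomogeneous hd j
    have hmod := modMonomial_single_mem_laterIdeal hd hu huj hu'
    have hfa := divMonomial_add_modMonomial_single f j
    have hXa : X j * a ∈ Q ⊔ laterIdeal K j := by
      have : X j * a = f - modMonomial f (Finsupp.single j 1) := eq_sub_of_add_eq hfa
      rw [this]
      exact Ideal.sub_mem _ (Ideal.mem_sup_left hf) (Ideal.mem_sup_right hmod)
    obtain ⟨q, hq, hq2, hr⟩ := exists_isHomogeneous_sub_mem_laterIdeal hQ.isHomogeneous ha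
      (hQ.regular j _ a (by omega) ha hXa)
    rw [mem_laterIdeal] at hr
    clear_value j
    obtain ⟨u', rfl⟩ := exists_add_of_le hju
    rw [map_add, Finsupp.degree_single] at hdeg
    have hu's : ∀ s, j < s → u' s = 0 := fun s hs => by
      have := hu' s hs
      simp only [Finsupp.add_apply] at this
      omega
    have hlead : IsLead (MonomialOrder.revLex (Fin n)) q u' := by
      constructor
      · intro h0
        have h1 : coeff u' (a - q) ≠ 0 := by
          rw [coeff_sub, h0, sub_zero, coeff_divMonomial]
          exact hu.1
        obtain ⟨s, hs, hs'⟩ := hr u' (mem_support_iff.2 h1)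
        exact hs' (hu's s hs)
      · intro w hw
        have hwd : w.degree = d + 2 := by
          by_contra h
          exact hw (hq2.coeff_eq_zero h)
        by_cases hwa : coeff w a = 0
        · have h1 : coeff w (a - q) ≠ 0 := by
            rw [coeff_sub, hwa, zero_sub]
            exact neg_ne_zero.2 hw
          obtain ⟨s, hs, hs'⟩ := hr w (mem_support_iff.2 h1)
          exact (revLex_lt_of_ne_zero (by omega) (fun t ht => hu's t (hs.trans_le ht)) hs').le
        · rw [coeff_divMonomial] at hwa
          have := hu.2 _ hwa
          rw [map_add, map_add] at this
          exact le_of_add_le_add_left this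
    obtain ⟨q', hq', hq'2, u'', hu'', hle⟩ := ih hq hq2 hlead
    exact ⟨q', hq', hq'2, u'', hu'', hle.trans le_add_self⟩

theorem span_X_Ioi_le (i : Fin n) :
    Submodule.span K (X '' Set.Ioi i : Set (MvPolynomial (Fin n) K)) ≤
      ((laterIdeal K i).restrictScalars K) ⊓ homogeneousSubmodule (Fin n) K 1 := by
  refine Submodule.span_le.2 ?_
  rintro _ ⟨s, hs, rfl⟩
  exact ⟨Ideal.subset_span ⟨s, hs, rfl⟩, isHomogeneous_X _ _⟩

theorem mem_span_X_Ioi {i : Fin n} {f : MvPolynomial (Fin n) K}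
    (h : ∀ w, coeff w f ≠ 0 → ∃ s, i < s ∧ w = Finsupp.single s 1) :
    f ∈ Submodule.span K (X '' Set.Ioi i : Set (MvPolynomial (Fin n) K)) := by
  rw [f.as_sum]
  refine Submodule.sum_mem _ fun w hw => ?_
  obtain ⟨s, hs, rfl⟩ := h w (mem_support_iff.1 hw)
  rw [← mul_one (coeff _ f), ← smul_eq_mul, ← smul_monomial]
  exact Submodule.smul_mem _ _ (Submodule.subset_span ⟨s, hs, rfl⟩)

/-- Modulo the variables after x_j, a quadric with leading monomial x_i x_j is x_j times a linear
form with leading variable x_i. The `stable` condition replaces that form by one with leading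
variable x_k, and the result lifts back to `Q`. -/
theorem RevLexGeneric.exists_isLead_of_le {Q : Ideal (MvPolynomial (Fin n) K)}
    (hQ : RevLexGeneric Q) {i j k : Fin n} (hij : i ≤ j) (hki : k ≤ i)
    {q : MvPolynomial (Fin n) K} (hq : q ∈ Q) (hq2 : q.IsHomogeneous 2)
    (hlead : IsLead (MonomialOrder.revLex (Fin n)) q (Finsupp.single i 1 + Finsupp.single j 1)) :
    ∃ q' ∈ Q, q'.IsHomogeneous 2 ∧
      IsLead (MonomialOrder.revLex (Fin n)) q' (Finsupp.single k 1 + Finsupp.single j 1) := by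
  have hz : ∀ {i j : Fin n}, i ≤ j → ∀ s, j < s →
      (Finsupp.single i 1 + Finsupp.single j 1 : Fin n →₀ ℕ) s = 0 := fun {i j} hij s hs => by
    simp [Finsupp.single_eq_of_ne hs.ne', Finsupp.single_eq_of_ne (hij.trans_lt hs).ne']
  set c := coeff (Finsupp.single i 1 + Finsupp.single j 1) q with hc
  have hmod := modMonomial_single_mem_laterIdeal hq2 hlead (j := j) (by simp) (hz hij)
  have hdiv : (divMonomial q (Finsupp.single j 1)).IsHomogeneous 1 :=
    divMonomial_single_isHomogeneous hq2 j
  set a := divMonomial q (Finsupp.single j 1) with ha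
  have hqa := divMonomial_add_modMonomial_single q j
  rw [← ha] at hqa
  have hsupp : ∀ w, coeff w a ≠ 0 → ∃ s, i ≤ s ∧ w = Finsupp.single s 1 := by
    intro w hw
    have hwd : w.degree = 1 := by
      by_contra h
      exact hw (hdiv.coeff_eq_zero h)
    obtain ⟨s, rfl⟩ := exists_eq_single_of_degree_eq_one hwd
    refine ⟨s, ?_, rfl⟩
    rw [ha, coeff_divMonomial, add_comm] at hw
    have := hlead.2 _ hw
    rw [map_add, map_add] at this
    have := le_of_add_le_add_right this
    by_contra! h
    exact absurd this (not_le.2 (revLex_single_lt_single.2 h))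
  have hci : coeff (Finsupp.single i 1) a = c := by
    rw [ha, coeff_divMonomial, add_comm]
  set μ := C c⁻¹ * a - X i with hμ
  have hμ1 : μ ∈ Submodule.span K (X '' Set.Ioi i) := by
    refine mem_span_X_Ioi fun w hw => ?_
    by_cases hwi : w = Finsupp.single i 1
    · refine absurd ?_ hw
      rw [hwi, hμ, coeff_sub, coeff_C_mul, hci, inv_mul_cancel₀ hlead.1, coeff_X_same, sub_self]
    · rw [hμ, coeff_sub, coeff_C_mul, coeff_X, if_neg (Ne.symm hwi), sub_zero] at hw
      obtain ⟨s, hs, rfl⟩ := hsupp w (right_ne_zero_of_mul hw)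
      refine ⟨s, lt_of_le_of_ne hs fun h => hwi (by rw [h]), rfl⟩
  have hmem : X j * (X i + μ) ∈ Q ⊔ laterIdeal K j := by
    have : X j * (X i + μ) = C c⁻¹ * (q - modMonomial q (Finsupp.single j 1)) := by
      rw [hμ]
      linear_combination C c⁻¹ * hqa
    rw [this]
    exact Ideal.mul_mem_left _ _
      (Ideal.sub_mem _ (Ideal.mem_sup_left hq) (Ideal.mem_sup_right hmod))
  obtain ⟨μ', hμ', hmem'⟩ := hQ.stable i j hij μ hμ1 hmem k hki
  have hμ'' := span_X_Ioi_le i hμ'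
  have hhom : (X j * (X k + μ')).IsHomogeneous 2 :=
    (isHomogeneous_X K j).mul ((isHomogeneous_X K k).add hμ''.2)
  obtain ⟨q', hq', hq'2, hr⟩ := exists_isHomogeneous_sub_mem_laterIdeal hQ.isHomogeneous hhom hmem'
  rw [mem_laterIdeal] at hr
  have hμs := mem_laterIdeal.1 hμ''.1
  have hkj := hki.trans hij
  have hcoeff : coeff (Finsupp.single k 1 + Finsupp.single j 1) (X j * (X k + μ')) = 1 := by
    have : coeff (Finsupp.single k 1) μ' = 0 := by
      by_contra h
      obtain ⟨s, hs, hs'⟩ := hμs _ (mem_support_iff.2 h)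
      exact hs' (Finsupp.single_eq_of_ne (hki.trans_lt hs).ne')
    rw [add_comm, coeff_X_mul, coeff_add, this, coeff_X_same, add_zero]
  refine ⟨q', hq', hq'2, ?_, ?_⟩
  · intro h0
    have h1 : coeff (Finsupp.single k 1 + Finsupp.single j 1) (X j * (X k + μ') - q') ≠ 0 := by
      rw [coeff_sub, h0, hcoeff, sub_zero]
      exact one_ne_zero
    obtain ⟨s, hs, hs'⟩ := hr _ (mem_support_iff.2 h1)
    exact hs' (hz hkj s hs)
  · intro w hw
    have hwd : w.degree = 2 := by
      by_contra h
      exact hw (hq'2.coeff_eq_zero h)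
    by_cases hwa : coeff w (X j * (X k + μ')) = 0
    · have h1 : coeff w (X j * (X k + μ') - q') ≠ 0 := by
        rw [coeff_sub, hwa, zero_sub]
        exact neg_ne_zero.2 hw
      obtain ⟨s, hs, hs'⟩ := hr w (mem_support_iff.2 h1)
      exact (revLex_lt_of_ne_zero (by simp [hwd]) (fun t ht => hz hkj t (hs.trans_le ht)) hs').le
    · rw [coeff_X_mul'] at hwa
      split_ifs at hwa with hjw
      · obtain ⟨w', rfl⟩ := exists_add_of_le
          (Finsupp.single_le_iff.2 (Nat.one_le_iff_ne_zero.2 (Finsupp.mem_support_iff.1 hjw)))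
        rw [add_tsub_cancel_left, coeff_add, coeff_X] at hwa
        rw [add_comm, map_add, map_add]
        refine add_le_add_left ?_ _
        split_ifs at hwa with hw'
        · rw [hw']
        · rw [zero_add] at hwa
          obtain ⟨s, hs, hs'⟩ := hμs _ (mem_support_iff.2 hwa)
          have hw'd : w'.degree = 1 := by
            rw [map_add, Finsupp.degree_single] at hwd
            omega
          refine (revLex_lt_of_ne_zero (by simp [hw'd]) (fun t ht => ?_) hs').le
          exact Finsupp.single_eq_of_ne ((hki.trans_lt hs).trans_le ht).ne'
      · exact absurd rfl hwa

end RevLex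

/-! ### Linear changes of coordinates -/

section Coordinates

variable {K : Type*} [Field K] {n : ℕ}

/-- The linear substitution `x_i ↦ ∑ j, g i j x_j`. -/
noncomputable def coordChange (g : GL (Fin n) K) :
    MvPolynomial (Fin n) K →ₐ[K] MvPolynomial (Fin n) K :=
  aeval (coordForm g)

theorem coordForm_eq_linForm (g : GL (Fin n) K) (i : Fin n) :
    coordForm g i = linForm (g.val i) := by
  rw [coordForm, linForm_apply]

theorem coordChange_X (g : GL (Fin n) K) (i : Fin n) :
    coordChange g (X i) = linForm (g.val i) := by
  rw [coordChange, aeval_X, coordForm_eq_linForm]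

theorem coordForm_isHomogeneous (g : GL (Fin n) K) (i : Fin n) :
    (coordForm g i).IsHomogeneous 1 := by
  rw [coordForm_eq_linForm]
  exact linForm_isHomogeneous _

theorem coordChange_isHomogeneous (g : GL (Fin n) K) {f : MvPolynomial (Fin n) K} {d : ℕ}
    (hf : f.IsHomogeneous d) : (coordChange g f).IsHomogeneous d := by
  have := hf.aeval (coordForm g) (fun i => coordForm_isHomogeneous g i)
  rwa [one_mul] at this

theorem homogeneousComponent_coordChange (g : GL (Fin n) K) (f : MvPolynomial (Fin n) K) (d : ℕ) :
    homogeneousComponent d (coordChange g f) = coordChange g (homogeneousComponent d f) := by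
  conv_lhs => rw [← sum_homogeneousComponent f, map_sum, map_sum]
  have h : ∀ i, homogeneousComponent d (coordChange g (homogeneousComponent i f)) =
      if i = d then coordChange g (homogeneousComponent d f) else 0 := by
    intro i
    rw [homogeneousComponent_of_mem (coordChange_isHomogeneous g
      (homogeneousComponent_isHomogeneous i f))]
    by_cases hi : i = d
    · simp [hi]
    · rw [if_neg hi, if_neg (Ne.symm hi)]
  simp only [h, Finset.sum_ite_eq', Finset.mem_range]
  split_ifs with h1
  · rfl
  · rw [homogeneousComponent_eq_zero _ _ (by omega), map_zero]

theorem isHomogeneous_comap_coordChange (g : GL (Fin n) K) {Q : Ideal (MvPolynomial (Fin n) K)}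
    (hQ : Q.IsHomogeneous (homogeneousSubmodule (Fin n) K)) :
    (Q.comap (coordChange g)).IsHomogeneous (homogeneousSubmodule (Fin n) K) := by
  intro d f hf
  have h : (DirectSum.decompose (homogeneousSubmodule (Fin n) K) f d : MvPolynomial (Fin n) K) =
      homogeneousComponent d f := decomposition.decompose'_apply f d
  rw [h, Ideal.mem_comap, ← homogeneousComponent_coordChange]
  exact homogeneousComponent_mem_of_mem hQ hf d

theorem coordChange_linForm (g : GL (Fin n) K) (v : Fin n → K) :
    coordChange g (linForm v) = linForm (Matrix.vecMul v g.val) := by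
  rw [linForm_apply, map_sum, Matrix.vecMul_eq_sum, map_sum]
  refine Finset.sum_congr rfl fun i _ => ?_
  rw [map_mul, coordChange_X, map_smul, smul_eq_C_mul, algHom_C, algebraMap_eq]

theorem coordChange_mul (g h : GL (Fin n) K) (f : MvPolynomial (Fin n) K) :
    coordChange (g * h) f = coordChange h (coordChange g f) := by
  have : coordChange (g * h) = (coordChange h).comp (coordChange g) := by
    ext1 i
    rw [AlgHom.comp_apply, coordChange_X, coordChange_X, coordChange_linForm]
    congr 1
  rw [this, AlgHom.comp_apply]

theorem coordChange_one (f : MvPolynomial (Fin n) K) : coordChange 1 f = f := by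
  have : coordChange (1 : GL (Fin n) K) = AlgHom.id K _ := by
    ext1 i
    rw [coordChange_X, AlgHom.id_apply, ← linForm_single]
    congr 1
    ext j
    simp [Matrix.one_apply, Pi.single_apply, eq_comm]
  rw [this, AlgHom.id_apply]

theorem coordChange_inv_apply (g : GL (Fin n) K) (f : MvPolynomial (Fin n) K) :
    coordChange g⁻¹ (coordChange g f) = f := by
  rw [← coordChange_mul, mul_inv_cancel, coordChange_one]

theorem coordChange_apply_inv (g : GL (Fin n) K) (f : MvPolynomial (Fin n) K) :
    coordChange g (coordChange g⁻¹ f) = f := by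
  rw [← coordChange_mul, inv_mul_cancel, coordChange_one]

theorem mem_comap_coordChange_sup {g : GL (Fin n) K} {Q I : Ideal (MvPolynomial (Fin n) K)}
    {f : MvPolynomial (Fin n) K} :
    f ∈ Q.comap (coordChange g) ⊔ I ↔ coordChange g f ∈ Q ⊔ I.map (coordChange g) := by
  have hs : Function.Surjective (coordChange g) := fun f => ⟨_, coordChange_apply_inv g f⟩
  have hi : Function.Injective (coordChange g) :=
    Function.LeftInverse.injective (coordChange_inv_apply g)
  have h : (Q.comap (coordChange g) ⊔ I).map (coordChange g) = Q ⊔ I.map (coordChange g) := by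
    rw [Ideal.map_sup, Ideal.map_comap_of_surjective _ hs]
  rw [← h]
  refine ⟨fun hf => Ideal.mem_map_of_mem _ hf, fun hf => ?_⟩
  obtain ⟨f', hf', he⟩ := (Ideal.mem_map_iff_of_surjective _ hs).1 hf
  rwa [← hi he]

theorem linIdeal_span (s : Set (Fin n → K)) :
    linIdeal (Submodule.span K s) = Ideal.span (linForm '' s) := by
  apply le_antisymm
  · refine Ideal.span_le.2 ?_
    rintro _ ⟨v, hv, rfl⟩
    have : Submodule.span K s ≤
        ((Ideal.span (linForm '' s)).restrictScalars K).comap linForm :=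
      Submodule.span_le.2 fun w hw => Ideal.subset_span ⟨w, hw, rfl⟩
    exact this hv
  · exact Ideal.span_mono (Set.image_mono Submodule.subset_span)

theorem flagSpan_eq_top {Q : Ideal (MvPolynomial (Fin n) K)} {v : ℕ → Fin n → K}
    (hv : ∀ k < n, IsGenericAt Q v k) : flagSpan v n = ⊤ := by
  have h : ∀ k ≤ n, k ≤ Module.finrank K (flagSpan v k) := by
    intro k
    induction k with
    | zero => simp
    | succ k ih =>
      intro hk
      have hlt : flagSpan v k < flagSpan v (k + 1) := by
        refine lt_of_le_of_ne (flagSpan_mono v (by omega)) fun h => (hv k (by omega)).notMem ?_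
        rw [h]
        exact Submodule.subset_span ⟨k, by simp, rfl⟩
      have := Submodule.finrank_lt_finrank_of_lt hlt
      have := ih (by omega)
      omega
  refine Submodule.eq_top_of_finrank_eq (le_antisymm (Submodule.finrank_le _) ?_)
  simpa using h n le_rfl

/-- An ideal with a `2`-linear resolution is in generic position with respect to the reverse
lexicographic order in suitable coordinates. -/
theorem Ideal.HasLinearResolution.exists_revLexGeneric [Infinite K]
    {Q : Ideal (MvPolynomial (Fin n) K)}
    (h2 : (2 : K) ≠ 0) (hQ : Q.HasLinearResolution 2) :
    ∃ g : GL (Fin n) K, RevLexGeneric (Q.comap (coordChange g)) := by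
  obtain ⟨F, hF⟩ := hQ.exists_quadraticComplex
  obtain ⟨v, hv⟩ := hF.exists_forall_isGenericAt h2
  -- The flag is used backwards: its first member becomes the last variable, so that the variables
  -- after x_i span the initial part of the flag of length `n - 1 - i`.
  let r : Fin n → ℕ := fun i => n - 1 - i
  have hr : ∀ i, r i < n := fun i => by have := i.2; simp only [r]; omega
  have himg : ∀ i, (fun i => v (r i)) '' Set.Ioi i = v '' Set.Iio (r i) := by
    intro i
    ext w
    constructor
    · rintro ⟨j, hj, rfl⟩
      refine ⟨r j, ?_, rfl⟩
      have := Fin.lt_def.1 (Set.mem_Ioi.1 hj)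
      have := j.2
      simp only [Set.mem_Iio, r]
      omega
    · rintro ⟨k, hk, rfl⟩
      have hk' := Set.mem_Iio.1 hk
      simp only [r] at hk'
      refine ⟨⟨n - 1 - k, by omega⟩, ?_, ?_⟩
      · rw [Set.mem_Ioi, Fin.lt_def]
        dsimp only
        omega
      · simp only [r]
        congr 1
        omega
  let M : Matrix (Fin n) (Fin n) K := Matrix.of fun i => v (r i)
  have hM : IsUnit M := by
    rw [← Matrix.linearIndependent_rows_iff_isUnit]
    refine linearIndependent_of_top_le_span_of_card_eq_finrank ?_ (by simp)
    rw [← flagSpan_eq_top hv]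
    refine Submodule.span_mono ?_
    rintro _ ⟨k, hk, rfl⟩
    have hk' := Set.mem_Iio.1 hk
    refine ⟨⟨n - 1 - k, by omega⟩, ?_⟩
    change v (n - 1 - (n - 1 - k)) = v k
    congr 1
    omega
  refine ⟨hM.unit, ?_⟩
  set g := hM.unit
  have hgX : ∀ i, coordChange g (X i) = linForm (v (r i)) := fun i => coordChange_X g i
  have himgX : ∀ i, coordChange g '' (X '' Set.Ioi i) = linForm '' (v '' Set.Iio (r i)) := by
    intro i
    rw [← himg, Set.image_image, Set.image_image]
    exact Set.image_congr fun j _ => hgX j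
  have hlater : ∀ i, (laterIdeal K i).map (coordChange g) = linIdeal (flagSpan v (r i)) := by
    intro i
    rw [laterIdeal, Ideal.map_span, flagSpan, linIdeal_span]
    exact congrArg _ (himgX i)
  have hspan : ∀ i, (Submodule.span K (X '' Set.Ioi i)).map (coordChange g).toLinearMap =
      (flagSpan v (r i)).map linForm := by
    intro i
    rw [Submodule.map_span, flagSpan, Submodule.map_span]
    exact congrArg _ (himgX i)
  refine ⟨isHomogeneous_comap_coordChange g F.isHomogeneous, ?_, ?_⟩
  · intro j d a hd ha h
    rw [mem_comap_coordChange_sup, hlater] at h ⊢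
    rw [map_mul, hgX] at h
    exact (hv (r j) (hr j)).regular d _ hd (coordChange_isHomogeneous g ha) h
  · intro i j hij μ hμ h k hk
    obtain ⟨w, hw, hwμ⟩ : coordChange g μ ∈ (flagSpan v (r i)).map linForm := by
      rw [← hspan]
      exact ⟨μ, hμ, rfl⟩
    have hij' : r j ≤ r i := by
      have := Fin.le_def.1 hij
      simp only [r]
      omega
    rw [mem_comap_coordChange_sup, hlater, map_mul, map_add, hgX, hgX, ← hwμ, ← map_add] at h
    -- A leading variable x_i in the colon puts `v (r i)` into the colon plus the flag, hence that
    -- sum is everything, and in particular it contains `v (r k)`.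
    have htop := (hv (r i) (hr i)).colon (r j) hij' (by
      rw [← add_sub_cancel_right (v (r i)) w]
      exact Submodule.sub_mem _ (Submodule.mem_sup_left h) (Submodule.mem_sup_right hw))
    have hmem : v (r k) ∈ linColon (Q ⊔ linIdeal (flagSpan v (r j))) (v (r j)) ⊔
        flagSpan v (r i) := by
      rw [htop]
      trivial
    obtain ⟨y, hy, z, hz, hyz⟩ := Submodule.mem_sup.1 hmem
    obtain ⟨μ', hμ', hμz⟩ : linForm (-z) ∈
        (Submodule.span K (X '' Set.Ioi i)).map (coordChange g).toLinearMap := by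
      rw [hspan]
      exact ⟨-z, Submodule.neg_mem _ hz, rfl⟩
    refine ⟨μ', hμ', ?_⟩
    rw [mem_comap_coordChange_sup, hlater, map_mul, map_add, hgX, hgX]
    rw [AlgHom.toLinearMap_apply] at hμz
    rw [hμz, ← map_add, ← hyz, add_neg_cancel_right]
    exact hy

end Coordinates

/-! ### A criterion for quadratic Gröbner bases -/

section Criterion

variable {σ K : Type*} [Finite σ] [Field K]

/-- There are only finitely many monomials of degree 2, so one quadric for each quadratic leading
monomial gives a finite basis. -/
theorem hasQuadraticGroebnerBasis_of_forall_exists (m : MonomialOrder σ)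
    {J : Ideal (MvPolynomial σ K)}
    (h : ∀ f ∈ J, ∀ u, IsLead m f u → ∃ g ∈ J, g.IsHomogeneous 2 ∧ ∃ u', IsLead m g u' ∧ u' ≤ u) :
    HasQuadraticGroebnerBasis m J := by
  classical
  let L : Set (σ →₀ ℕ) := {u | ∃ g ∈ J, g.IsHomogeneous 2 ∧ IsLead m g u}
  have hL : L.Finite := (Finsupp.finite_of_degree_eq 2).subset fun u hu => by
    obtain ⟨g, -, hg2, hu⟩ := hu
    exact hu.degree_of_isHomogeneous hg2
  have hc : ∀ u : σ →₀ ℕ, ∃ g, u ∈ L → g ∈ J ∧ g.IsHomogeneous 2 ∧ IsLead m g u := fun u => by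
    by_cases hu : u ∈ L
    · obtain ⟨g, hg⟩ := hu
      exact ⟨g, fun _ => hg⟩
    · exact ⟨0, fun h => absurd h hu⟩
  choose G hG using hc
  refine ⟨hL.toFinset.image G, ⟨fun g hg => ?_, le_antisymm ?_ ?_⟩, fun g hg => ?_⟩
  · obtain ⟨u, hu, rfl⟩ := Finset.mem_image.1 hg
    exact (hG u (by simpa using hu)).1
  · refine Ideal.span_mono (Set.image_mono fun g hg => ?_)
    obtain ⟨u, hu, rfl⟩ := Finset.mem_image.1 (Finset.mem_coe.1 hg)
    exact (hG u (by simpa using hu)).1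
  · refine Ideal.span_le.2 ?_
    rintro _ ⟨f, hf, rfl⟩
    by_cases hf0 : f = 0
    · rw [hf0, m.leadingTerm_zero]
      exact zero_mem _
    obtain ⟨g, hg, hg2, u, hu, hle⟩ := h f hf _ (isLead_degree hf0)
    have huL : u ∈ L := ⟨g, hg, hg2, hu⟩
    obtain ⟨-, -, hGu⟩ := hG u huL
    obtain ⟨v, hv⟩ := exists_add_of_le hle
    have hmem : m.leadingTerm (G u) ∈ Ideal.span (m.leadingTerm ''
        (hL.toFinset.image G : Finset (MvPolynomial σ K))) :=
      Ideal.subset_span ⟨G u, by simpa using ⟨u, huL, rfl⟩, rfl⟩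
    have hlc : m.leadingCoeff (G u) ≠ 0 := by
      rw [MonomialOrder.leadingCoeff, hGu.degree_eq]
      exact hGu.1
    have heq : m.leadingTerm f =
        monomial v (m.leadingCoeff f * (m.leadingCoeff (G u))⁻¹) * m.leadingTerm (G u) := by
      rw [MonomialOrder.leadingTerm, MonomialOrder.leadingTerm, hv, hGu.degree_eq, monomial_mul,
        inv_mul_cancel_right₀ hlc, add_comm]
    rw [SetLike.mem_coe, heq]
    exact Ideal.mul_mem_left _ _ hmem
  · obtain ⟨u, hu, rfl⟩ := Finset.mem_image.1 hg
    exact (hG u (by simpa using hu)).2.1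

end Criterion

/-! ### Merging the two sets of variables -/

section Merge

variable {n : ℕ}

/-- The exponents of the variables `x_i`. -/
noncomputable def xPart (w : Fin (n + n) →₀ ℕ) : Fin n →₀ ℕ :=
  Finsupp.equivFunOnFinite.symm fun i => w (Fin.castAdd n i)

/-- The exponents of the variables `y_i`. -/
noncomputable def yPart (w : Fin (n + n) →₀ ℕ) : Fin n →₀ ℕ :=
  Finsupp.equivFunOnFinite.symm fun i => w (Fin.natAdd n i)

@[simp] theorem xPart_apply (w : Fin (n + n) →₀ ℕ) (i : Fin n) : xPart w i = w (Fin.castAdd n i) :=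
  rfl

@[simp] theorem yPart_apply (w : Fin (n + n) →₀ ℕ) (i : Fin n) : yPart w i = w (Fin.natAdd n i) :=
  rfl

theorem castAdd_lt_natAdd (i k : Fin n) : Fin.castAdd n i < Fin.natAdd n k :=
  Fin.lt_def.2 (i.2.trans_le (Nat.le_add_right n k))

theorem degree_xPart_add_yPart (w : Fin (n + n) →₀ ℕ) :
    (xPart w + yPart w).degree = w.degree := by
  rw [map_add, Finsupp.degree_eq_sum, Finsupp.degree_eq_sum, Finsupp.degree_eq_sum,
    Fin.sum_univ_add]
  rfl

theorem revLex_lt_of_le_of_lt {u w : Fin n →₀ ℕ} {j : Fin n} (hdeg : w.degree = u.degree)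
    (hle : ∀ k, j ≤ k → u k ≤ w k) (hlt : u j < w j) :
    (MonomialOrder.revLex (Fin n)).toSyn w < (MonomialOrder.revLex (Fin n)).toSyn u := by
  classical
  let s : Finset (Fin n) := Finset.univ.filter fun k => w k ≠ u k
  have hj : j ∈ s := by simp [s, hlt.ne']
  have hs : s.Nonempty := ⟨j, hj⟩
  have hmax := s.max'_mem hs
  refine revLex_lt_iff.2 (Or.inr ⟨hdeg, s.max' hs, fun k hk => ?_, ?_⟩)
  · by_contra h
    exact absurd (s.le_max' k (by simpa [s] using Ne.symm h)) (not_le.2 hk)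
  · exact lt_of_le_of_ne (hle _ (s.le_max' j hj)) (Ne.symm (Finset.mem_filter.1 hmax).2)

/-- Merging is strictly monotone below a sorted monomial, for fixed bidegree. -/
theorem revLex_merge_lt_merge {u w : Fin (n + n) →₀ ℕ} (hdeg : w.degree = u.degree)
    (hy : (yPart w).degree = (yPart u).degree)
    (hsort : ∀ i j, u (Fin.castAdd n j) ≠ 0 → u (Fin.natAdd n i) ≠ 0 → j ≤ i)
    (hlt : (MonomialOrder.revLex (Fin (n + n))).toSyn w <
      (MonomialOrder.revLex (Fin (n + n))).toSyn u) :
    (MonomialOrder.revLex (Fin n)).toSyn (xPart w + yPart w) <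
      (MonomialOrder.revLex (Fin n)).toSyn (xPart u + yPart u) := by
  have hdeg' : (xPart w + yPart w).degree = (xPart u + yPart u).degree := by
    rw [degree_xPart_add_yPart, degree_xPart_add_yPart, hdeg]
  rcases revLex_lt_iff.1 hlt with h | ⟨-, p, hp, hlt⟩
  · omega
  induction p using Fin.addCases with
  | left i =>
    have hyeq : ∀ k, u (Fin.natAdd n k) = w (Fin.natAdd n k) := fun k =>
      hp _ (castAdd_lt_natAdd _ _)
    refine revLex_lt_of_le_of_lt hdeg' (j := i) (fun k hk => ?_) ?_
    · simp only [Finsupp.add_apply, xPart_apply, yPart_apply, hyeq]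
      rcases hk.lt_or_eq with hk | rfl
      · rw [hp (Fin.castAdd n k) hk]
      · omega
    · simp only [Finsupp.add_apply, xPart_apply, yPart_apply, hyeq]
      omega
  | right j =>
    have hyeq : ∀ k, j < k → u (Fin.natAdd n k) = w (Fin.natAdd n k) := fun k hk =>
      hp _ (by simpa using hk)
    -- `w` has more y_j than `u` and the same later y's, while the y-degrees agree; so `u` contains
    -- an earlier y_i. Sortedness then bars x_k with k ≥ j from `u`, and merging cannot reverse the
    -- comparison at j.
    obtain ⟨i, hij, hi⟩ : ∃ i, i < j ∧ u (Fin.natAdd n i) ≠ 0 := by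
      by_contra! h
      have : (yPart u).degree < (yPart w).degree := by
        rw [Finsupp.degree_eq_sum, Finsupp.degree_eq_sum]
        refine Finset.sum_lt_sum (fun k _ => ?_) ⟨j, Finset.mem_univ _, hlt⟩
        rcases lt_trichotomy k j with hk | rfl | hk
        · rw [yPart_apply, yPart_apply, h k hk]
          exact Nat.zero_le _
        · exact hlt.le
        · exact (hyeq k hk).le
      omega
    have hx : ∀ k, j ≤ k → u (Fin.castAdd n k) = 0 := fun k hk => by
      by_contra h
      exact absurd (hsort i k h hi) (not_le.2 (hij.trans_le hk))
    refine revLex_lt_of_le_of_lt hdeg' (j := j) (fun k hk => ?_) ?_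
    · simp only [Finsupp.add_apply, xPart_apply, yPart_apply, hx k hk]
      rcases hk.lt_or_eq with hk | rfl
      · rw [hyeq k hk]
        omega
      · omega
    · simp only [Finsupp.add_apply, xPart_apply, yPart_apply, hx j le_rfl]
      omega

variable {K : Type*} [Field K]

/-- The substitution `x_i ↦ x_i`, `y_i ↦ x_i t`. -/
noncomputable def mergeHom (n : ℕ) (K : Type*) [Field K] :
    MvPolynomial (Fin (n + n)) K →ₐ[K] Polynomial (MvPolynomial (Fin n) K) :=
  aeval (Fin.append (fun i => Polynomial.C (X i)) (fun i => Polynomial.C (X i) * Polynomial.X))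

theorem mergeHom_monomial (w : Fin (n + n) →₀ ℕ) (c : K) :
    mergeHom n K (monomial w c) =
      Polynomial.monomial (yPart w).degree (monomial (xPart w + yPart w) c) := by
  rw [mergeHom, aeval_monomial, Finsupp.prod_fintype _ _ (by simp), Fin.prod_univ_add]
  simp only [Fin.append_left, Fin.append_right, mul_pow, Finset.prod_mul_distrib]
  have h1 : ∀ v : Fin n →₀ ℕ, ∏ i, (Polynomial.C (X i : MvPolynomial (Fin n) K)) ^ v i =
      Polynomial.C (monomial v 1) := fun v => by
    rw [monomial_eq, C_1, one_mul, Finsupp.prod_fintype _ _ (by simp), map_prod]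
    simp
  have h2 : ∏ i, (Polynomial.X : Polynomial (MvPolynomial (Fin n) K)) ^ (yPart w) i =
      Polynomial.X ^ (yPart w).degree := by
    rw [Finset.prod_pow_eq_pow_sum, Finsupp.degree_eq_sum]
  have h3 := h1 (xPart w)
  have h4 := h1 (yPart w)
  simp only [xPart_apply, yPart_apply] at h2 h3 h4
  rw [h2, h3, h4, ← Polynomial.C_mul_X_pow_eq_monomial, ← mul_assoc, ← mul_assoc]
  congr 1
  change Polynomial.C (C c) * _ * _ = _
  rw [← Polynomial.C_mul, ← Polynomial.C_mul, C_mul_monomial, monomial_mul, mul_one, mul_one]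

theorem coeff_coeff_mergeHom (f : MvPolynomial (Fin (n + n)) K) (b : ℕ) (v : Fin n →₀ ℕ) :
    coeff v ((mergeHom n K f).coeff b) =
      ∑ w ∈ f.support with xPart w + yPart w = v ∧ (yPart w).degree = b, coeff w f := by
  conv_lhs => rw [f.as_sum, map_sum, Polynomial.finsetSum_coeff, coeff_sum]
  rw [Finset.sum_filter]
  refine Finset.sum_congr rfl fun w _ => ?_
  rw [mergeHom_monomial, Polynomial.coeff_monomial]
  by_cases hb : (yPart w).degree = b
  · simp [hb, coeff_monomial]
  · simp [hb]

/-- The leading monomial after merging the variables. -/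
theorem IsLead.mergeHom {f : MvPolynomial (Fin (n + n)) K} {u : Fin (n + n) →₀ ℕ}
    (hu : IsLead (MonomialOrder.revLex (Fin (n + n))) f u)
    (hsort : ∀ i j, u (Fin.castAdd n j) ≠ 0 → u (Fin.natAdd n i) ≠ 0 → j ≤ i) :
    IsLead (MonomialOrder.revLex (Fin n))
      (homogeneousComponent u.degree ((_root_.mergeHom n K f).coeff (yPart u).degree))
      (xPart u + yPart u) := by
  -- `f` need not be bihomogeneous; the power of t and the homogeneous component isolate the
  -- bidegree of `u`. Within it, strict monotonicity keeps any other term from cancelling the image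
  -- of `u`.
  have key : ∀ w, coeff w f ≠ 0 → w ≠ u → w.degree = u.degree →
      (yPart w).degree = (yPart u).degree →
      (MonomialOrder.revLex (Fin n)).toSyn (xPart w + yPart w) <
      (MonomialOrder.revLex (Fin n)).toSyn (xPart u + yPart u) := fun w hw hne h1 h2 =>
    revLex_merge_lt_merge h1 h2 hsort (lt_of_le_of_ne (hu.2 w hw) fun h =>
      hne ((MonomialOrder.revLex (Fin (n + n))).toSyn.injective h))
  constructor
  · rw [coeff_homogeneousComponent, if_pos (degree_xPart_add_yPart u), coeff_coeff_mergeHom,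
      Finset.sum_eq_single u]
    · exact hu.1
    · intro w hw hne
      obtain ⟨hw, h1, h2⟩ := Finset.mem_filter.1 hw
      refine absurd (congrArg (MonomialOrder.revLex (Fin n)).toSyn h1)
        (key w (mem_support_iff.1 hw) hne ?_ h2).ne
      rw [← degree_xPart_add_yPart w, h1, degree_xPart_add_yPart]
    · intro h
      exact absurd (Finset.mem_filter.2 ⟨mem_support_iff.2 hu.1, rfl, rfl⟩) h
  · intro v hv
    rw [coeff_homogeneousComponent] at hv
    split_ifs at hv with hvd
    · rw [coeff_coeff_mergeHom] at hv
      obtain ⟨w, hw, hw0⟩ := Finset.exists_ne_zero_of_sum_ne_zero hv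
      obtain ⟨hw, rfl, h2⟩ := Finset.mem_filter.1 hw
      by_cases hne : w = u
      · rw [hne]
      · refine (key w hw0 hne ?_ h2).le
        rw [← degree_xPart_add_yPart w, hvd]
    · exact absurd rfl hv

/-- The substitution `x_i ↦ 0`, `y_i ↦ x_i`. -/
noncomputable def yHom (n : ℕ) (K : Type*) [Field K] :
    MvPolynomial (Fin (n + n)) K →ₐ[K] MvPolynomial (Fin n) K :=
  aeval (Fin.append (fun _ => 0) X)

theorem yHom_monomial (w : Fin (n + n) →₀ ℕ) (c : K) :
    yHom n K (monomial w c) = if xPart w = 0 then monomial (yPart w) c else 0 := by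
  rw [yHom, aeval_monomial, Finsupp.prod_fintype _ _ (by simp), Fin.prod_univ_add]
  simp only [Fin.append_left, Fin.append_right]
  split_ifs with h
  · have h1 : ∀ i, w (Fin.castAdd n i) = 0 := fun i => DFunLike.congr_fun h i
    simp only [h1, pow_zero, Finset.prod_const_one, one_mul]
    rw [monomial_eq, Finsupp.prod_fintype _ _ (by simp)]
    rfl
  · obtain ⟨i, hi⟩ := Finsupp.ne_iff.1 h
    rw [Finset.prod_eq_zero (Finset.mem_univ i), zero_mul, mul_zero]
    exact zero_pow hi

theorem eq_of_xPart_eq_of_yPart_eq {u w : Fin (n + n) →₀ ℕ} (hx : xPart u = xPart w)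
    (hy : yPart u = yPart w) : u = w := by
  ext p
  induction p using Fin.addCases with
  | left i => exact DFunLike.congr_fun hx i
  | right i => exact DFunLike.congr_fun hy i

theorem coeff_yPart_yHom (f : MvPolynomial (Fin (n + n)) K) {u : Fin (n + n) →₀ ℕ}
    (hu : xPart u = 0) : coeff (yPart u) (yHom n K f) = coeff u f := by
  conv_lhs => rw [f.as_sum, map_sum, coeff_sum]
  rw [Finset.sum_eq_single u]
  · rw [yHom_monomial, if_pos hu, coeff_monomial, if_pos rfl]
  · intro w _ hne
    rw [yHom_monomial]
    split_ifs with h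
    · rw [coeff_monomial, if_neg]
      exact fun h' => hne (eq_of_xPart_eq_of_yPart_eq (h.trans hu.symm) h')
    · rw [coeff_zero]
  · intro h
    rw [notMem_support_iff.1 h, map_zero, map_zero, coeff_zero]

end Merge

/-! ### The presentation of the symmetric algebra -/

section Presentation

variable {K : Type*} [Field K] {n : ℕ} (Q : Ideal (MvPolynomial (Fin n) K)) (g : GL (Fin n) K)

theorem symPresentation_X_castAdd (i : Fin n) : symPresentation Q g (X (Fin.castAdd n i)) =
    algebraMap (MvPolynomial (Fin n) K ⧸ Q) (SymMax Q)
      (Ideal.Quotient.mk Q (coordChange g (X i))) := by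
  rw [symPresentation, aeval_X, Fin.append_left, coordChange, aeval_X]

theorem coordChange_mul_X_mem (f : MvPolynomial (Fin n) K) (i : Fin n) :
    Ideal.Quotient.mk Q (coordChange g (f * X i)) ∈ gradedMaxIdeal Q := by
  rw [map_mul, map_mul, coordChange, aeval_X]
  exact Ideal.mul_mem_left _ _ (mk_coordForm_mem Q g i)

theorem symPresentation_rename (f : MvPolynomial (Fin n) K) :
    symPresentation Q g (rename (Fin.castAdd n) f) =
      algebraMap (MvPolynomial (Fin n) K ⧸ Q) (SymMax Q)
        (Ideal.Quotient.mk Q (coordChange g f)) := by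
  induction f using MvPolynomial.induction_on with
  | C a =>
    rw [rename_C, ← algebraMap_eq, AlgHom.commutes, ← algebraMap_eq, AlgHom.commutes,
      Ideal.Quotient.mk_algebraMap, ← IsScalarTower.algebraMap_apply]
  | add p q hp hq => simp only [map_add, hp, hq]
  | mul_X p i hp => rw [map_mul, map_mul, hp, rename_X, symPresentation_X_castAdd, ← map_mul,
      ← map_mul, ← map_mul]

theorem symPresentation_rename_mul_X (f : MvPolynomial (Fin n) K) (i : Fin n) :
    symPresentation Q g (rename (Fin.castAdd n) f * X (Fin.natAdd n i)) =
      SymmetricAlgebra.ι (MvPolynomial (Fin n) K ⧸ Q) (gradedMaxIdeal Q)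
        ⟨Ideal.Quotient.mk Q (coordChange g (f * X i)), coordChange_mul_X_mem Q g f i⟩ := by
  rw [map_mul, symPresentation_rename, symPresentation, aeval_X, Fin.append_right,
    ← Algebra.smul_def, ← map_smul]
  congr 1
  ext
  simp [coordChange]

/-- Elements linear in the y's land in S¹(𝔪) and are computed by replacing y_i by x_i. Hence any way
of writing an element of `Q` as ∑ f x_l yields a relation ∑ f y_l; the minors and the polarizations
arise like this. -/
theorem sum_symPresentation_rename_mul_X {τ : Type*} (s : Finset τ)
    (f : τ → MvPolynomial (Fin n) K) (l : τ → Fin n) (z : gradedMaxIdeal Q)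
    (hz : (z : MvPolynomial (Fin n) K ⧸ Q) =
      Ideal.Quotient.mk Q (coordChange g (∑ p ∈ s, f p * X (l p)))) :
    symPresentation Q g (∑ p ∈ s, rename (Fin.castAdd n) (f p) * X (Fin.natAdd n (l p))) =
      SymmetricAlgebra.ι (MvPolynomial (Fin n) K ⧸ Q) (gradedMaxIdeal Q) z := by
  rw [map_sum]
  simp only [symPresentation_rename_mul_X]
  rw [← map_sum]
  congr 1
  ext
  rw [hz, map_sum, map_sum, AddSubmonoidClass.coe_finsetSum]

variable {Q g}

theorem rename_mem_symDefiningIdeal {f : MvPolynomial (Fin n) K} (hf : f ∈ Q.comap (coordChange g)) :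
    rename (Fin.castAdd n) f ∈ symDefiningIdeal Q g := by
  rw [symDefiningIdeal, RingHom.mem_ker, symPresentation_rename,
    Ideal.Quotient.eq_zero_iff_mem (I := Q) |>.2 hf, map_zero]

theorem sum_rename_mul_X_mem_symDefiningIdeal {τ : Type*} (s : Finset τ)
    (f : τ → MvPolynomial (Fin n) K) (l : τ → Fin n)
    (h : ∑ p ∈ s, f p * X (l p) ∈ Q.comap (coordChange g)) :
    ∑ p ∈ s, rename (Fin.castAdd n) (f p) * X (Fin.natAdd n (l p)) ∈ symDefiningIdeal Q g := by
  rw [symDefiningIdeal, RingHom.mem_ker, sum_symPresentation_rename_mul_X Q g s f l 0, map_zero]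
  rw [Ideal.Quotient.eq_zero_iff_mem (I := Q) |>.2 h]
  rfl

theorem minor_mem_symDefiningIdeal (i j : Fin n) :
    X (Fin.castAdd n j) * X (Fin.natAdd n i) - X (Fin.castAdd n i) * X (Fin.natAdd n j) ∈
      symDefiningIdeal Q g := by
  have := sum_rename_mul_X_mem_symDefiningIdeal (Q := Q) (g := g) (Finset.univ : Finset (Fin 2))
    ![X j, -X i] ![i, j] (by
      have : ∑ p, (![X j, -X i] : Fin 2 → MvPolynomial (Fin n) K) p * X (![i, j] p) = 0 := by
        simp [Fin.sum_univ_two, mul_comm]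
      rw [this]
      exact zero_mem _)
  simpa [Fin.sum_univ_two, sub_eq_add_neg] using this

theorem symPresentation_surjective (Q : Ideal (MvPolynomial (Fin n) K)) (g : GL (Fin n) K) :
    Function.Surjective (symPresentation Q g) := by
  intro z
  induction z using SymmetricAlgebra.induction with
  | algebraMap a =>
    obtain ⟨f, rfl⟩ := Ideal.Quotient.mk_surjective a
    refine ⟨rename (Fin.castAdd n) (coordChange g⁻¹ f), ?_⟩
    rw [symPresentation_rename, coordChange_apply_inv]
  | ι x =>
    obtain ⟨x, hx⟩ := x
    obtain ⟨f, hf, rfl⟩ := (Ideal.mem_map_iff_of_surjective _ Ideal.Quotient.mk_surjective).1 hx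
    have hf' : coordChange g⁻¹ f ∈ Ideal.span (Set.range X) := by
      have hle : Ideal.span (Set.range X) ≤
          (Ideal.span (Set.range X)).comap (coordChange (K := K) g⁻¹) := by
        refine Ideal.span_le.2 ?_
        rintro _ ⟨i, rfl⟩
        rw [SetLike.mem_coe, Ideal.mem_comap, coordChange_X, linForm_apply]
        exact Ideal.sum_mem _ fun j _ => Ideal.mul_mem_left _ _ (Ideal.subset_span ⟨j, rfl⟩)
      exact hle hf
    obtain ⟨c, hc⟩ := (Ideal.mem_span_range_iff_exists_fun).1 hf'
    refine ⟨_, sum_symPresentation_rename_mul_X Q g Finset.univ c id _ ?_⟩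
    simp only [id, hc, coordChange_apply_inv]
  | mul a b ha hb =>
    obtain ⟨a, rfl⟩ := ha
    obtain ⟨b, rfl⟩ := hb
    exact ⟨a * b, map_mul _ _ _⟩
  | add a b ha hb =>
    obtain ⟨a, rfl⟩ := ha
    obtain ⟨b, rfl⟩ := hb
    exact ⟨a + b, map_add _ _ _⟩

/-- The homomorphism from the symmetric algebra onto the Rees algebra, inside `A[t]`. -/
noncomputable def symToPolynomial (Q : Ideal (MvPolynomial (Fin n) K)) :
    SymMax Q →ₐ[MvPolynomial (Fin n) K ⧸ Q] Polynomial (MvPolynomial (Fin n) K ⧸ Q) :=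
  SymmetricAlgebra.lift (A := Polynomial (MvPolynomial (Fin n) K ⧸ Q))
    ((LinearMap.toSpanSingleton _ (Polynomial (MvPolynomial (Fin n) K ⧸ Q)) Polynomial.X) ∘ₗ
      (gradedMaxIdeal Q).subtype)

theorem symToPolynomial_symPresentation (f : MvPolynomial (Fin (n + n)) K) :
    symToPolynomial Q (symPresentation Q g f) =
      (mergeHom n K f).map ((Ideal.Quotient.mk Q).comp (coordChange g).toRingHom) := by
  induction f using MvPolynomial.induction_on with
  | C a =>
    have h1 := symPresentation_rename Q g (C a)
    rw [rename_C] at h1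
    have h2 : mergeHom n K (C a) = Polynomial.C (C a) := AlgHom.commutes (mergeHom n K) a
    rw [h1, AlgHom.commutes, h2, Polynomial.map_C]
    rfl
  | add p q hp hq => simp only [map_add, Polynomial.map_add, hp, hq]
  | mul_X p i hp =>
    rw [map_mul, map_mul, map_mul, Polynomial.map_mul, hp]
    congr 1
    rw [mergeHom, aeval_X]
    induction i using Fin.addCases with
    | left i =>
      rw [symPresentation_X_castAdd, Fin.append_left, AlgHom.commutes, Polynomial.map_C]
      rfl
    | right i =>
      have h1 := symPresentation_rename_mul_X Q g 1 i
      rw [map_one, one_mul] at h1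
      rw [h1, Fin.append_right, Polynomial.map_mul, Polynomial.map_C, Polynomial.map_X,
        symToPolynomial, SymmetricAlgebra.lift_ι_apply]
      simp [Polynomial.smul_eq_C_mul]

/-- The substitution y_i ↦ x_i t, taken modulo `Q`, factors through S(𝔪) → A[t], so relations of
S(𝔪) become zero there. -/
theorem coeff_mergeHom_mem {f : MvPolynomial (Fin (n + n)) K} (hf : f ∈ symDefiningIdeal Q g)
    (b : ℕ) : (mergeHom n K f).coeff b ∈ Q.comap (coordChange g) := by
  have h := symToPolynomial_symPresentation (Q := Q) (g := g) f
  rw [(RingHom.mem_ker).1 hf, map_zero] at h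
  have := congrArg (Polynomial.coeff · b) h
  simp only [Polynomial.coeff_zero, Polynomial.coeff_map] at this
  exact (Ideal.Quotient.eq_zero_iff_mem (I := Q)).1 this.symm

/-- The homomorphism to the dual numbers that remembers the linear part of a polynomial. -/
noncomputable def linearPartHom (n : ℕ) (K : Type*) [Field K] :
    MvPolynomial (Fin n) K →ₐ[K] TrivSqZeroExt (MvPolynomial (Fin n) K) (MvPolynomial (Fin n) K) :=
  aeval fun i => TrivSqZeroExt.inr (X i)

theorem linearPartHom_apply (f : MvPolynomial (Fin n) K) :
    linearPartHom n K f = TrivSqZeroExt.inl (C (coeff 0 f)) +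
      TrivSqZeroExt.inr (homogeneousComponent 1 f) := by
  induction f using MvPolynomial.induction_on with
  | C a =>
    rw [homogeneousComponent_of_mem (isHomogeneous_C _ a), if_neg one_ne_zero,
      TrivSqZeroExt.inr_zero, add_zero, coeff_C, if_pos rfl]
    exact AlgHom.commutes (linearPartHom n K) a
  | add p q hp hq =>
    rw [map_add, hp, hq, coeff_add, map_add, map_add, TrivSqZeroExt.inl_add, TrivSqZeroExt.inr_add]
    abel
  | mul_X p i hp =>
    have h1 : linearPartHom n K (X i) = TrivSqZeroExt.inr (X i) := aeval_X _ _
    have h2 : homogeneousComponent (0 + 1) (p * X i) = homogeneousComponent 0 p * X i :=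
      homogeneousComponent_mul_of_isHomogeneous (isHomogeneous_X K i) p 0
    rw [zero_add] at h2
    rw [map_mul, hp, h1, h2, homogeneousComponent_zero, add_mul, TrivSqZeroExt.inr_mul_inr,
      TrivSqZeroExt.inl_mul_inr, add_zero, smul_eq_mul]
    have h3 : coeff 0 (p * X i) = 0 := by
      simp [coeff_mul_X']
    rw [h3, map_zero, TrivSqZeroExt.inl_zero, zero_add]

/-- Since `Q` has no constant or linear terms, taking linear parts is well defined on 𝔪 and A-linear
when A acts through its constant terms. The universal property gives S(𝔪) → Sym(𝔪/𝔪²), a polynomial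
ring, killing the x_i and keeping the y_i independent. -/
theorem coordChange_yHom_eq_zero (hQ : ∀ f ∈ Q, linearPartHom n K f = 0)
    {f : MvPolynomial (Fin (n + n)) K} (hf : f ∈ symDefiningIdeal Q g) :
    coordChange g (yHom n K f) = 0 := by
  let θ : MvPolynomial (Fin n) K ⧸ Q →+*
      TrivSqZeroExt (MvPolynomial (Fin n) K) (MvPolynomial (Fin n) K) :=
    Ideal.Quotient.lift Q (linearPartHom n K).toRingHom hQ
  have hθ : ∀ p, θ (Ideal.Quotient.mk Q p) = linearPartHom n K p := fun p => rfl
  let _ : Algebra (MvPolynomial (Fin n) K ⧸ Q) (MvPolynomial (Fin n) K) :=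
    ((TrivSqZeroExt.fstHom K (MvPolynomial (Fin n) K)
      (MvPolynomial (Fin n) K)).toRingHom.comp θ).toAlgebra
  have hsmul : ∀ (a : MvPolynomial (Fin n) K ⧸ Q) (p : MvPolynomial (Fin n) K),
      a • p = (θ a).fst * p := fun a p => rfl
  have hmax : ∀ z ∈ gradedMaxIdeal Q, (θ z).fst = 0 := by
    intro z hz
    obtain ⟨p, hp, rfl⟩ := (Ideal.mem_map_iff_of_surjective _ Ideal.Quotient.mk_surjective).1 hz
    have : Ideal.span (Set.range X) ≤ RingHom.ker (constantCoeff (R := K) (σ := Fin n)) := by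
      refine Ideal.span_le.2 ?_
      rintro _ ⟨i, rfl⟩
      simp
    have hp' : coeff 0 p = 0 := this hp
    rw [hθ, linearPartHom_apply, hp']
    simp
  let L : gradedMaxIdeal Q →ₗ[MvPolynomial (Fin n) K ⧸ Q] MvPolynomial (Fin n) K :=
    { toFun := fun z => (θ z).snd
      map_add' := fun a b => by simp
      map_smul' := fun a z => by
        rw [RingHom.id_apply, hsmul, Submodule.coe_smul, smul_eq_mul, map_mul,
          TrivSqZeroExt.snd_mul, hmax z z.2]
        simp }
  have key : ∀ p, SymmetricAlgebra.lift L (symPresentation Q g p) = coordChange g (yHom n K p) := by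
    intro p
    induction p using MvPolynomial.induction_on with
    | C a =>
      have h1 := symPresentation_rename Q g (C a)
      rw [rename_C] at h1
      have h2 : yHom n K (C a) = C a := AlgHom.commutes (yHom n K) a
      have h3 : coordChange g (C a) = C a := AlgHom.commutes (coordChange g) a
      rw [h1, AlgHom.commutes, h2, h3]
      change (θ (Ideal.Quotient.mk Q (C a))).fst = C a
      rw [hθ, linearPartHom_apply]
      simp
    | add p q hp hq => simp only [map_add, hp, hq]
    | mul_X p i hp =>
      rw [map_mul, map_mul, map_mul, map_mul, hp]
      congr 1
      rw [yHom, aeval_X]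
      induction i using Fin.addCases with
      | left i =>
        rw [symPresentation_X_castAdd, Fin.append_left, AlgHom.commutes, map_zero, coordChange_X]
        change (θ (Ideal.Quotient.mk Q (linForm (g.val i)))).fst = 0
        rw [hθ, linearPartHom_apply, (linForm_isHomogeneous _).coeff_eq_zero (by simp)]
        simp
      | right i =>
        have h1 := symPresentation_rename_mul_X Q g 1 i
        rw [map_one, one_mul] at h1
        rw [h1, Fin.append_right, SymmetricAlgebra.lift_ι_apply]
        change (θ (Ideal.Quotient.mk Q (coordChange g (1 * X i)))).snd = _
        rw [hθ, linearPartHom_apply, one_mul, coordChange_X,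
          homogeneousComponent_eq_self (linForm_isHomogeneous _)]
        simp
  rw [← key, (RingHom.mem_ker).1 hf, map_zero]

end Presentation

/-! ### Leading monomials of the defining ideal of S(𝔪) -/

section QuadraticGroebner

variable {n : ℕ}

theorem mapDomain_castAdd_apply_castAdd (w : Fin n →₀ ℕ) (i : Fin n) :
    Finsupp.mapDomain (Fin.castAdd n) w (Fin.castAdd n i) = w i :=
  Finsupp.mapDomain_apply (Fin.castAdd_injective n n) w i

theorem mapDomain_castAdd_apply_natAdd (w : Fin n →₀ ℕ) (i : Fin n) :
    Finsupp.mapDomain (Fin.castAdd n) w (Fin.natAdd n i) = 0 := by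
  refine Finsupp.mapDomain_of_notMem_range _ _ ?_
  rintro ⟨j, hj⟩
  exact (castAdd_lt_natAdd j i).ne hj

theorem revLex_mapDomain_castAdd_le {u w : Fin n →₀ ℕ}
    (h : (MonomialOrder.revLex (Fin n)).toSyn w ≤ (MonomialOrder.revLex (Fin n)).toSyn u) :
    (MonomialOrder.revLex (Fin (n + n))).toSyn (Finsupp.mapDomain (Fin.castAdd n) w) ≤
      (MonomialOrder.revLex (Fin (n + n))).toSyn (Finsupp.mapDomain (Fin.castAdd n) u) := by
  have hd : ∀ v : Fin n →₀ ℕ, (Finsupp.mapDomain (Fin.castAdd n) v).degree = v.degree := fun v =>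
    Finsupp.degree_mapDomain _ _
  rcases h.lt_or_eq with h | h
  · refine (revLex_lt_iff.2 ?_).le
    rw [hd, hd]
    refine (revLex_lt_iff.1 h).imp_right fun ⟨h1, i, h2, h3⟩ => ⟨h1, Fin.castAdd n i, ?_, ?_⟩
    · intro j hj
      induction j using Fin.addCases with
      | left j => simpa only [mapDomain_castAdd_apply_castAdd] using h2 j hj
      | right j => simp only [mapDomain_castAdd_apply_natAdd]
    · simpa only [mapDomain_castAdd_apply_castAdd] using h3
  · rw [(MonomialOrder.revLex (Fin n)).toSyn.injective h]

variable {K : Type*} [Field K]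

theorem IsLead.rename_castAdd {q : MvPolynomial (Fin n) K} {u : Fin n →₀ ℕ}
    (h : IsLead (MonomialOrder.revLex (Fin n)) q u) :
    IsLead (MonomialOrder.revLex (Fin (n + n))) (rename (Fin.castAdd n) q)
      (Finsupp.mapDomain (Fin.castAdd n) u) := by
  constructor
  · rw [coeff_rename_mapDomain _ (Fin.castAdd_injective n n)]
    exact h.1
  · intro w hw
    obtain ⟨v, rfl, hv⟩ := coeff_rename_ne_zero _ _ _ hw
    exact revLex_mapDomain_castAdd_le (h.2 v hv)

/-- The pairs `(k, l)` with `k ≤ l`. -/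
def sortedPairs (n : ℕ) : Finset (Fin n × Fin n) := Finset.univ.filter fun p => p.1 ≤ p.2

theorem single_add_single_injOn : Set.InjOn
    (fun p : Fin n × Fin n => (Finsupp.single p.1 1 + Finsupp.single p.2 1 : Fin n →₀ ℕ))
    (sortedPairs n : Set (Fin n × Fin n)) := by
  rintro ⟨k, l⟩ hkl ⟨a, b⟩ hab h
  simp only [sortedPairs, Finset.coe_filter, Finset.mem_univ, true_and, Set.mem_ofPred_eq] at hkl hab
  simp only at h
  rw [Finsupp.single_add_single_eq_single_add_single one_ne_zero one_ne_zero] at h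
  rcases h with ⟨rfl, rfl⟩ | ⟨-, rfl, rfl⟩ | h
  · rfl
  · rw [le_antisymm hkl hab]
  · omega

theorem exists_sorted_of_degree_eq_two {w : Fin n →₀ ℕ} (h : w.degree = 2) :
    ∃ p ∈ sortedPairs n, Finsupp.single p.1 1 + Finsupp.single p.2 1 = w := by
  have hw : w ≠ 0 := by
    rintro rfl
    simp at h
  obtain ⟨k, hk⟩ := Finsupp.ne_iff.1 hw
  obtain ⟨v, rfl⟩ := exists_add_of_le (Finsupp.single_le_iff.2 (Nat.one_le_iff_ne_zero.2 hk))
  rw [map_add, Finsupp.degree_single] at h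
  obtain ⟨l, rfl⟩ := exists_eq_single_of_degree_eq_one (by omega : v.degree = 1)
  rcases le_total k l with hkl | hkl
  · exact ⟨(k, l), by simpa [sortedPairs] using hkl, rfl⟩
  · exact ⟨(l, k), by simpa [sortedPairs] using hkl, add_comm _ _⟩

theorem sum_sortedPairs {q : MvPolynomial (Fin n) K} (hq : q.IsHomogeneous 2) :
    ∑ p ∈ sortedPairs n, monomial (Finsupp.single p.1 1)
      (coeff (Finsupp.single p.1 1 + Finsupp.single p.2 1) q) * X p.2 = q := by
  classical
  have h : ∀ p : Fin n × Fin n, monomial (Finsupp.single p.1 1)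
      (coeff (Finsupp.single p.1 1 + Finsupp.single p.2 1) q) * X p.2 =
      monomial (Finsupp.single p.1 1 + Finsupp.single p.2 1)
        (coeff (Finsupp.single p.1 1 + Finsupp.single p.2 1) q) := fun p => by
    rw [X, monomial_mul, mul_one]
  simp only [h]
  rw [← Finset.sum_image (f := fun w => monomial w (coeff w q)) single_add_single_injOn]
  conv_rhs => rw [q.as_sum]
  refine (Finset.sum_subset (fun w hw => ?_) fun w _ hw => ?_).symm
  · obtain ⟨p, hp, rfl⟩ := exists_sorted_of_degree_eq_two
      (hq.degree_eq_of_coeff_ne_zero (mem_support_iff.1 hw))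
    exact Finset.mem_image_of_mem _ hp
  · rw [notMem_support_iff.1 hw, monomial_zero]

/-- The sorted polarization `∑_{k ≤ l} q_{kl} x_k y_l` of a quadric. -/
noncomputable def polarization (q : MvPolynomial (Fin n) K) : MvPolynomial (Fin (n + n)) K :=
  ∑ p ∈ sortedPairs n, rename (Fin.castAdd n) (monomial (Finsupp.single p.1 1)
    (coeff (Finsupp.single p.1 1 + Finsupp.single p.2 1) q)) * X (Fin.natAdd n p.2)

theorem polarization_eq (q : MvPolynomial (Fin n) K) : polarization q =
    ∑ p ∈ sortedPairs n,
      monomial (Finsupp.single (Fin.castAdd n p.1) 1 + Finsupp.single (Fin.natAdd n p.2) 1)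
      (coeff (Finsupp.single p.1 1 + Finsupp.single p.2 1) q) := by
  refine Finset.sum_congr rfl fun p _ => ?_
  rw [rename_monomial, Finsupp.mapDomain_single, X, monomial_mul, mul_one]

theorem polarization_isHomogeneous (q : MvPolynomial (Fin n) K) :
    (polarization q).IsHomogeneous 2 := by
  rw [polarization_eq]
  exact IsHomogeneous.sum _ _ _ fun p _ => isHomogeneous_monomial _ (by simp)

/-- For k ≤ l the order compares x_k x_l by the larger index l first and then by k, and it compares
x_k y_l in the same way. Putting the y on the larger index thus preserves the leading term. -/
theorem IsLead.polarization {q : MvPolynomial (Fin n) K} {c j : Fin n} (hcj : c ≤ j)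
    (h : IsLead (MonomialOrder.revLex (Fin n)) q (Finsupp.single c 1 + Finsupp.single j 1)) :
    IsLead (MonomialOrder.revLex (Fin (n + n))) (_root_.polarization q)
      (Finsupp.single (Fin.castAdd n c) 1 + Finsupp.single (Fin.natAdd n j) 1) := by
  have hinj : ∀ p p' : Fin n × Fin n,
      (Finsupp.single (Fin.castAdd n p.1) 1 + Finsupp.single (Fin.natAdd n p.2) 1 :
        Fin (n + n) →₀ ℕ) =
      Finsupp.single (Fin.castAdd n p'.1) 1 + Finsupp.single (Fin.natAdd n p'.2) 1 → p = p' := by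
    intro p p' h
    rw [Finsupp.single_add_single_eq_single_add_single one_ne_zero one_ne_zero] at h
    rcases h with ⟨h1, h2⟩ | ⟨-, h1, -⟩ | h
    · exact Prod.ext (Fin.castAdd_injective n n h1) (Fin.natAdd_injective n n h2)
    · exact absurd h1 (castAdd_lt_natAdd _ _).ne
    · omega
  have hz : ∀ {a b : Fin n}, a ≤ b → ∀ t, b < t →
      (Finsupp.single a 1 + Finsupp.single b 1 : Fin n →₀ ℕ) t = 0 := fun {a b} hab t ht => by
    simp [Finsupp.single_eq_of_ne ht.ne', Finsupp.single_eq_of_ne (hab.trans_lt ht).ne']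
  rw [polarization_eq]
  constructor
  · rw [coeff_sum, Finset.sum_eq_single (c, j)]
    · rw [coeff_monomial, if_pos rfl]
      exact h.1
    · intro p _ hp
      rw [coeff_monomial, if_neg]
      exact fun h' => hp (hinj p (c, j) h')
    · intro h'
      exact absurd (by simpa [sortedPairs] using hcj) h'
  · intro w hw
    rw [coeff_sum] at hw
    obtain ⟨⟨k, l⟩, hkl, hp⟩ := Finset.exists_ne_zero_of_sum_ne_zero hw
    have hkl' : k ≤ l := by simpa [sortedPairs] using hkl
    rw [coeff_monomial] at hp
    split_ifs at hp with hpw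
    · subst hpw
      have hle := h.2 _ hp
      rcases lt_trichotomy l j with hlj | rfl | hlj
      · exfalso
        refine absurd hle (not_le.2 (revLex_lt_of_ne_zero (s := j) (by simp) (fun t ht => ?_)
          (by simp)))
        exact hz hkl' t (hlj.trans_le ht)
      · rw [map_add, map_add] at hle ⊢
        have hle := le_of_add_le_add_right hle
        refine add_le_add_left ?_ _
        have := revLex_mapDomain_castAdd_le hle
        rwa [Finsupp.mapDomain_single, Finsupp.mapDomain_single] at this
      · refine (revLex_lt_of_ne_zero (s := Fin.natAdd n l) (by simp) (fun t ht => ?_)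
          (by simp)).le
        have h1 : Fin.natAdd n j < t := lt_of_lt_of_le (by simpa using hlj) ht
        have h2 : Fin.castAdd n c < t := (castAdd_lt_natAdd c j).trans h1
        rw [Finsupp.add_apply, Finsupp.single_eq_of_ne h1.ne', Finsupp.single_eq_of_ne h2.ne', add_zero]
    · exact absurd rfl hp

theorem isLead_minor {i j : Fin n} (hij : i < j) :
    IsLead (K := K) (MonomialOrder.revLex (Fin (n + n)))
      (X (Fin.castAdd n j) * X (Fin.natAdd n i) - X (Fin.castAdd n i) * X (Fin.natAdd n j))
      (Finsupp.single (Fin.castAdd n j) 1 + Finsupp.single (Fin.natAdd n i) 1) := by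
  have hlt : (MonomialOrder.revLex (Fin (n + n))).toSyn
      (Finsupp.single (Fin.castAdd n i) 1 + Finsupp.single (Fin.natAdd n j) 1) <
      (MonomialOrder.revLex (Fin (n + n))).toSyn
        (Finsupp.single (Fin.castAdd n j) 1 + Finsupp.single (Fin.natAdd n i) 1) := by
    refine revLex_lt_of_ne_zero (s := Fin.natAdd n j) (by simp) (fun t ht => ?_) (by simp)
    have h1 : Fin.natAdd n i < t := lt_of_lt_of_le (by simpa using hij) ht
    have h2 : Fin.castAdd n j < t := (castAdd_lt_natAdd j i).trans h1
    rw [Finsupp.add_apply, Finsupp.single_eq_of_ne h1.ne', Finsupp.single_eq_of_ne h2.ne', add_zero]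
  have hne := fun h => hlt.ne (congrArg _ h)
  rw [X, X, X, X, monomial_mul, monomial_mul, mul_one]
  constructor
  · rw [coeff_sub, coeff_monomial, coeff_monomial, if_pos rfl, if_neg hne, sub_zero]
    exact one_ne_zero
  · intro w hw
    rw [coeff_sub, coeff_monomial, coeff_monomial] at hw
    split_ifs at hw with h1 h2 h2
    · rw [h1]
    · rw [h1]
    · rw [← h2]
      exact hlt.le
    · simp at hw

variable {Q : Ideal (MvPolynomial (Fin n) K)} {g : GL (Fin n) K}

theorem polarization_mem_symDefiningIdeal {q : MvPolynomial (Fin n) K} (hq : q.IsHomogeneous 2)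
    (hqQ : q ∈ Q.comap (coordChange g)) : polarization q ∈ symDefiningIdeal Q g := by
  refine sum_rename_mul_X_mem_symDefiningIdeal _ _ _ ?_
  rwa [sum_sortedPairs hq]

theorem single_add_single_le {σ : Type*} {u : σ →₀ ℕ} {a b : σ} (hab : a ≠ b) (ha : u a ≠ 0)
    (hb : u b ≠ 0) : Finsupp.single a 1 + Finsupp.single b 1 ≤ u := by
  classical
  intro t
  simp only [Finsupp.add_apply, Finsupp.single_apply]
  split_ifs with h1 h2 h2
  · exact absurd (h1.trans h2.symm) hab
  · rw [← h1]; omega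
  · rw [← h2]; omega
  · omega

/-- In generic coordinates, the leading monomials of the defining ideal of the symmetric algebra
are multiples of leading monomials of quadrics of the ideal. -/
theorem RevLexGeneric.exists_isLead_le_of_mem_symDefiningIdeal
    (hgen : RevLexGeneric (Q.comap (coordChange g))) (hlin : ∀ f ∈ Q, linearPartHom n K f = 0)
    {f : MvPolynomial (Fin (n + n)) K} (hf : f ∈ symDefiningIdeal Q g) {u : Fin (n + n) →₀ ℕ}
    (hu : IsLead (MonomialOrder.revLex (Fin (n + n))) f u) :
    ∃ G ∈ symDefiningIdeal Q g, G.IsHomogeneous 2 ∧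
      ∃ u', IsLead (MonomialOrder.revLex (Fin (n + n))) G u' ∧ u' ≤ u := by
  by_cases hsort : ∀ i j, u (Fin.castAdd n j) ≠ 0 → u (Fin.natAdd n i) ≠ 0 → j ≤ i
  swap
  -- An unsorted pair x_j y_i with i < j is the leading monomial of a minor.
  · push Not at hsort
    obtain ⟨i, j, hj, hi, hij⟩ := hsort
    exact ⟨_, minor_mem_symDefiningIdeal i j,
      ((isHomogeneous_X K _).mul (isHomogeneous_X K _)).sub
        ((isHomogeneous_X K _).mul (isHomogeneous_X K _)), _, isLead_minor hij,
      single_add_single_le (castAdd_lt_natAdd _ _).ne hj hi⟩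
  -- The map to Sym(𝔪/𝔪²) rules out pure y-monomials. The Rees algebra alone would not do so: for q
  -- in `Q`, the form q(y) is a relation there.
  have hx : xPart u ≠ 0 := by
    intro hx
    have h0 := coordChange_yHom_eq_zero hlin hf
    have h1 : yHom n K f = 0 := by
      rw [← coordChange_inv_apply g (yHom n K f), h0, map_zero]
    refine hu.1 ?_
    rw [← coeff_yPart_yHom f hx, h1, coeff_zero]
  have hxs : (xPart u).support.Nonempty := by
    rwa [Finset.nonempty_iff_ne_empty, Ne, Finsupp.support_eq_empty]
  -- The least x-index of `u`; by sortedness it is also the least index of the merged monomial.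
  set c := (xPart u).support.min' hxs
  have hc : xPart u c ≠ 0 := Finsupp.mem_support_iff.1 (Finset.min'_mem _ _)
  have hcx : ∀ i, xPart u i ≠ 0 → c ≤ i := fun i hi =>
    Finset.min'_le _ _ (Finsupp.mem_support_iff.2 hi)
  clear_value c
  have hcm : ∀ i, (xPart u + yPart u) i ≠ 0 → c ≤ i := by
    intro i hi
    by_cases h : xPart u i = 0
    · refine hsort i c hc ?_
      rw [Finsupp.add_apply, h, zero_add] at hi
      exact hi
    · exact hcx i h
  have hlead := hu.mergeHom hsort
  have hmem := homogeneousComponent_mem_of_mem hgen.isHomogeneous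
    (coeff_mergeHom_mem hf (yPart u).degree) u.degree
  have hhom := homogeneousComponent_isHomogeneous u.degree
    ((mergeHom n K f).coeff (yPart u).degree)
  -- A nonzero form of degree at most 1 in `Q` would have a nonzero constant or linear part.
  have hdeg : 2 ≤ u.degree := by
    by_contra! hlt
    have h1 := linearPartHom_apply
      (coordChange g (homogeneousComponent u.degree ((mergeHom n K f).coeff (yPart u).degree)))
    rw [hlin _ hmem] at h1
    have h2 : homogeneousComponent u.degree ((mergeHom n K f).coeff (yPart u).degree) ≠ 0 :=
      fun h => hlead.1 (by rw [h, coeff_zero])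
    refine h2 ?_
    rw [← coordChange_inv_apply g (homogeneousComponent _ _)]
    have h3 := coordChange_isHomogeneous g hhom
    have hfst := congrArg TrivSqZeroExt.fst h1
    have hsnd := congrArg TrivSqZeroExt.snd h1
    simp only [TrivSqZeroExt.fst_zero, TrivSqZeroExt.snd_zero, TrivSqZeroExt.fst_add,
      TrivSqZeroExt.snd_add, TrivSqZeroExt.fst_inl, TrivSqZeroExt.snd_inl, TrivSqZeroExt.fst_inr,
      TrivSqZeroExt.snd_inr, add_zero, zero_add] at hfst hsnd
    rw [← homogeneousComponent_zero] at hfst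
    interval_cases hd : u.degree
    · rw [homogeneousComponent_eq_self h3] at hfst
      rw [← hfst, map_zero]
    · rw [homogeneousComponent_eq_self h3] at hsnd
      rw [← hsnd, map_zero]
  obtain ⟨d, hd⟩ := Nat.exists_eq_add_of_le' hdeg
  obtain ⟨q, hq, hq2, u', hu', hle⟩ := hgen.exists_isLead_le d hmem (by rwa [hd] at hhom ⊢) hlead
  obtain ⟨⟨i, j⟩, hij, rfl⟩ := exists_sorted_of_degree_eq_two (hu'.degree_of_isHomogeneous hq2)
  have hij : i ≤ j := by simpa [sortedPairs] using hij
  dsimp only at hu' hle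
  have hmi : (xPart u + yPart u) i ≠ 0 := by
    have := hle i
    simp only [Finsupp.add_apply, Finsupp.single_eq_same] at this ⊢
    omega
  have hmj : (xPart u + yPart u) j ≠ 0 := by
    have := hle j
    simp only [Finsupp.add_apply, Finsupp.single_eq_same] at this ⊢
    omega
  have hci := hcm i hmi
  -- The factor x_i may have come from a y in `u`. Replacing it by x_c guarantees that one factor is
  -- really an x of `u`.
  obtain ⟨q', hq', hq'2, hlead'⟩ := hgen.exists_isLead_of_le hij hci hq hq2 hu'
  by_cases hyj : u (Fin.natAdd n j) = 0
  · refine ⟨_, rename_mem_symDefiningIdeal hq', hq'2.rename_isHomogeneous, _,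
      hlead'.rename_castAdd, ?_⟩
    have hxj : u (Fin.castAdd n j) ≠ 0 := by
      rw [Finsupp.add_apply, yPart_apply, hyj, add_zero] at hmj
      exact hmj
    rw [Finsupp.mapDomain_add, Finsupp.mapDomain_single, Finsupp.mapDomain_single]
    -- If `c = j`, the square of x_c must divide `u`: then also `i = c`, and since y_c does not
    -- occur both copies come from the x-part.
    by_cases hcj : c = j
    · subst hcj
      have hic : i = c := le_antisymm hij hci
      subst hic
      have := hle i
      simp only [Finsupp.add_apply, Finsupp.single_eq_same, yPart_apply, hyj, xPart_apply] at this
      rw [← Finsupp.single_add, Finsupp.single_le_iff]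
      omega
    · exact single_add_single_le (fun h => hcj (Fin.castAdd_injective n n h)) hc hxj
  · exact ⟨_, polarization_mem_symDefiningIdeal hq'2 hq', polarization_isHomogeneous q', _,
      hlead'.polarization (hci.trans hij), single_add_single_le (castAdd_lt_natAdd _ _).ne hc hyj⟩

end QuadraticGroebner

/-! ### Schreyer resolutions over algebras with a quadratic Gröbner basis -/

section Schreyer

universe u

variable {σ : Type u} {K : Type*} [Field K] (m : MonomialOrder σ)

/-- The key of the monomial `x ^ u` times the `k`-th basis vector, for given weights of the
basis vectors. -/
noncomputable def vecKey {ι : Type*} (w : ι → σ →₀ ℕ) (k : ι) (u : σ →₀ ℕ) : m.syn ×ₗ ι :=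
  toLex (m.toSyn (w k + u), k)

section Keys

variable {m} {ι : Type*} [LinearOrder ι] {w : ι → σ →₀ ℕ}

theorem vecKey_le_iff {k k' : ι} {u u' : σ →₀ ℕ} : vecKey m w k u ≤ vecKey m w k' u' ↔
    m.toSyn (w k + u) < m.toSyn (w k' + u') ∨ (w k + u = w k' + u' ∧ k ≤ k') := by
  rw [vecKey, vecKey, Prod.Lex.toLex_le_toLex]
  exact or_congr_right (and_congr_left' m.toSyn.injective.eq_iff)

theorem vecKey_injective {k k' : ι} {u u' : σ →₀ ℕ} (h : vecKey m w k u = vecKey m w k' u') :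
    k = k' ∧ u = u' := by
  have h' := toLex.injective h
  obtain rfl : k = k' := (Prod.ext_iff.1 h').2
  exact ⟨rfl, add_left_cancel (m.toSyn.injective (Prod.ext_iff.1 h').1)⟩

theorem vecKey_add_le {k k' : ι} {u u' : σ →₀ ℕ} (h : vecKey m w k u ≤ vecKey m w k' u')
    (v : σ →₀ ℕ) : vecKey m w k (v + u) ≤ vecKey m w k' (v + u') := by
  rw [vecKey_le_iff, add_left_comm, add_left_comm (w k'), map_add, map_add m.toSyn v (w k' + u')]
  rw [vecKey_le_iff] at h
  exact h.imp (fun h => by gcongr) fun h => ⟨by rw [h.1], h.2⟩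

/-- The leading monomial of a vector of polynomials is `x ^ u` times the `k`-th basis vector. -/
def IsVecLead (m : MonomialOrder σ) (w : ι → σ →₀ ℕ) (f : ι → MvPolynomial σ K) (k : ι)
    (u : σ →₀ ℕ) : Prop :=
  coeff u (f k) ≠ 0 ∧ ∀ k' u', coeff u' (f k') ≠ 0 → vecKey m w k' u' ≤ vecKey m w k u

theorem exists_isVecLead [Fintype ι] (m : MonomialOrder σ) (w : ι → σ →₀ ℕ)
    {f : ι → MvPolynomial σ K} (hf : f ≠ 0) : ∃ k u, IsVecLead m w f k u := by
  let s : Finset (Σ _ : ι, σ →₀ ℕ) := Finset.univ.sigma fun k => (f k).support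
  have hs : s.Nonempty := by
    obtain ⟨k, hk⟩ := Function.ne_iff.1 hf
    obtain ⟨u, hu⟩ := support_nonempty.2 hk
    exact ⟨⟨k, u⟩, by simpa [s] using hu⟩
  obtain ⟨⟨k, u⟩, hku, hmax⟩ := s.exists_max_image (fun x => vecKey m w x.1 x.2) hs
  refine ⟨k, u, by simpa [s] using hku, fun k' u' h => hmax ⟨k', u'⟩ (by simpa [s] using h)⟩

theorem IsVecLead.sub_lt {f r : ι → MvPolynomial σ K} {k : ι} {u : σ →₀ ℕ}
    (hf : ∀ k' u', coeff u' (f k') ≠ 0 → vecKey m w k' u' ≤ vecKey m w k u)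
    (hr : ∀ k' u', coeff u' (r k') ≠ 0 → vecKey m w k' u' ≤ vecKey m w k u)
    (h : coeff u (f k) = coeff u (r k)) (k' : ι) (u' : σ →₀ ℕ) (hne : coeff u' ((f - r) k') ≠ 0) :
    vecKey m w k' u' < vecKey m w k u := by
  refine lt_of_le_of_ne ?_ fun he => ?_
  · by_cases h0 : coeff u' (f k') = 0
    · refine hr _ _ fun h1 => hne ?_
      rw [Pi.sub_apply, coeff_sub, h0, h1, sub_zero]
    · exact hf _ _ h0
  · obtain ⟨rfl, rfl⟩ := vecKey_injective he
    rw [Pi.sub_apply, coeff_sub, h, sub_self] at hne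
    exact hne rfl

theorem exists_add_of_coeff_monomial_mul_ne_zero {v s : σ →₀ ℕ} {a : K} {f : MvPolynomial σ K}
    (h : coeff s (monomial v a * f) ≠ 0) : ∃ s', s = v + s' ∧ coeff s' f ≠ 0 := by
  rw [coeff_monomial_mul'] at h
  split_ifs at h with hle
  · exact ⟨s - v, (add_tsub_cancel_of_le hle).symm, right_ne_zero_of_mul h⟩
  · exact absurd rfl h

end Keys

variable {m}

/-- The monomial `x ^ u` is divisible by the leading monomial of a quadric of `J`. -/
def QuadDvd (m : MonomialOrder σ) (J : Ideal (MvPolynomial σ K)) (u : σ →₀ ℕ) : Prop :=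
  ∃ g ∈ J, g.IsHomogeneous 2 ∧ ∃ u', IsLead m g u' ∧ u' ≤ u

/-- The colon of a quadratic monomial ideal by a variable is that ideal plus variables: a new
divisor must use up x_p, leaving a single variable dividing `u`. -/
theorem QuadDvd.exists_single {J : Ideal (MvPolynomial σ K)} {u : σ →₀ ℕ} {p : σ}
    (h : QuadDvd m J (u + Finsupp.single p 1)) (hu : ¬ QuadDvd m J u) :
    ∃ q, u q ≠ 0 ∧ QuadDvd m J (Finsupp.single p 1 + Finsupp.single q 1) := by
  classical
  obtain ⟨g, hg, hg2, u', hu', hle⟩ := h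
  have hp : u' p ≠ 0 := by
    intro hp
    refine hu ⟨g, hg, hg2, u', hu', fun q => ?_⟩
    have := hle q
    rw [Finsupp.add_apply, Finsupp.single_apply] at this
    split_ifs at this with hpq
    · rw [← hpq, hp]
      exact Nat.zero_le _
    · exact this
  obtain ⟨s, rfl⟩ := exists_add_of_le (Finsupp.single_le_iff.2 (Nat.one_le_iff_ne_zero.2 hp))
  have hdeg := hu'.degree_of_isHomogeneous hg2
  rw [map_add, Finsupp.degree_single] at hdeg
  obtain ⟨q, rfl⟩ := exists_eq_single_of_degree_eq_one (by omega : s.degree = 1)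
  refine ⟨q, ?_, g, hg, hg2, _, hu', le_rfl⟩
  rw [add_comm] at hle
  have := le_of_add_le_add_right hle
  exact Nat.one_le_iff_ne_zero.1 (Finsupp.single_le_iff.1 this)

variable (m)

/-- A submodule `U` of a free module, containing `J` times the free module, whose leading
monomials are the multiples of leading monomials of quadrics of `J` and of linear leading
monomials of given elements of `U`. -/
structure SchreyerData (J : Ideal (MvPolynomial σ K)) where
  ι : Type u
  [linearOrder : LinearOrder ι]
  [fintype : Fintype ι]
  w : ι → σ →₀ ℕ
  T : ι → σ → Prop
  U : Submodule (MvPolynomial σ K) (ι → MvPolynomial σ K)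
  vecIdeal_le : vecIdeal J ι ≤ U
  gen : ι → σ → ι → MvPolynomial σ K
  gen_mem : ∀ k p, T k p → gen k p ∈ U
  gen_hom : ∀ k p, T k p → HomVec 1 (gen k p)
  gen_coeff : ∀ k p, T k p → coeff (Finsupp.single p 1) (gen k p k) = 1
  gen_le : ∀ k p, T k p → ∀ k' u, coeff u (gen k p k') ≠ 0 →
    vecKey m w k' u ≤ vecKey m w k (Finsupp.single p 1)
  lead : ∀ f ∈ U, ∀ k u, IsVecLead m w f k u → QuadDvd m J u ∨ ∃ p, T k p ∧ u p ≠ 0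

attribute [instance] SchreyerData.linearOrder SchreyerData.fintype

namespace SchreyerData

variable {m} [LinearOrder σ] [Fintype σ] {J : Ideal (MvPolynomial σ K)} (s : SchreyerData m J)

/-- The index type of the linear leading monomials. -/
def Next : Type u := {x : s.ι ×ₗ σ // s.T (ofLex x).1 (ofLex x).2}

noncomputable instance : LinearOrder s.Next :=
  inferInstanceAs (LinearOrder {x : s.ι ×ₗ σ // s.T (ofLex x).1 (ofLex x).2})

noncomputable instance : Fintype s.Next := by
  classical
  have : Finite s.Next := inferInstanceAs (Finite {x : s.ι × σ // s.T x.1 x.2})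
  exact Fintype.ofFinite _

variable {s}

/-- The index of the basis vector. -/
def Next.fst (x : s.Next) : s.ι := (ofLex x.1).1

/-- The variable. -/
def Next.snd (x : s.Next) : σ := (ofLex x.1).2

theorem Next.prop (x : s.Next) : s.T x.fst x.snd := x.2

theorem Next.le_iff {x y : s.Next} : x ≤ y ↔ x.fst < y.fst ∨ x.fst = y.fst ∧ x.snd ≤ y.snd :=
  Prod.Lex.le_iff

theorem Next.ext {x y : s.Next} (h1 : x.fst = y.fst) (h2 : x.snd = y.snd) : x = y :=
  Subtype.ext (ofLex.injective (Prod.ext h1 h2))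

variable (s)

/-- The weights of the next free module. -/
noncomputable def nextWeight (x : s.Next) : σ →₀ ℕ := s.w x.fst + Finsupp.single x.snd 1

/-- The map from the next free module. -/
noncomputable def nextMap :
    (s.Next → MvPolynomial σ K) →ₗ[MvPolynomial σ K] (s.ι → MvPolynomial σ K) :=
  Fintype.linearCombination (MvPolynomial σ K) fun x : s.Next => s.gen x.fst x.snd

theorem nextMap_apply (f : s.Next → MvPolynomial σ K) (k : s.ι) :
    s.nextMap f k = ∑ x, f x * s.gen x.fst x.snd k := by
  simp [nextMap, Fintype.linearCombination_apply, Finset.sum_apply]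

theorem nextMap_single (x : s.Next) (a : MvPolynomial σ K) :
    s.nextMap (Pi.single x a) = a • s.gen x.fst x.snd := by
  simp [nextMap]

/-- The key of a monomial of the next free module, without the tie break by variables. -/
noncomputable def nextKey (x : s.Next) (u : σ →₀ ℕ) : m.syn ×ₗ s.ι :=
  toLex (m.toSyn (s.nextWeight x + u), x.fst)

theorem nextKey_eq (x : s.Next) (u : σ →₀ ℕ) :
    s.nextKey x u = vecKey m s.w x.fst (u + Finsupp.single x.snd 1) := by
  rw [nextKey, vecKey, nextWeight, add_assoc, add_comm u]

/-- This is Schreyer's order: monomials are compared by the leading monomials of their images, and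
ties are broken by the variable of the generator. -/
theorem vecKey_lt_of_nextKey_lt {x y : s.Next} {u v : σ →₀ ℕ} (h : s.nextKey x u < s.nextKey y v) :
    vecKey m s.nextWeight x u < vecKey m s.nextWeight y v := by
  rw [nextKey, nextKey, Prod.Lex.toLex_lt_toLex] at h
  rw [vecKey, vecKey, Prod.Lex.toLex_lt_toLex]
  refine h.imp_right fun h => ⟨h.1, ?_⟩
  refine lt_of_not_ge fun hle => ?_
  rcases Next.le_iff.1 hle with h' | h'
  · exact lt_asymm h.2 h'
  · exact h.2.ne h'.1.symm

theorem nextKey_le_of_vecKey_le {x y : s.Next} {u v : σ →₀ ℕ}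
    (h : vecKey m s.nextWeight x u ≤ vecKey m s.nextWeight y v) :
    s.nextKey x u ≤ s.nextKey y v := by
  by_contra hlt
  exact absurd h (not_le.2 (s.vecKey_lt_of_nextKey_lt (not_le.1 hlt)))

/-- Division with remainder by the given elements. -/
theorem exists_sub_nextMap_mem (κ : m.syn ×ₗ s.ι) : ∀ h ∈ s.U,
    (∀ k u, coeff u (h k) ≠ 0 → vecKey m s.w k u ≤ κ) →
    ∃ c : s.Next → MvPolynomial σ K, (∀ x u, coeff u (c x) ≠ 0 → s.nextKey x u ≤ κ) ∧
      (∀ e, HomVec (e + 1) h → HomVec e c) ∧ h - s.nextMap c ∈ vecIdeal J s.ι := by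
  induction κ using WellFoundedLT.induction with
  | ind κ ih =>
  intro h hU hκ
  by_cases h0 : h = 0
  · subst h0
    refine ⟨0, by simp, fun e _ k => isHomogeneous_zero _ _ _, ?_⟩
    rw [map_zero, sub_zero]
    exact zero_mem _
  obtain ⟨k, u, hku⟩ := exists_isVecLead m s.w h0
  have hle := hκ k u hku.1
  have hdeg : ∀ e, HomVec (e + 1) h → u.degree = e + 1 := fun e he =>
    (he k).degree_eq_of_coeff_ne_zero hku.1
  -- Subtracting an element of `U` with the same leading term lowers the key, so induction applies
  -- to the difference. Below, `r` is a multiple of a quadric of `J` or of a linear generator; only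
  -- the latter is recorded in the quotient.
  have step : ∀ r ∈ s.U, (∀ k' u', coeff u' (r k') ≠ 0 → vecKey m s.w k' u' ≤ vecKey m s.w k u) →
      coeff u (h k) = coeff u (r k) → (∀ e, HomVec (e + 1) h → HomVec (e + 1) r) →
      ∃ c : s.Next → MvPolynomial σ K, (∀ x u, coeff u (c x) ≠ 0 → s.nextKey x u ≤ κ) ∧
      (∀ e, HomVec (e + 1) h → HomVec e c) ∧ h - r - s.nextMap c ∈ vecIdeal J s.ι := by
    intro r hr hrκ hcoeff hrhom
    have hlt := IsVecLead.sub_lt hku.2 hrκ hcoeff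
    by_cases h1 : h - r = 0
    · refine ⟨0, by simp, fun e _ k => isHomogeneous_zero _ _ _, ?_⟩
      rw [h1, map_zero, sub_zero]
      exact zero_mem _
    · obtain ⟨k', u', hku'⟩ := exists_isVecLead m s.w h1
      have hlt' := (hlt k' u' hku'.1).trans_le hle
      obtain ⟨c, hc1, hc2, hc3⟩ := ih _ hlt' (h - r) (sub_mem hU hr) hku'.2
      exact ⟨c, fun x v hv => (hc1 x v hv).trans hlt'.le,
        fun e he => hc2 e (he.sub (hrhom e he)), hc3⟩
  rcases s.lead h hU k u hku with ⟨g, hg, hg2, u', hu', hle'⟩ | ⟨p, hp, hup⟩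
  · obtain ⟨v, rfl⟩ := exists_add_of_le hle'
    have hmem : Pi.single k (monomial v (coeff (u' + v) (h k) * (coeff u' g)⁻¹) * g) ∈
        vecIdeal J s.ι := by
      refine mem_vecIdeal.2 fun k' => ?_
      by_cases hk' : k' = k
      · subst hk'
        rw [Pi.single_eq_same]
        exact J.mul_mem_left _ hg
      · rw [Pi.single_eq_of_ne hk']
        exact zero_mem _
    obtain ⟨c, hc1, hc2, hc3⟩ := step _ (s.vecIdeal_le hmem) (fun k' s' hs' => by
        by_cases hk' : k' = k
        · subst hk'
          rw [Pi.single_eq_same] at hs'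
          obtain ⟨t, rfl, ht⟩ := exists_add_of_coeff_monomial_mul_ne_zero hs'
          rw [add_comm u' v]
          refine vecKey_add_le (vecKey_le_iff.2 ?_) v
          rcases (hu'.2 t ht).lt_or_eq with hlt | heq
          · left
            rw [map_add, map_add]
            gcongr
          · right
            rw [m.toSyn.injective heq]
            exact ⟨rfl, le_rfl⟩
        · rw [Pi.single_eq_of_ne hk'] at hs'
          simp at hs')
      (by
        rw [Pi.single_eq_same, add_comm u' v, coeff_monomial_mul, inv_mul_cancel_right₀ hu'.1])
      (fun e he k' => by
        by_cases hk' : k' = k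
        · subst hk'
          rw [Pi.single_eq_same]
          have h1 := hdeg e he
          have h2 := hu'.degree_of_isHomogeneous hg2
          rw [map_add] at h1
          have := (isHomogeneous_monomial (coeff (u' + v) (h k') * (coeff u' g)⁻¹)
            (rfl : v.degree = _)).mul hg2
          rwa [show v.degree + 2 = e + 1 by omega] at this
        · rw [Pi.single_eq_of_ne hk']
          exact isHomogeneous_zero _ _ _)
    refine ⟨c, hc1, hc2, ?_⟩
    have := add_mem hc3 hmem
    rwa [sub_right_comm, sub_add_cancel] at this
  · obtain ⟨v, rfl⟩ := exists_add_of_le (Finsupp.single_le_iff.2 (Nat.one_le_iff_ne_zero.2 hup))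
    set a := coeff (Finsupp.single p 1 + v) (h k)
    obtain ⟨c, hc1, hc2, hc3⟩ := step (monomial v a • s.gen k p)
      (Submodule.smul_mem _ _ (s.gen_mem k p hp)) (fun k' s' hs' => by
        rw [Pi.smul_apply, smul_eq_mul] at hs'
        obtain ⟨t, rfl, ht⟩ := exists_add_of_coeff_monomial_mul_ne_zero hs'
        rw [add_comm _ v]
        exact vecKey_add_le (s.gen_le k p hp k' t ht) v)
      (by
        rw [Pi.smul_apply, smul_eq_mul, add_comm _ v, coeff_monomial_mul, s.gen_coeff k p hp,
          mul_one])
      (fun e he => by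
        have h1 := hdeg e he
        rw [map_add, Finsupp.degree_single] at h1
        have := (s.gen_hom k p hp).smul (isHomogeneous_monomial a (rfl : v.degree = _))
        rwa [show 1 + v.degree = e + 1 by omega] at this)
    let x : s.Next := ⟨toLex (k, p), hp⟩
    refine ⟨c + Pi.single x (monomial v a), fun y t hy => ?_, fun e he y => ?_, ?_⟩
    · by_cases hcy : coeff t (c y) = 0
      · rw [Pi.add_apply, coeff_add, hcy, zero_add] at hy
        by_cases hyx : y = x
        · subst hyx
          rw [Pi.single_eq_same, coeff_monomial] at hy
          split_ifs at hy with hvt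
          · subst hvt
            rw [nextKey_eq, add_comm v]
            exact hle
          · exact absurd rfl hy
        · rw [Pi.single_eq_of_ne hyx] at hy
          simp at hy
      · exact hc1 y t hcy
    · refine (hc2 e he y).add ?_
      by_cases hyx : y = x
      · subst hyx
        rw [Pi.single_eq_same]
        have h1 := hdeg e he
        rw [map_add, Finsupp.degree_single] at h1
        exact isHomogeneous_monomial _ (by omega)
      · rw [Pi.single_eq_of_ne hyx]
        exact isHomogeneous_zero _ _ _
    · rw [map_add, nextMap_single]
      rwa [sub_right_comm, sub_sub] at hc3

theorem mem_U_iff (f : s.ι → MvPolynomial σ K) :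
    f ∈ s.U ↔ ∃ c, f - s.nextMap c ∈ vecIdeal J s.ι := by
  constructor
  · intro hf
    by_cases h0 : f = 0
    · refine ⟨0, ?_⟩
      rw [h0, map_zero, sub_zero]
      exact zero_mem _
    · obtain ⟨k, u, hku⟩ := exists_isVecLead m s.w h0
      obtain ⟨c, -, -, hc⟩ := s.exists_sub_nextMap_mem _ f hf hku.2
      exact ⟨c, hc⟩
  · rintro ⟨c, hc⟩
    rw [← sub_add_cancel f (s.nextMap c)]
    refine add_mem (s.vecIdeal_le hc) ?_
    rw [nextMap, Fintype.linearCombination_apply]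
    exact sum_mem fun x _ => Submodule.smul_mem _ _ (s.gen_mem _ _ x.prop)

theorem exists_sub_nextMap_mem_of_lt {κ : m.syn ×ₗ s.ι} {h : s.ι → MvPolynomial σ K} (hU : h ∈ s.U)
    (hκ : ∀ k u, coeff u (h k) ≠ 0 → vecKey m s.w k u < κ) (hh : HomVec 2 h) :
    ∃ c : s.Next → MvPolynomial σ K, (∀ x u, coeff u (c x) ≠ 0 → s.nextKey x u < κ) ∧
      HomVec 1 c ∧ h - s.nextMap c ∈ vecIdeal J s.ι := by
  by_cases h0 : h = 0
  · subst h0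
    refine ⟨0, by simp, fun k => isHomogeneous_zero _ _ _, ?_⟩
    rw [map_zero, sub_zero]
    exact zero_mem _
  · obtain ⟨k, u, hku⟩ := exists_isVecLead m s.w h0
    obtain ⟨c, hc1, hc2, hc3⟩ := s.exists_sub_nextMap_mem _ h hU hku.2
    exact ⟨c, fun x v hv => (hc1 x v hv).trans_lt (hκ k u hku.1), hc2 1 hh, hc3⟩

end SchreyerData

end Schreyer

/-! ### The next module of relations -/

section SchreyerNext

universe u

variable {σ : Type u} {K : Type*} [Field K] {m : MonomialOrder σ}

namespace SchreyerData

variable [LinearOrder σ] [Fintype σ] {J : Ideal (MvPolynomial σ K)} (s : SchreyerData m J)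

/-- The linear leading monomials of the module of relations. -/
def NextT (x : s.Next) (q : σ) : Prop :=
  QuadDvd m J (Finsupp.single x.snd 1 + Finsupp.single q 1) ∨ (q < x.snd ∧ s.T x.fst q)

/-- The module of relations. -/
noncomputable def nextU : Submodule (MvPolynomial σ K) (s.Next → MvPolynomial σ K) :=
  (vecIdeal J s.ι).comap s.nextMap

theorem vecIdeal_le_nextU : vecIdeal J s.Next ≤ s.nextU := by
  intro f hf
  rw [nextU, Submodule.mem_comap, mem_vecIdeal]
  intro k
  rw [nextMap_apply]
  exact sum_mem fun x _ => J.mul_mem_right _ (mem_vecIdeal.1 hf x)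

/-- The relation is x_q e_x - z; it has leading monomial x_q e_x because all terms of `z` are
smaller. -/
theorem exists_gen_of_sub_mem {x : s.Next} {q : σ} {z : s.Next → MvPolynomial σ K}
    (hz : HomVec 1 z)
    (hlt : ∀ y v, coeff v (z y) ≠ 0 →
      vecKey m s.nextWeight y v < vecKey m s.nextWeight x (Finsupp.single q 1))
    (hmem : (X q : MvPolynomial σ K) • s.gen x.fst x.snd - s.nextMap z ∈ vecIdeal J s.ι) :
    ∃ G ∈ s.nextU, HomVec 1 G ∧ coeff (Finsupp.single q 1) (G x) = 1 ∧
      ∀ y v, coeff v (G y) ≠ 0 →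
        vecKey m s.nextWeight y v ≤ vecKey m s.nextWeight x (Finsupp.single q 1) := by
  refine ⟨Pi.single x (X q) - z, ?_, HomVec.sub (fun y => ?_) hz, ?_, fun y v hv => ?_⟩
  · rwa [nextU, Submodule.mem_comap, map_sub, nextMap_single]
  · by_cases hy : y = x
    · subst hy
      rw [Pi.single_eq_same]
      exact isHomogeneous_X _ _
    · rw [Pi.single_eq_of_ne hy]
      exact isHomogeneous_zero _ _ _
  · have h0 : coeff (Finsupp.single q 1) (z x) = 0 := by
      by_contra h
      exact lt_irrefl _ (hlt x _ h)
    rw [Pi.sub_apply, coeff_sub, h0, Pi.single_eq_same, coeff_X_same, sub_zero]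
  · by_cases h0 : coeff v (z y) = 0
    · rw [Pi.sub_apply, coeff_sub, h0, sub_zero] at hv
      by_cases hy : y = x
      · subst hy
        rw [Pi.single_eq_same, coeff_X] at hv
        split_ifs at hv with hqv
        · rw [hqv]
        · exact absurd rfl hv
      · rw [Pi.single_eq_of_ne hy] at hv
        simp at hv
    · exact (hlt y v h0).le

theorem vecKey_le_of_coeff_X_smul_gen {k : s.ι} {p : σ} (hp : s.T k p) (q : σ) {k' : s.ι}
    {v : σ →₀ ℕ} (hv : coeff v (((X q : MvPolynomial σ K) • s.gen k p) k') ≠ 0) :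
    vecKey m s.w k' v ≤ vecKey m s.w k (Finsupp.single q 1 + Finsupp.single p 1) := by
  rw [Pi.smul_apply, smul_eq_mul, X] at hv
  obtain ⟨t, rfl, ht⟩ := exists_add_of_coeff_monomial_mul_ne_zero hv
  exact vecKey_add_le (s.gen_le k p hp k' t ht) _

theorem coeff_X_smul_gen {k : s.ι} {p : σ} (hp : s.T k p) (q : σ) :
    coeff (Finsupp.single q 1 + Finsupp.single p 1) (((X q : MvPolynomial σ K) • s.gen k p) k) = 1 := by
  rw [Pi.smul_apply, smul_eq_mul, X, coeff_monomial_mul, s.gen_coeff k p hp, one_mul]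

theorem homVec_X_smul_gen {k : s.ι} {p : σ} (hp : s.T k p) (q : σ) :
    HomVec 2 ((X q : MvPolynomial σ K) • s.gen k p) :=
  (s.gen_hom k p hp).smul (isHomogeneous_X K q)

/-- The leading monomial of x_q times the generator is that of a quadric of `J` in one component.
Cancel it and divide the remainder by the generators. -/
theorem exists_gen_of_quadDvd {x : s.Next} {q : σ}
    (h : QuadDvd m J (Finsupp.single x.snd 1 + Finsupp.single q 1)) :
    ∃ G ∈ s.nextU, HomVec 1 G ∧ coeff (Finsupp.single q 1) (G x) = 1 ∧
      ∀ y v, coeff v (G y) ≠ 0 →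
        vecKey m s.nextWeight y v ≤ vecKey m s.nextWeight x (Finsupp.single q 1) := by
  obtain ⟨g, hg, hg2, u', hu', hle⟩ := h
  obtain rfl : u' = Finsupp.single q 1 + Finsupp.single x.snd 1 := by
    obtain ⟨t, ht⟩ := exists_add_of_le hle
    have h1 := congrArg Finsupp.degree ht
    rw [map_add, map_add, Finsupp.degree_single, Finsupp.degree_single,
      hu'.degree_of_isHomogeneous hg2] at h1
    have h2 : t = 0 := (Finsupp.degree_eq_zero_iff t).1 (by omega)
    rw [add_comm, ht, h2, add_zero]
  set u' := Finsupp.single q 1 + Finsupp.single x.snd 1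
  have hT := x.prop
  set r : s.ι → MvPolynomial σ K := Pi.single x.fst (C (coeff u' g)⁻¹ * g) with hr
  have hrJ : r ∈ vecIdeal J s.ι := by
    refine mem_vecIdeal.2 fun k' => ?_
    by_cases hk' : k' = x.fst
    · subst hk'
      rw [hr, Pi.single_eq_same]
      exact J.mul_mem_left _ hg
    · rw [hr, Pi.single_eq_of_ne hk']
      exact zero_mem _
  have hr2 : HomVec 2 r := fun k' => by
    by_cases hk' : k' = x.fst
    · subst hk'
      rw [hr, Pi.single_eq_same]
      simpa using (isHomogeneous_C σ (coeff u' g)⁻¹).mul hg2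
    · rw [hr, Pi.single_eq_of_ne hk']
      exact isHomogeneous_zero _ _ _
  have hlt := IsVecLead.sub_lt (w := s.w) (k := x.fst) (u := u')
    (fun _ _ => s.vecKey_le_of_coeff_X_smul_gen hT q) (r := r) (fun k' v hv => by
      by_cases hk' : k' = x.fst
      · subst hk'
        rw [hr, Pi.single_eq_same, coeff_C_mul] at hv
        rw [vecKey_le_iff]
        rcases (hu'.2 v (right_ne_zero_of_mul hv)).lt_or_eq with hlt | heq
        · left
          rw [map_add, map_add]
          gcongr
        · right
          rw [m.toSyn.injective heq]
          exact ⟨rfl, le_rfl⟩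
      · rw [hr, Pi.single_eq_of_ne hk'] at hv
        simp at hv)
    (by rw [s.coeff_X_smul_gen hT q, hr, Pi.single_eq_same, coeff_C_mul, inv_mul_cancel₀ hu'.1])
  obtain ⟨c, hc1, hc2, hc3⟩ := s.exists_sub_nextMap_mem_of_lt
    (sub_mem (Submodule.smul_mem _ (X q : MvPolynomial σ K) (s.gen_mem _ _ hT)) (s.vecIdeal_le hrJ)) hlt
    ((s.homVec_X_smul_gen hT q).sub hr2)
  refine s.exists_gen_of_sub_mem hc2 (fun y v hv => s.vecKey_lt_of_nextKey_lt ?_) ?_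
  · rw [s.nextKey_eq x]
    exact hc1 y v hv
  · have := add_mem hc3 hrJ
    rwa [sub_right_comm, sub_add_cancel] at this

/-- The S-pair of two generators with leading monomials x_p e_k and x_q e_k. Both terms have the
same weight, and the tie break makes the one at (k, p) leading since q < p. -/
theorem exists_gen_of_lt {x : s.Next} {q : σ} (hq : q < x.snd) (hT' : s.T x.fst q) :
    ∃ G ∈ s.nextU, HomVec 1 G ∧ coeff (Finsupp.single q 1) (G x) = 1 ∧
      ∀ y v, coeff v (G y) ≠ 0 →
        vecKey m s.nextWeight y v ≤ vecKey m s.nextWeight x (Finsupp.single q 1) := by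
  have hT := x.prop
  let y : s.Next := ⟨toLex (x.fst, q), hT'⟩
  have hyx : y < x := by
    refine lt_of_not_ge fun h => ?_
    rcases Next.le_iff.1 h with h | h
    · exact lt_irrefl _ h
    · exact absurd h.2 (not_le.2 hq)
  have hlt := IsVecLead.sub_lt (w := s.w) (k := x.fst)
    (fun _ _ => s.vecKey_le_of_coeff_X_smul_gen hT q) (fun k' v hv => by
      rw [add_comm]
      exact s.vecKey_le_of_coeff_X_smul_gen hT' x.snd hv)
    (by rw [s.coeff_X_smul_gen hT q, add_comm, s.coeff_X_smul_gen hT'])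
  obtain ⟨c, hc1, hc2, hc3⟩ := s.exists_sub_nextMap_mem_of_lt
    (sub_mem (Submodule.smul_mem _ (X q : MvPolynomial σ K) (s.gen_mem _ _ hT))
      (Submodule.smul_mem _ (X x.snd : MvPolynomial σ K) (s.gen_mem _ _ hT'))) hlt
    ((s.homVec_X_smul_gen hT q).sub (s.homVec_X_smul_gen hT' x.snd))
  refine s.exists_gen_of_sub_mem (z := Pi.single y (X x.snd) + c) (fun k => ?_)
    (fun k v hv => ?_) ?_
  · refine IsHomogeneous.add ?_ (hc2 k)
    by_cases hk : k = y
    · subst hk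
      rw [Pi.single_eq_same]
      exact isHomogeneous_X _ _
    · rw [Pi.single_eq_of_ne hk]
      exact isHomogeneous_zero _ _ _
  · by_cases h0 : coeff v (c k) = 0
    · rw [Pi.add_apply, coeff_add, h0, add_zero] at hv
      by_cases hk : k = y
      · subst hk
        rw [Pi.single_eq_same, coeff_X] at hv
        split_ifs at hv with hqv
        · rw [vecKey, vecKey, Prod.Lex.toLex_lt_toLex]
          right
          refine ⟨?_, hyx⟩
          rw [← hqv]
          change m.toSyn (s.w x.fst + Finsupp.single q 1 + Finsupp.single x.snd 1) =
            m.toSyn (s.w x.fst + Finsupp.single x.snd 1 + Finsupp.single q 1)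
          rw [add_right_comm]
        · exact absurd rfl hv
      · rw [Pi.single_eq_of_ne hk] at hv
        simp at hv
    · apply s.vecKey_lt_of_nextKey_lt
      rw [s.nextKey_eq x]
      exact hc1 k v h0
  · rw [map_add, nextMap_single, ← sub_sub]
    exact hc3

theorem exists_gen {x : s.Next} {q : σ} (h : s.NextT x q) :
    ∃ G ∈ s.nextU, HomVec 1 G ∧ coeff (Finsupp.single q 1) (G x) = 1 ∧
      ∀ y v, coeff v (G y) ≠ 0 →
        vecKey m s.nextWeight y v ≤ vecKey m s.nextWeight x (Finsupp.single q 1) :=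
  h.elim s.exists_gen_of_quadDvd fun h => s.exists_gen_of_lt h.1 h.2

theorem vecKey_nextMap_le {f : s.Next → MvPolynomial σ K} {x : s.Next} {u : σ →₀ ℕ}
    (hf : IsVecLead m s.nextWeight f x u) {y : s.Next} {k : s.ι} {a b : σ →₀ ℕ}
    (ha : coeff a (f y) ≠ 0) (hb : coeff b (s.gen y.fst y.snd k) ≠ 0) :
    vecKey m s.w k (a + b) ≤ vecKey m s.w y.fst (a + Finsupp.single y.snd 1) ∧
    vecKey m s.w y.fst (a + Finsupp.single y.snd 1) ≤
      vecKey m s.w x.fst (u + Finsupp.single x.snd 1) := by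
  refine ⟨vecKey_add_le (s.gen_le _ _ y.prop k b hb) a, ?_⟩
  have := s.nextKey_le_of_vecKey_le (hf.2 y a ha)
  rwa [nextKey_eq, nextKey_eq] at this

/-- No cancellation occurs. A competing contribution must come from a generator with the same basis
vector and a smaller variable, and that variable would divide `u`; but it is one of the linear
leading monomials assumed not to divide `u`. -/
theorem coeff_nextMap {f : s.Next → MvPolynomial σ K} {x : s.Next} {u : σ →₀ ℕ}
    (hf : IsVecLead m s.nextWeight f x u) (hu : ∀ q, s.NextT x q → u q = 0) :
    coeff (u + Finsupp.single x.snd 1) (s.nextMap f x.fst) = coeff u (f x) := by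
  have key : ∀ (y : s.Next) (a b : σ →₀ ℕ), a + b = u + Finsupp.single x.snd 1 →
      coeff a (f y) ≠ 0 → coeff b (s.gen y.fst y.snd x.fst) ≠ 0 →
      y = x ∧ a = u ∧ b = Finsupp.single x.snd 1 := by
    intro y a b hab ha hb
    obtain ⟨h1, h2⟩ := s.vecKey_nextMap_le hf ha hb
    rw [← hab] at h2
    have h3 := vecKey_injective (le_antisymm h1 h2)
    have hb' := add_left_cancel h3.2
    rw [hb'] at hab
    have hle : y ≤ x := by
      rcases vecKey_le_iff.1 (hf.2 y a ha) with h | h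
      · refine absurd h (not_lt.2 (le_of_eq ?_))
        rw [nextWeight, nextWeight, add_assoc, add_assoc, add_comm _ u, add_comm _ a, hab, h3.1]
      · exact h.2
    have hsnd : y.snd = x.snd := by
      by_contra hne
      have hlt : y.snd < x.snd := by
        rcases Next.le_iff.1 hle with h | h
        · exact absurd h3.1 h.ne'
        · exact lt_of_le_of_ne h.2 hne
      have h0 := hu y.snd (Or.inr ⟨hlt, by rw [h3.1]; exact y.prop⟩)
      have h4 := congrArg (fun w : σ →₀ ℕ => w y.snd) hab
      simp only [Finsupp.add_apply, Finsupp.single_eq_same, h0,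
        Finsupp.single_eq_of_ne hne] at h4
      omega
    obtain rfl := Next.ext h3.1.symm hsnd
    exact ⟨rfl, add_right_cancel hab, hb'⟩
  classical
  rw [nextMap_apply, coeff_sum, Finset.sum_eq_single x, coeff_mul,
    Finset.sum_eq_single (u, Finsupp.single x.snd 1), s.gen_coeff _ _ x.prop, mul_one]
  · rintro ⟨a, b⟩ hab hne
    by_contra h0
    obtain ⟨-, rfl, rfl⟩ := key x a b (Finset.HasAntidiagonal.mem_antidiagonal.1 hab) (left_ne_zero_of_mul h0)
      (right_ne_zero_of_mul h0)
    exact hne rfl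
  · intro h
    refine absurd ?_ h
    rw [Finset.HasAntidiagonal.mem_antidiagonal]
  · intro y _ hy
    rw [coeff_mul]
    refine Finset.sum_eq_zero fun ab hab => ?_
    by_contra h0
    exact hy (key y _ _ (Finset.HasAntidiagonal.mem_antidiagonal.1 hab) (left_ne_zero_of_mul h0)
      (right_ne_zero_of_mul h0)).1
  · intro h
    exact absurd (Finset.mem_univ _) h

theorem isLead_nextMap {f : s.Next → MvPolynomial σ K} {x : s.Next} {u : σ →₀ ℕ}
    (hf : IsVecLead m s.nextWeight f x u) (hu : ∀ q, s.NextT x q → u q = 0) :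
    IsLead m (s.nextMap f x.fst) (u + Finsupp.single x.snd 1) := by
  classical
  refine ⟨by rw [s.coeff_nextMap hf hu]; exact hf.1, fun w hw => ?_⟩
  rw [nextMap_apply, coeff_sum] at hw
  obtain ⟨y, -, hy⟩ := Finset.exists_ne_zero_of_sum_ne_zero hw
  rw [coeff_mul] at hy
  obtain ⟨⟨a, b⟩, hab, h0⟩ := Finset.exists_ne_zero_of_sum_ne_zero hy
  obtain rfl := Finset.HasAntidiagonal.mem_antidiagonal.1 hab
  obtain ⟨h1, h2⟩ := s.vecKey_nextMap_le hf (left_ne_zero_of_mul h0) (right_ne_zero_of_mul h0)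
  rcases vecKey_le_iff.1 (h1.trans h2) with h | h
  · rw [map_add, map_add m.toSyn (s.w x.fst)] at h
    exact (lt_of_add_lt_add_left h).le
  · exact le_of_eq (congrArg _ (add_left_cancel h.1))

variable (hJ : ∀ f ∈ J, ∀ u, IsLead m f u → QuadDvd m J u)

open Classical in
/-- The module of relations, with its leading monomials. -/
noncomputable def next : SchreyerData m J where
  ι := s.Next
  w := s.nextWeight
  T := s.NextT
  U := s.nextU
  vecIdeal_le := s.vecIdeal_le_nextU
  gen x q := if h : s.NextT x q then (s.exists_gen h).choose else 0
  gen_mem x q h := by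
    rw [dif_pos h]
    exact (s.exists_gen h).choose_spec.1
  gen_hom x q h := by
    rw [dif_pos h]
    exact (s.exists_gen h).choose_spec.2.1
  gen_coeff x q h := by
    rw [dif_pos h]
    exact (s.exists_gen h).choose_spec.2.2.1
  gen_le x q h := by
    rw [dif_pos h]
    exact (s.exists_gen h).choose_spec.2.2.2
  lead f hf x u hx := by
    by_contra! hcon
    have hq : ∀ q, s.NextT x q → u q = 0 := hcon.2
    -- If no linear leading monomial divides `u`, the image of `f` has leading monomial u x_p, lying
    -- in the initial ideal of `J`. The colon by x_p then produces a linear divisor of `u` after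
    -- all.
    have h2 := hJ _ (mem_vecIdeal.1 hf x.fst) _ (s.isLead_nextMap hx hq)
    obtain ⟨q, hq0, hqd⟩ := h2.exists_single hcon.1
    exact hq0 (hq q (Or.inl hqd))

/-- The irrelevant ideal, with the variables as its generators. -/
noncomputable def initial (hJX : J ≤ Ideal.span (Set.range X)) : SchreyerData m J where
  ι := PUnit
  w _ := 0
  T _ _ := True
  U := vecIdeal (Ideal.span (Set.range X)) PUnit
  vecIdeal_le _ hf := mem_vecIdeal.2 fun k => hJX (mem_vecIdeal.1 hf k)
  gen _ p _ := X p
  gen_mem _ p _ := mem_vecIdeal.2 fun _ => Ideal.subset_span ⟨p, rfl⟩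
  gen_hom _ p _ _ := isHomogeneous_X K p
  gen_coeff _ p _ := coeff_X_same p
  gen_le _ p _ _ u hu := by
    rw [coeff_X] at hu
    split_ifs at hu with h
    · rw [h]
    · exact absurd rfl hu
  lead f hf k u hu := by
    right
    have h := (mem_vecIdeal.1 hf) k
    rw [← Set.image_univ, mem_ideal_span_X_image] at h
    obtain ⟨p, -, hp⟩ := h u (mem_support_iff.2 hu.1)
    exact ⟨p, trivial, hp⟩

end SchreyerData

end SchreyerNext

/-! ### The linear resolution over the residue class ring -/

section LinearResolution

universe u

variable {σ : Type u} {K R : Type*} [Field K] {m : MonomialOrder σ} [CommRing R] [Algebra K R]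
  [LinearOrder σ] [Fintype σ] {J : Ideal (MvPolynomial σ K)} (π : MvPolynomial σ K →ₐ[K] R)

namespace SchreyerData

variable (s : SchreyerData m J)

/-- The map from the next free module over the residue class ring. -/
noncomputable def quotMap : (s.Next → R) →ₗ[R] (s.ι → R) :=
  Fintype.linearCombination R fun x : s.Next => fun k => π (s.gen x.fst x.snd k)

theorem quotMap_comp (f : s.Next → MvPolynomial σ K) :
    s.quotMap π (π ∘ f) = π ∘ s.nextMap f := by
  ext k
  rw [Function.comp_apply, nextMap_apply, map_sum, quotMap, Fintype.linearCombination_apply,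
    Finset.sum_apply]
  refine Finset.sum_congr rfl fun x _ => ?_
  rw [map_mul]
  rfl

theorem quotMap_single (x : s.Next) (k : s.ι) :
    s.quotMap π (Pi.single x 1) k = π (s.gen x.fst x.snd k) := by
  simp [quotMap]

variable {π}

theorem comp_eq_comp_iff (hker : RingHom.ker π = J) {ι : Type*} {f g : ι → MvPolynomial σ K} :
    π ∘ f = π ∘ g ↔ f - g ∈ vecIdeal J ι := by
  rw [mem_vecIdeal, funext_iff]
  refine forall_congr' fun k => ?_
  rw [Pi.sub_apply, ← hker, RingHom.mem_ker, map_sub, sub_eq_zero]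
  rfl

theorem comp_mem_range_quotMap_iff (hπ : Function.Surjective π) (hker : RingHom.ker π = J)
    (f : s.ι → MvPolynomial σ K) : π ∘ f ∈ Set.range (s.quotMap π) ↔ f ∈ s.U := by
  rw [mem_U_iff]
  constructor
  · rintro ⟨F, hF⟩
    obtain ⟨c, rfl⟩ := hπ.comp_left F
    refine ⟨c, (comp_eq_comp_iff hker).1 ?_⟩
    rw [← quotMap_comp]
    exact hF.symm
  · rintro ⟨c, hc⟩
    exact ⟨π ∘ c, by rw [quotMap_comp, ← (comp_eq_comp_iff hker).2 hc]⟩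

theorem quotMap_comp_eq_zero_iff (hker : RingHom.ker π = J) (f : s.Next → MvPolynomial σ K) :
    s.quotMap π (π ∘ f) = 0 ↔ f ∈ s.nextU := by
  have h0 : (0 : s.ι → R) = π ∘ (0 : s.ι → MvPolynomial σ K) := by
    ext
    simp
  rw [quotMap_comp, h0, comp_eq_comp_iff hker, sub_zero]
  rfl

end SchreyerData

/-- The iterated modules of relations, starting with the irrelevant ideal. -/
noncomputable def SchreyerData.iterate (hJ : ∀ f ∈ J, ∀ u, IsLead m f u → QuadDvd m J u)
    (hJX : J ≤ Ideal.span (Set.range X)) : ℕ → SchreyerData m J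
  | 0 => initial hJX
  | i + 1 => (iterate hJ hJX i).next hJ

/-- The Schreyer generators of each relation module, together with multiples of `J`, generate it.
After reduction modulo `J` the kernel of each map is thus the image of the next, and the entries are
linear. -/
theorem hasLinearResolution_quotient_of_quadDvd {π : MvPolynomial σ K →ₐ[K] R}
    (hπ : Function.Surjective π) (hker : RingHom.ker π = J)
    (hJ : ∀ f ∈ J, ∀ u, IsLead m f u → QuadDvd m J u) (hJX : J ≤ Ideal.span (Set.range X))
    {𝓡 : ℕ → Submodule K R} (h𝓡 : ∀ d, 𝓡 d = (homogeneousSubmodule σ K d).map π.toLinearMap)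
    {I : Ideal R} (hI : I.comap π = Ideal.span (Set.range X)) :
    HasLinearResolution (K := K) (R := R) (M := R ⧸ I) 𝓡
      (fun d => (𝓡 d).map (I.mkQ.restrictScalars K)) 0 := by
  let st : ℕ → SchreyerData m J := SchreyerData.iterate hJ hJX
  let b : ℕ → ℕ := fun i => Fintype.card (st i).ι
  let e : ∀ i, (st i).ι ≃ Fin (b i) := fun i => Fintype.equivFin _
  let E : ∀ i, (Fin (b i) → R) ≃ₗ[R] ((st i).ι → R) := fun i => LinearEquiv.funCongrLeft R R (e i)
  let q : ∀ i, ((st (i + 1)).ι → R) →ₗ[R] ((st i).ι → R) := fun i => (st i).quotMap π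
  have hq : ∀ i (f : (st (i + 1)).ι → MvPolynomial σ K),
      q i (π ∘ f) = 0 ↔ π ∘ f ∈ Set.range (q (i + 1)) := fun i f =>
    ((st i).quotMap_comp_eq_zero_iff hker f).trans
      ((st (i + 1)).comp_mem_range_quotMap_iff hπ hker f).symm
  let ε₀ : ((st 0).ι → R) →ₗ[R] R ⧸ I := I.mkQ ∘ₗ LinearMap.proj PUnit.unit
  have hε₀ : ∀ f : (st 0).ι → MvPolynomial σ K, ε₀ (π ∘ f) = 0 ↔ π ∘ f ∈ Set.range (q 0) :=
    fun f => by
    refine Iff.trans ?_ ((st 0).comp_mem_range_quotMap_iff hπ hker f).symm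
    change Submodule.Quotient.mk (π (f PUnit.unit)) = 0 ↔
      f ∈ vecIdeal (Ideal.span (Set.range X)) PUnit
    rw [Submodule.Quotient.mk_eq_zero]
    have hI' : ∀ p, π p ∈ I ↔ p ∈ Ideal.span (Set.range X) := fun p => by
      rw [← hI]
      rfl
    exact (hI' _).trans ⟨fun h => mem_vecIdeal.2 fun _ => h, fun h => mem_vecIdeal.1 h PUnit.unit⟩
  have hE : ∀ i j, E i (Pi.single j 1) = Pi.single ((e i).symm j) 1 := fun i j => by
    ext k
    change (Pi.single j 1 : Fin (b i) → R) (e i k) = _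
    by_cases hk : e i k = j
    · subst hk
      rw [Equiv.symm_apply_apply, Pi.single_eq_same, Pi.single_eq_same]
    · rw [Pi.single_eq_of_ne hk, Pi.single_eq_of_ne]
      rintro rfl
      exact hk (Equiv.apply_symm_apply _ _)
  refine ⟨b, ε₀ ∘ₗ (E 0).toLinearMap,
    fun i => (E i).symm.toLinearMap ∘ₗ q i ∘ₗ (E (i + 1)).toLinearMap,
    fun j => ?_, fun i j k => ?_, ?_, fun y => ?_, fun i y => ?_⟩
  · refine ⟨1, ?_, ?_⟩
    · rw [h𝓡]
      exact ⟨1, isHomogeneous_one σ K, map_one π⟩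
    · rw [LinearMap.comp_apply, LinearEquiv.coe_coe, hE]
      have h : (Pi.single ((e 0).symm j) 1 : (st 0).ι → R) PUnit.unit = 1 :=
        Pi.single_eq_same (M := fun _ : (st 0).ι => R) _ _
      exact (congrArg (Submodule.Quotient.mk (p := I)) h).symm
  · have : ((E i).symm.toLinearMap ∘ₗ q i ∘ₗ (E (i + 1)).toLinearMap) (Pi.single j 1) k =
        q i (E (i + 1) (Pi.single j 1)) ((e i).symm k) := rfl
    rw [this, hE, h𝓡]
    refine ⟨(st i).gen _ _ _, ?_, ((st i).quotMap_single π ((e (i + 1)).symm j) _).symm⟩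
    exact (st i).gen_hom _ _ (SchreyerData.Next.prop _) _
  · rw [LinearMap.coe_comp]
    refine Function.Surjective.comp ?_ (E 0).surjective
    intro y
    obtain ⟨r, rfl⟩ := I.mkQ_surjective y
    exact ⟨fun _ => r, rfl⟩
  · obtain ⟨f, hf⟩ := hπ.comp_left (E 0 y)
    simp only [LinearMap.comp_apply, LinearEquiv.coe_coe, Set.mem_range] at hε₀ ⊢
    rw [← hf]
    refine (hε₀ f).trans ?_
    constructor
    · rintro ⟨z, hz⟩
      refine ⟨(E 1).symm z, ?_⟩
      rw [LinearEquiv.apply_symm_apply, hz, LinearEquiv.symm_apply_eq]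
      exact hf
    · rintro ⟨z, hz⟩
      refine ⟨E 1 z, ?_⟩
      rw [LinearEquiv.symm_apply_eq] at hz
      exact hz.trans hf.symm
  · obtain ⟨f, hf⟩ := hπ.comp_left (E (i + 1) y)
    simp only [LinearMap.comp_apply, LinearEquiv.coe_coe, Set.mem_range] at hq ⊢
    rw [LinearEquiv.symm_apply_eq, map_zero, ← hf]
    refine (hq i f).trans ?_
    constructor
    · rintro ⟨z, hz⟩
      refine ⟨(E (i + 2)).symm z, ?_⟩
      rw [LinearEquiv.apply_symm_apply, hz, LinearEquiv.symm_apply_eq]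
      exact hf
    · rintro ⟨z, hz⟩
      refine ⟨E (i + 2) z, ?_⟩
      rw [LinearEquiv.symm_apply_eq] at hz
      exact hz.trans hf.symm

end LinearResolution

/-! ### Quotient gradings and the Koszul property -/

section QuadraticIdeals

variable {σ K : Type*} [Field K] {m : MonomialOrder σ} {J : Ideal (MvPolynomial σ K)}

/-- A nonzero remainder on division by the quadrics would lie in `J` with an indivisible leading
monomial. Homogeneity of `J`, and hence the grading of the quotient, is deduced from this. -/
theorem span_quadrics_eq (hJ : ∀ f ∈ J, ∀ u, IsLead m f u → QuadDvd m J u) :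
    Ideal.span {g | g ∈ J ∧ g.IsHomogeneous 2} = J := by
  refine le_antisymm (Ideal.span_le.2 fun g hg => hg.1) fun f hf => ?_
  let B : Set (MvPolynomial σ K) := {g | g ∈ J ∧ g.IsHomogeneous 2 ∧ g ≠ 0}
  have hB : B ⊆ {g | g ∈ J ∧ g.IsHomogeneous 2} := fun g hg => ⟨hg.1, hg.2.1⟩
  obtain ⟨c, r, hr, -, hdvd⟩ := MonomialOrder.div_set (m := m) (B := B)
    (fun b hb => isUnit_iff_ne_zero.2 (MonomialOrder.leadingCoeff_ne_zero_iff.2 hb.2.2)) f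
  have hmem : Finsupp.linearCombination (MvPolynomial σ K) (fun b : B => (b : MvPolynomial σ K)) c ∈
      Ideal.span {g | g ∈ J ∧ g.IsHomogeneous 2} :=
    sum_mem fun b _ => Ideal.mul_mem_left _ _ (Ideal.subset_span (hB b.2))
  have hr0 : r = 0 := by
    by_contra h0
    have hrJ : r ∈ J := by
      rw [← sub_eq_of_eq_add' hr]
      exact sub_mem hf (Ideal.span_le.2 (fun g hg => hg.1) hmem)
    obtain ⟨g, hg, hg2, u', hu', hle⟩ := hJ r hrJ _ (isLead_degree h0)
    refine hdvd _ (mem_support_iff.2 (isLead_degree (m := m) h0).1) g ⟨hg, hg2, ?_⟩ ?_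
    · rintro rfl
      exact hu'.1 (coeff_zero _)
    · rwa [hu'.degree_eq]
  rw [hr, hr0, add_zero]
  exact hmem

theorem mem_span_range_X_iff {f : MvPolynomial σ K} :
    f ∈ Ideal.span (Set.range X) ↔ coeff 0 f = 0 := by
  rw [← Set.image_univ, mem_ideal_span_X_image]
  constructor
  · intro h
    by_contra h0
    obtain ⟨i, -, hi⟩ := h 0 (mem_support_iff.2 h0)
    exact hi rfl
  · intro h u hu
    have hu0 : u ≠ 0 := by
      rintro rfl
      exact mem_support_iff.1 hu h
    obtain ⟨i, hi⟩ := Finsupp.ne_iff.1 hu0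
    exact ⟨i, trivial, hi⟩

theorem span_quadrics_le_span_range_X (J : Ideal (MvPolynomial σ K)) :
    Ideal.span {g | g ∈ J ∧ g.IsHomogeneous 2} ≤ Ideal.span (Set.range X) :=
  Ideal.span_le.2 fun g hg => mem_span_range_X_iff.2
    (hg.2.coeff_eq_zero (by rw [map_zero]; exact two_ne_zero.symm))

theorem isHomogeneous_span_quadrics (J : Ideal (MvPolynomial σ K)) :
    (Ideal.span {g | g ∈ J ∧ g.IsHomogeneous 2}).IsHomogeneous (homogeneousSubmodule σ K) :=
  Ideal.homogeneous_span _ _ fun _ hg => ⟨2, hg.2⟩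

end QuadraticIdeals

/-! ### Gradings induced by a presentation -/

section QuotientGrading

variable {σ K R : Type*} [Field K] [CommRing R] [Algebra K R] {π : MvPolynomial σ K →ₐ[K] R}
  {𝓡 : ℕ → Submodule K R}

theorem isInternal_of_map_homogeneousSubmodule
    (hπ : Function.Surjective π)
    (hJ : ∀ f, π f = 0 → ∀ d, π (homogeneousComponent d f) = 0)
    (h𝓡 : ∀ d, 𝓡 d = (homogeneousSubmodule σ K d).map π.toLinearMap) :
    DirectSum.IsInternal 𝓡 := by
  classical
  constructor
  · rw [injective_iff_map_eq_zero]
    intro a ha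
    have h1 : ∀ i, ∃ f ∈ homogeneousSubmodule σ K i, π f = (a i : R) := fun i =>
      (h𝓡 i).le (a i).2
    choose f hf hfa using h1
    rw [DirectSum.coeAddMonoidHom_eq_dfinsuppSum, DFinsupp.sum] at ha
    have h2 : π (∑ i ∈ DFinsupp.support a, f i) = 0 := by
      rw [map_sum, ← ha]
      exact Finset.sum_congr rfl fun i _ => hfa i
    refine DFinsupp.ext fun i => ?_
    by_contra hi
    have h3 := hJ _ h2 i
    rw [map_sum, Finset.sum_congr rfl fun j _ => homogeneousComponent_of_mem (hf j),
      Finset.sum_ite_eq, if_pos (DFinsupp.mem_support_iff.2 hi), hfa] at h3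
    exact hi (Subtype.ext h3)
  · intro r
    obtain ⟨f, rfl⟩ := hπ r
    have hmem : ∀ i, π (homogeneousComponent i f) ∈ 𝓡 i := fun i => by
      rw [h𝓡]
      exact ⟨_, homogeneousComponent_isHomogeneous i f, rfl⟩
    refine ⟨∑ i ∈ Finset.range (f.totalDegree + 1), DirectSum.of (fun i => 𝓡 i) i ⟨_, hmem i⟩, ?_⟩
    rw [map_sum]
    simp only [DirectSum.coeAddMonoidHom_of]
    rw [← map_sum, sum_homogeneousComponent]

theorem gradedMonoid_of_map_homogeneousSubmodule
    (h𝓡 : ∀ d, 𝓡 d = (homogeneousSubmodule σ K d).map π.toLinearMap) :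
    SetLike.GradedMonoid 𝓡 where
  one_mem := by
    rw [h𝓡]
    exact ⟨1, isHomogeneous_one σ K, map_one π⟩
  mul_mem i j a b ha hb := by
    rw [h𝓡] at ha hb ⊢
    obtain ⟨f, hf, rfl⟩ := ha
    obtain ⟨g, hg, rfl⟩ := hb
    exact ⟨f * g, IsHomogeneous.mul hf hg, map_mul π f g⟩

theorem comap_irrelevant_eq [GradedAlgebra 𝓡]
    (hJX : RingHom.ker π ≤ Ideal.span (Set.range X))
    (h𝓡 : ∀ d, 𝓡 d = (homogeneousSubmodule σ K d).map π.toLinearMap) :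
    (HomogeneousIdeal.irrelevant 𝓡).toIdeal.comap π = Ideal.span (Set.range X) := by
  have hle : Ideal.span (Set.range X) ≤ (HomogeneousIdeal.irrelevant 𝓡).toIdeal.comap π := by
    rw [Ideal.span_le]
    rintro _ ⟨i, rfl⟩
    refine HomogeneousIdeal.mem_irrelevant_of_mem 𝓡 one_pos ?_
    rw [h𝓡]
    exact ⟨X i, isHomogeneous_X K i, rfl⟩
  refine le_antisymm (fun f hf => ?_) hle
  have h1 : f - C (coeff 0 f) ∈ Ideal.span (Set.range X) := by
    classical
    rw [mem_span_range_X_iff, coeff_sub, coeff_C, if_pos rfl, sub_self]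
  have h2 := sub_mem hf (hle h1)
  rw [sub_sub_cancel] at h2
  have h3 : π (C (coeff 0 f)) ∈ HomogeneousIdeal.irrelevant 𝓡 := h2
  have h4 : π (C (coeff 0 f)) ∈ 𝓡 0 := by
    rw [h𝓡]
    exact ⟨_, isHomogeneous_C _ _, rfl⟩
  rw [HomogeneousIdeal.mem_irrelevant_iff, GradedRing.proj_apply,
    DirectSum.decompose_of_mem_same 𝓡 h4] at h3
  rw [← sub_add_cancel f (C (coeff 0 f))]
  exact add_mem h1 (hJX h3)

end QuotientGrading

/-- Algebras presented by an ideal with a quadratic Gröbner basis are Koszul. -/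
theorem exists_gradedAlgebra_isKoszul {σ K R : Type*} [Field K] [CommRing R] [Algebra K R]
    [LinearOrder σ] [Fintype σ] {m : MonomialOrder σ} {π : MvPolynomial σ K →ₐ[K] R}
    {𝓡 : ℕ → Submodule K R} (hπ : Function.Surjective π)
    (hJ : ∀ f ∈ RingHom.ker π, ∀ u, IsLead m f u → QuadDvd m (RingHom.ker π) u)
    (h𝓡 : ∀ d, 𝓡 d = (homogeneousSubmodule σ K d).map π.toLinearMap) :
    ∃ _ : GradedAlgebra 𝓡, IsKoszul (K := K) (R := R) 𝓡 := by
  have hspan := span_quadrics_eq hJ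
  have hJX : RingHom.ker π ≤ Ideal.span (Set.range X) := by
    rw [← hspan]
    exact span_quadrics_le_span_range_X _
  have hhom : (RingHom.ker π).IsHomogeneous (homogeneousSubmodule σ K) := by
    rw [← hspan]
    exact isHomogeneous_span_quadrics _
  have hint := isInternal_of_map_homogeneousSubmodule hπ (fun f hf d => by
    have h : (DirectSum.decompose (homogeneousSubmodule σ K) f d : MvPolynomial σ K) =
      homogeneousComponent d f := decomposition.decompose'_apply f d
    rw [← h]
    exact hhom d (show f ∈ RingHom.ker π from hf)) h𝓡
  let : DirectSum.Decomposition 𝓡 := hint.chooseDecomposition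
  have := gradedMonoid_of_map_homogeneousSubmodule h𝓡
  let : GradedAlgebra 𝓡 := { }
  refine ⟨inferInstance, ?_, ?_⟩
  · rw [h𝓡, homogeneousSubmodule_zero, Submodule.map_one]
  · exact hasLinearResolution_quotient_of_quadDvd hπ rfl hJ hJX h𝓡 (comap_irrelevant_eq hJX h𝓡)

/-! ### Independence of the grading of S(𝔪) from the coordinates -/

section SymmetricAlgebraGrading

variable {K : Type*} [Field K] {n : ℕ} (Q : Ideal (MvPolynomial (Fin n) K))

/-- The linear substitution in both sets of variables. -/
noncomputable def symCoordChange (g : GL (Fin n) K) :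
    MvPolynomial (Fin (n + n)) K →ₐ[K] MvPolynomial (Fin (n + n)) K :=
  aeval (Fin.append (fun i => rename (Fin.castAdd n) (coordForm g i))
    (fun i => ∑ j, rename (Fin.castAdd n) (C (g.val i j)) * X (Fin.natAdd n j)))

theorem symCoordChange_isHomogeneous (g : GL (Fin n) K) {f : MvPolynomial (Fin (n + n)) K} {d : ℕ}
    (hf : f.IsHomogeneous d) : (symCoordChange g f).IsHomogeneous d := by
  have := hf.aeval (n := 1) (Fin.append (fun i => rename (Fin.castAdd n) (coordForm g i))
    (fun i => ∑ j, rename (Fin.castAdd n) (C (g.val i j)) * X (Fin.natAdd n j))) (fun i => by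
      induction i using Fin.addCases with
      | left i =>
        rw [Fin.append_left]
        exact (coordForm_isHomogeneous g i).rename_isHomogeneous
      | right i =>
        rw [Fin.append_right]
        refine IsHomogeneous.sum _ _ _ fun j _ => ?_
        rw [rename_C]
        simpa using (isHomogeneous_C (Fin (n + n)) (g.val i j)).mul (isHomogeneous_X K _))
  rwa [one_mul] at this

theorem symPresentation_mul (g h : GL (Fin n) K) (f : MvPolynomial (Fin (n + n)) K) :
    symPresentation Q (g * h) f = symPresentation Q h (symCoordChange g f) := by
  have key : ∀ i, coordForm (g * h) i = coordChange h (coordForm g i) := fun i => by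
    have := coordChange_mul g h (X i)
    rwa [coordChange, aeval_X, coordChange_X, ← coordForm_eq_linForm] at this
  have : symPresentation Q (g * h) = (symPresentation Q h).comp (symCoordChange g) := by
    refine algHom_ext fun i => ?_
    rw [AlgHom.comp_apply, symCoordChange, aeval_X, symPresentation, aeval_X]
    induction i using Fin.addCases with
    | left i =>
      rw [Fin.append_left, Fin.append_left, symPresentation_rename, key]
    | right i =>
      rw [Fin.append_right, Fin.append_right]
      refine (sum_symPresentation_rename_mul_X Q h Finset.univ _ id _ ?_).symm
      change Ideal.Quotient.mk Q (coordForm (g * h) i) = _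
      rw [key]
      rfl
  rw [this, AlgHom.comp_apply]

/-- Two presentations differ by a degree-preserving substitution. This transfers the result from the
generic coordinates to the grading, which is defined by the original ones. -/
theorem symGrading_eq (g : GL (Fin n) K) (d : ℕ) : symGrading Q d =
    (homogeneousSubmodule (Fin (n + n)) K d).map (symPresentation Q g).toLinearMap := by
  have hle : ∀ g h : GL (Fin n) K,
      (homogeneousSubmodule (Fin (n + n)) K d).map (symPresentation Q (g * h)).toLinearMap ≤
      (homogeneousSubmodule (Fin (n + n)) K d).map (symPresentation Q h).toLinearMap := by
    rintro g h _ ⟨f, hf, rfl⟩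
    exact ⟨symCoordChange g f, symCoordChange_isHomogeneous g hf, (symPresentation_mul Q g h f).symm⟩
  rw [symGrading]
  refine le_antisymm ?_ ?_
  · have := hle g⁻¹ g
    rwa [inv_mul_cancel] at this
  · have := hle g 1
    rwa [mul_one] at this

end SymmetricAlgebraGrading

/-- `Q` is generated by quadrics, and a ring homomorphism that kills them kills `Q`. -/
theorem Ideal.HasLinearResolution.linearPartHom_eq_zero {K : Type*} [Field K] {n : ℕ}
    {Q : Ideal (MvPolynomial (Fin n) K)} (hlin : Q.HasLinearResolution 2) :
    ∀ f ∈ Q, linearPartHom n K f = 0 := by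
  obtain ⟨F, -⟩ := hlin.exists_quadraticComplex
  intro f hf
  obtain ⟨u, hu⟩ := (F.mem_iff f).1 hf
  have h1 : f = F.ε u 0 := by rw [hu]
  rw [h1, LinearMap.pi_apply_eq_sum_univ F.ε u, Finset.sum_apply, map_sum]
  refine Finset.sum_eq_zero fun j _ => ?_
  have h2 : linearPartHom n K (F.ε (Pi.single j 1) 0) = 0 := by
    rw [linearPartHom_apply, homogeneousComponent_of_mem (F.ε_hom j 0), if_neg (by decide),
      (F.ε_hom j 0).coeff_eq_zero (by rw [map_zero]; exact two_ne_zero.symm), map_zero,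
      TrivSqZeroExt.inl_zero, TrivSqZeroExt.inr_zero, add_zero]
  have h3 : (fun i => if j = i then 1 else 0 : Fin (F.b 0) → MvPolynomial (Fin n) K) =
      Pi.single j 1 := by
    ext1 i
    simp [Pi.single_apply, eq_comm]
  rw [Pi.smul_apply, smul_eq_mul, map_mul, h3, h2, mul_zero]

set_option maxHeartbeats 1600000 in
/-- The symmetric algebra of the graded maximal ideal is Koszul if its defining ideal has a
quadratic Gröbner basis in some coordinates. -/
theorem exists_gradedAlgebra_symGrading_isKoszul {K : Type*} [Field K] {n : ℕ}
    {Q : Ideal (MvPolynomial (Fin n) K)} {g : GL (Fin n) K} {m : MonomialOrder (Fin (n + n))}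
    (hJ : ∀ f ∈ symDefiningIdeal Q g, ∀ u, IsLead m f u → QuadDvd m (symDefiningIdeal Q g) u) :
    ∃ _ : GradedAlgebra (symGrading Q), IsKoszul (K := K) (R := SymMax Q) (symGrading Q) :=
  exists_gradedAlgebra_isKoszul (R := SymMax Q) (π := symPresentation Q g)
    (symPresentation_surjective Q g) hJ (symGrading_eq Q g)

theorem theorem3p2 {K : Type*} [Field K] [Infinite K] (hchar : ringChar K ≠ 2) {n : ℕ}
    (Q : Ideal (MvPolynomial (Fin n) K))
    (hQ : Q.IsHomogeneous (homogeneousSubmodule (Fin n) K))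
    (hlin : Q.HasLinearResolution 2) :
    (∃ g : GL (Fin n) K,
      Function.Surjective (symPresentation Q g) ∧
      HasQuadraticGroebnerBasis (MonomialOrder.revLex (Fin (n + n))) (symDefiningIdeal Q g)) ∧
    ∃ _ : GradedAlgebra (symGrading Q), IsKoszul (K := K) (R := SymMax Q) (symGrading Q) := by
  obtain ⟨g, hg⟩ := hlin.exists_revLexGeneric (Ring.two_ne_zero hchar)
  -- Both conclusions follow from this divisibility statement alone.
  have hJ : ∀ f ∈ symDefiningIdeal Q g, ∀ u, IsLead (MonomialOrder.revLex (Fin (n + n))) f u →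
      QuadDvd (MonomialOrder.revLex (Fin (n + n))) (symDefiningIdeal Q g) u := fun _ hf _ hu =>
    hg.exists_isLead_le_of_mem_symDefiningIdeal hlin.linearPartHom_eq_zero hf hu
  exact ⟨⟨g, symPresentation_surjective Q g, hasQuadraticGroebnerBasis_of_forall_exists _ hJ⟩,
    exists_gradedAlgebra_symGrading_isKoszul hJ⟩
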